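/- Let $(F,g)$ be a smooth Riemannian manifold without boundary of dimension $f$ (Hausdorff and second countable; not necessarily compact, complete, connected or orientable), let $c>0$ be a real number, and let $C^*(F)=F\times(0,1)$ carry the metric $g_c=dr\otimes dr+r^{2c}\,\pi^*g$, where $r$ is the coordinate on $(0,1)$ and $\pi:C^*(F)\to F$ is the projection. For a Riemannian manifold $(M,h)$ let $L^2\Omega^i(M,h)$ be the Hilbert space of measurable square-integrable real $i$-forms, modulo equality almost everywhere. Let $d_{max,i}$ be the operator from $L^2\Omega^i(M,h)$ to $L^2\Omega^{i+1}(M,h)$ for which $\omega$ is in the domain, with $d_{max,i}\,\omega=\eta$, if and only if $\langle\omega,\delta\zeta\rangle=\langle\eta,\zeta\rangle$ for all smooth compactly supported $(i+1)$-forms $\zeta$; here $\delta$ is the formal adjoint of the exterior derivative $d$. Put $H^i_{2,max}(M,h)=\ker d_{max,i}/\operatorname{ran} d_{max,i-1}$ (with $\operatorname{ran} d_{max,-1}=0$). Assume that one of the following holds: 1. $c<1$; 2. $c\ge 1$ and $f$ is even; 3. $c\ge 1$, $f$ is odd, and $d_{max,\frac{f-1}{2}}$ has closed range in $L^2\Omega^{\frac{f+1}{2}}(F,g)$.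 Then for every integer $i\ge 0$: - if $i<\frac f2+\frac1{2c}$, the pullback $\omega\mapsto\pi^*\omega$ induces a linear isomorphism $H^i_{2,max}(F,g)\cong H^i_{2,max}(C^*(F),g_c)$; - if $i\ge\frac f2+\frac1{2c}$, then $H^i_{2,max}(C^*(F),g_c)=0$. -/

import Mathlib

open scoped Manifold ContDiff Topology
open MeasureTheory

noncomputable section

namespace ConeL2

set_option linter.unusedSectionVars false

section LinearAlgebra

variable {V : Type*} [AddCommGroup V] [Module ℝ V] [TopologicalSpace V]
  {ι : Type*}

/-- The Gram matrix of a bilinear form in a family of vectors. -/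
def gram (B : V →L[ℝ] V →L[ℝ] ℝ) (b : ι → V) : Matrix ι ι ℝ :=
  Matrix.of fun i j => B (b i) (b j)

theorem gram_posSemidef [Fintype ι] {B : V →L[ℝ] V →L[ℝ] ℝ} {b : ι → V}
    (hB : ∀ v w, B v w = B w v) (hB' : ∀ v, 0 ≤ B v v) : (gram B b).PosSemidef := by
  refine Matrix.PosSemidef.of_dotProduct_mulVec_nonneg ?_ ?_
  · ext i j; simp [gram, hB (b j) (b i)]
  · intro x
    have h : star x ⬝ᵥ (gram B b).mulVec x = B (∑ i, x i • b i) (∑ i, x i • b i) := by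
      simp [dotProduct, Matrix.mulVec, gram, map_sum, Finset.mul_sum]
      rw [Finset.sum_comm]
      refine Finset.sum_congr rfl fun p _ => Finset.sum_congr rfl fun q _ => ?_
      ring
    rw [h]; exact hB' _

variable [Fintype ι] [DecidableEq ι] {k : ℕ}

/-- The inner product of two alternating `k`-covectors `α`, `β` induced by an inner product `B`, in
a basis `b`: `(1 / k!) ∑ B^{i₁ j₁} ⋯ B^{iₖ jₖ} α_{i₁ … iₖ} β_{j₁ … jₖ}`. -/
def covInner (B : V →L[ℝ] V →L[ℝ] ℝ) (b : ι → V) (α β : V [⋀^Fin k]→L[ℝ] ℝ) : ℝ :=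
  ((k.factorial : ℝ))⁻¹ * ∑ p : Fin k → ι, ∑ q : Fin k → ι,
    (∏ a, (gram B b)⁻¹ (p a) (q a)) * α (fun a => b (p a)) * β (fun a => b (q a))

variable {B : V →L[ℝ] V →L[ℝ] ℝ} {b : ι → V}

theorem covInner_add_left (α α' β : V [⋀^Fin k]→L[ℝ] ℝ) :
    covInner B b (α + α') β = covInner B b α β + covInner B b α' β := by
  simp only [covInner, ContinuousAlternatingMap.add_apply, mul_add, add_mul, Finset.sum_add_distrib]

theorem covInner_smul_left (c : ℝ) (α β : V [⋀^Fin k]→L[ℝ] ℝ) :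
    covInner B b (c • α) β = c * covInner B b α β := by
  simp only [covInner, ContinuousAlternatingMap.smul_apply, smul_eq_mul, Finset.mul_sum]
  refine Finset.sum_congr rfl fun p _ => Finset.sum_congr rfl fun q _ => ?_
  ring

theorem covInner_comm (hB : ∀ v w, B v w = B w v) (α β : V [⋀^Fin k]→L[ℝ] ℝ) :
    covInner B b α β = covInner B b β α := by
  have hG : (gram B b).transpose = gram B b := by
    ext i j; simp [gram, hB (b j) (b i)]
  have hG' : ∀ i j, (gram B b)⁻¹ i j = (gram B b)⁻¹ j i := by
    intro i j
    conv_lhs => rw [← hG, ← Matrix.transpose_nonsing_inv]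
    rfl
  unfold covInner
  rw [Finset.sum_comm]
  congr 1
  refine Finset.sum_congr rfl fun p _ => Finset.sum_congr rfl fun q _ => ?_
  rw [Finset.prod_congr rfl fun a _ => hG' (q a) (p a)]
  ring

open scoped MatrixOrder in
theorem sum_prod_mul_nonneg {A : Matrix ι ι ℝ} (hA : A.PosSemidef) (x : (Fin k → ι) → ℝ) :
    0 ≤ ∑ p : Fin k → ι, ∑ q : Fin k → ι, (∏ a, A (p a) (q a)) * x p * x q := by
  obtain ⟨C, rfl⟩ : ∃ C : Matrix ι ι ℝ, A = C.conjTranspose * C := by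
    exact CStarAlgebra.nonneg_iff_eq_star_mul_self.1 hA.nonneg
  have h : ∀ p q : Fin k → ι, ∏ a, (C.conjTranspose * C) (p a) (q a)
      = ∑ r : Fin k → ι, (∏ a, C (r a) (p a)) * ∏ a, C (r a) (q a) := by
    intro p q
    simp only [Matrix.mul_apply, Matrix.conjTranspose_apply, star_trivial]
    rw [Finset.prod_univ_sum]
    simp [Finset.prod_mul_distrib, Fintype.piFinset_univ]
  have h2 : ∑ p : Fin k → ι, ∑ q : Fin k → ι, (∏ a, (C.conjTranspose * C) (p a) (q a)) * x p * x q
      = ∑ r : Fin k → ι, (∑ p : Fin k → ι, (∏ a, C (r a) (p a)) * x p) ^ 2 := by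
    simp only [h, sq, Finset.sum_mul_sum]
    simp only [Finset.sum_mul]
    rw [Finset.sum_congr rfl fun p _ => Finset.sum_comm, Finset.sum_comm]
    refine Finset.sum_congr rfl fun r _ => Finset.sum_congr rfl fun p _ =>
      Finset.sum_congr rfl fun q _ => ?_
    ring
  rw [h2]
  positivity

theorem covInner_self_nonneg (hB : ∀ v w, B v w = B w v) (hB' : ∀ v, 0 ≤ B v v)
    (α : V [⋀^Fin k]→L[ℝ] ℝ) : 0 ≤ covInner B b α α :=
  mul_nonneg (by positivity) (sum_prod_mul_nonneg (gram_posSemidef hB hB').inv _)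

/-- `covInner` does not depend on the basis. -/
theorem covInner_change_basis {b' : ι → V} {P : Matrix ι ι ℝ} (hP : IsUnit P.det)
    (hb : ∀ j, b' j = ∑ i, P i j • b i) (α β : V [⋀^Fin k]→L[ℝ] ℝ) :
    covInner B b' α β = covInner B b α β := by
  have hG : gram B b' = P.transpose * gram B b * P := by
    ext i j
    simp only [gram, Matrix.of_apply, hb, map_sum, map_smul, _root_.sum_apply,
      _root_.smul_apply, smul_eq_mul, Matrix.mul_apply, Matrix.transpose_apply,
      Finset.sum_mul]
    refine Finset.sum_congr rfl fun p _ => ?_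
    rw [Finset.mul_sum]
    refine Finset.sum_congr rfl fun q _ => ?_
    ring
  have hGi : P * (gram B b')⁻¹ * P.transpose = (gram B b)⁻¹ := by
    have hPt : IsUnit P.transpose.det := by rwa [Matrix.det_transpose]
    rw [hG, Matrix.mul_inv_rev, Matrix.mul_inv_rev, ← Matrix.mul_assoc, ← Matrix.mul_assoc,
      Matrix.mul_nonsing_inv _ hP, Matrix.one_mul, Matrix.mul_assoc, Matrix.nonsing_inv_mul _ hPt,
      Matrix.mul_one]
  have hα : ∀ (γ : V [⋀^Fin k]→L[ℝ] ℝ) (p : Fin k → ι), γ (fun a => b' (p a))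
      = ∑ r : Fin k → ι, (∏ a, P (r a) (p a)) * γ (fun a => b (r a)) := by
    intro γ p
    simp only [hb]
    have := γ.toMultilinearMap.map_sum (fun a i => P i (p a) • b i)
    refine this.trans (Finset.sum_congr rfl fun r _ => ?_)
    exact γ.toMultilinearMap.map_smul_univ (fun a => P (r a) (p a)) (fun a => b (r a))
  have hprod : ∀ r s : Fin k → ι, ∏ a, (gram B b)⁻¹ (r a) (s a) = ∑ p : Fin k → ι,
      ∑ q : Fin k → ι, (∏ a, P (r a) (p a)) * (∏ a, (gram B b')⁻¹ (p a) (q a))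
        * ∏ a, P (s a) (q a) := by
    intro r s
    simp only [← hGi, Matrix.mul_apply, Matrix.transpose_apply, Finset.sum_mul]
    rw [Finset.prod_univ_sum, Fintype.piFinset_univ, Finset.sum_comm]
    refine Finset.sum_congr rfl fun q _ => ?_
    rw [Finset.prod_univ_sum, Fintype.piFinset_univ]
    simp [Finset.prod_mul_distrib]
  unfold covInner
  congr 1
  have hsum : ∀ T : (Fin k → ι) → (Fin k → ι) → (Fin k → ι) → (Fin k → ι) → ℝ,
      ∑ r, ∑ s, ∑ p, ∑ q, T r s p q = ∑ p, ∑ q, ∑ r, ∑ s, T r s p q := by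
    intro T
    rw [Finset.sum_congr rfl fun r _ => Finset.sum_comm, Finset.sum_comm]
    refine Finset.sum_congr rfl fun p _ => ?_
    rw [Finset.sum_congr rfl fun r _ => Finset.sum_comm, Finset.sum_comm]
  simp only [hprod, Finset.sum_mul]
  rw [hsum]
  refine Finset.sum_congr rfl fun p _ => Finset.sum_congr rfl fun q _ => ?_
  rw [hα α, hα β, mul_assoc, Finset.sum_mul_sum, Finset.mul_sum]
  refine Finset.sum_congr rfl fun r _ => ?_
  rw [Finset.mul_sum]
  refine Finset.sum_congr rfl fun s _ => ?_
  ring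

end LinearAlgebra

section Forms

variable {E : Type*} [NormedAddCommGroup E] [NormedSpace ℝ E]
  {H : Type*} [TopologicalSpace H] (I : ModelWithCorners ℝ E H)
  {M : Type*} [TopologicalSpace M] [ChartedSpace H M] [IsManifold I ∞ M]

/-- The coordinate vector at `x` with components `v` in the preferred chart at `x₀`: the image of
`v` under the derivative of the inverse of that chart. -/
def chartVec (x₀ x : M) : E →L[ℝ] TangentSpace I x :=
  (trivializationAt E (TangentSpace I) x₀).symmL ℝ x

/-- The coordinate frame `∂₁, …, ∂ₙ` at `x` of the preferred chart at `x₀`. -/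
def coordFrame [FiniteDimensional ℝ E] (x₀ x : M) :
    Fin (Module.finrank ℝ E) → TangentSpace I x :=
  fun i => chartVec I x₀ x (Module.finBasis ℝ E i)

/-- (Arbitrary, not necessarily smooth or measurable) differential forms of degree `k`. -/
abbrev DForm (M : Type*) [TopologicalSpace M] [ChartedSpace H M] (k : ℕ) : Type _ :=
  (x : M) → TangentSpace I x [⋀^Fin k]→L[ℝ] ℝ

variable {I} {k : ℕ}

/-- The coordinate expression of a differential form in the preferred chart at `x₀`. -/
def DForm.inChart (φ : DForm I M k) (x₀ : M) (y : E) : E [⋀^Fin k]→L[ℝ] ℝ :=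
  (φ ((extChartAt I x₀).symm y)).compContinuousLinearMap
    (chartVec I x₀ ((extChartAt I x₀).symm y))

/-- Smooth differential forms: the coordinate expressions are smooth. -/
def DForm.IsSmooth (φ : DForm I M k) : Prop :=
  ∀ x₀ : M, ContDiffOn ℝ ∞ (φ.inChart x₀) (extChartAt I x₀).target

/-- Smooth differential forms with compact support. -/
def DForm.IsTest (φ : DForm I M k) : Prop :=
  φ.IsSmooth ∧ ∃ K : Set M, IsCompact K ∧ ∀ x ∉ K, φ x = 0

/-- The exterior derivative of a differential form, computed at each point in the preferred chart
at this point. -/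
def DForm.d (φ : DForm I M k) : DForm I M (k + 1) := fun x =>
  (extDeriv (φ.inChart x) (extChartAt I x x)).compContinuousLinearMap
    ((trivializationAt E (TangentSpace I) x).continuousLinearMapAt ℝ x)

/-- Borel measurable differential forms: the components in every chart are measurable. -/
def DForm.IsMeasurable [MeasurableSpace M] (φ : DForm I M k) : Prop :=
  ∀ (x₀ : M) (v : Fin k → E), Measurable fun x : (chartAt H x₀).source =>
    φ x fun j => chartVec I x₀ x (v j)

end Forms

section Metric

variable {E : Type*} [NormedAddCommGroup E] [NormedSpace ℝ E] [FiniteDimensional ℝ E]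
  {H : Type*} [TopologicalSpace H] {I : ModelWithCorners ℝ E H}
  {M : Type*} [TopologicalSpace M] [ChartedSpace H M] [IsManifold I ∞ M] {k : ℕ}

variable (I M) in
/-- Smooth Riemannian metrics on `M`. -/
abbrev RiemMetric : Type _ := Bundle.ContMDiffRiemannianMetric I ∞ E (fun x : M => TangentSpace I x)

/-- The inner product of `k`-covectors at `x` induced by a Riemannian metric. -/
def formInner (g : RiemMetric I M) (x : M) (α β : TangentSpace I x [⋀^Fin k]→L[ℝ] ℝ) : ℝ :=
  covInner (g.inner x) (coordFrame I x x) α β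

/-- The Riemannian measure read in the preferred chart at `x₀` (a measure on `M` concentrated on the
domain of the chart): `√(det gᵢⱼ) dx¹ ⋯ dxⁿ`. -/
def chartVolume [MeasurableSpace E] [BorelSpace E] [MeasurableSpace M]
    (g : RiemMetric I M) (x₀ : M) : Measure M :=
  (((Module.finBasis ℝ E).addHaar.restrict (extChartAt I x₀).target).withDensity fun y =>
    ENNReal.ofReal √(gram (g.inner ((extChartAt I x₀).symm y))
      (coordFrame I x₀ ((extChartAt I x₀).symm y))).det).map (extChartAt I x₀).symm

/-- The Riemannian measure: the least measure on `M` which dominates `√(det gᵢⱼ) dx¹ ⋯ dxⁿ` in every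
chart. Since these measures agree on the overlaps of charts, it coincides with
`√(det gᵢⱼ) dx¹ ⋯ dxⁿ` on each of them. -/
def riemVolume [MeasurableSpace E] [BorelSpace E] [MeasurableSpace M] (g : RiemMetric I M) :
    Measure M :=
  ⨆ x₀ : M, chartVolume g x₀

theorem formInner_add_left (g : RiemMetric I M) (x : M) (α α' β : TangentSpace I x [⋀^Fin k]→L[ℝ] ℝ) :
    formInner g x (α + α') β = formInner g x α β + formInner g x α' β :=
  covInner_add_left _ _ _

theorem formInner_smul_left (g : RiemMetric I M) (x : M) (c : ℝ)
    (α β : TangentSpace I x [⋀^Fin k]→L[ℝ] ℝ) :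
    formInner g x (c • α) β = c * formInner g x α β :=
  covInner_smul_left _ _ _

theorem formInner_comm (g : RiemMetric I M) (x : M) (α β : TangentSpace I x [⋀^Fin k]→L[ℝ] ℝ) :
    formInner g x α β = formInner g x β α :=
  covInner_comm (g.symm x) _ _

theorem RiemMetric.nonneg (g : RiemMetric I M) (x : M) (v : TangentSpace I x) : 0 ≤ g.inner x v v := by
  rcases eq_or_ne v 0 with rfl | hv
  · simp
  · exact (g.pos x v hv).le

theorem formInner_self_nonneg (g : RiemMetric I M) (x : M) (α : TangentSpace I x [⋀^Fin k]→L[ℝ] ℝ) :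
    0 ≤ formInner g x α α :=
  covInner_self_nonneg (g.symm x) (RiemMetric.nonneg g x) _

theorem formInner_add_add (g : RiemMetric I M) (x : M) (α β : TangentSpace I x [⋀^Fin k]→L[ℝ] ℝ) :
    formInner g x (α + β) (α + β)
      = formInner g x α α + 2 * formInner g x α β + formInner g x β β := by
  rw [formInner_add_left, formInner_comm g x α (α + β), formInner_comm g x β (α + β),
    formInner_add_left, formInner_add_left, formInner_comm g x β α]
  ring

theorem abs_formInner_le (g : RiemMetric I M) (x : M) (α β : TangentSpace I x [⋀^Fin k]→L[ℝ] ℝ) :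
    |formInner g x α β| ≤ formInner g x α α + formInner g x β β := by
  have h1 := formInner_self_nonneg g x (α + β)
  have h2 := formInner_self_nonneg g x (α + (-1 : ℝ) • β)
  have hb := formInner_self_nonneg g x β
  have ha := formInner_self_nonneg g x α
  rw [formInner_add_add] at h1 h2
  rw [formInner_comm g x α ((-1 : ℝ) • β), formInner_smul_left, formInner_smul_left,
    formInner_comm g x β ((-1 : ℝ) • β), formInner_smul_left, formInner_comm g x β α] at h2
  rw [abs_le]
  constructor <;> linarith

theorem formInner_eq_coordFrame (g : RiemMetric I M) {x₀ x : M} (hx : x ∈ (chartAt H x₀).source)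
    (α β : TangentSpace I x [⋀^Fin k]→L[ℝ] ℝ) :
    formInner g x α β = covInner (g.inner x) (coordFrame I x₀ x) α β := by
  let b := Module.finBasis ℝ E
  let e := trivializationAt E (TangentSpace I : M → Type _) x
  let e₀ := trivializationAt E (TangentSpace I : M → Type _) x₀
  have hx0 : x ∈ e₀.baseSet := by simpa [e₀] using hx
  have hx1 : x ∈ e.baseSet := FiberBundle.mem_baseSet_trivializationAt' x
  let L : E ≃L[ℝ] E := (e.continuousLinearEquivAt ℝ x hx1).symm.trans
    (e₀.continuousLinearEquivAt ℝ x hx0)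
  let P : Matrix _ _ ℝ := LinearMap.toMatrix b b (L : E →ₗ[ℝ] E)
  refine covInner_change_basis (P := P) ?_ ?_ α β
  · exact LinearEquiv.isUnit_det L.toLinearEquiv b b
  · intro j
    have h1 : ∑ i, P i j • b i = L (b j) := by
      simp [P, LinearMap.toMatrix_apply, b.sum_repr]
    have h2 : ∀ v, chartVec I x₀ x v = (e₀.continuousLinearEquivAt ℝ x hx0).symm v := fun v => by
      rw [chartVec, ← Bundle.Trivialization.symm_continuousLinearEquivAt_eq _ hx0]
    have h3 : ∀ v, chartVec I x x v = (e.continuousLinearEquivAt ℝ x hx1).symm v := fun v => by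
      rw [chartVec, ← Bundle.Trivialization.symm_continuousLinearEquivAt_eq _ hx1]
    have h4 : ∑ i, P i j • coordFrame I x₀ x i = chartVec I x₀ x (∑ i, P i j • b i) := by
      simp [coordFrame, b, map_sum]
    rw [h4, h1, h2, coordFrame, h3]
    change _ = (e₀.continuousLinearEquivAt ℝ x hx0).symm ((e₀.continuousLinearEquivAt ℝ x hx0) _)
    rw [ContinuousLinearEquiv.symm_apply_apply]
    rfl

theorem continuous_gram (g : RiemMetric I M) (x₀ : M) :
    Continuous fun x : (chartAt H x₀).source => gram (g.inner x) (coordFrame I x₀ x) := by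
  refine continuous_matrix fun i j => ?_
  have hv : ∀ i, ContMDiffOn I (I.prod 𝓘(ℝ, E)) ∞ (fun x => Bundle.TotalSpace.mk' E x
      (coordFrame I x₀ x i)) (chartAt H x₀).source := by
    intro i
    have hs : (chartAt H x₀).source
        = (trivializationAt E (TangentSpace I : M → Type _) x₀).baseSet := by simp
    rw [hs, (trivializationAt E (TangentSpace I : M → Type _) x₀).contMDiffOn_section_baseSet_iff]
    refine (contMDiffOn_const (c := Module.finBasis ℝ E i)).congr fun y hy => ?_
    simp only [coordFrame, chartVec]
    rw [Bundle.Trivialization.symmL_apply _ hy, Bundle.Trivialization.mk_symm _ hy,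
      Bundle.Trivialization.apply_symm_apply' _ hy]
  have h := (g.contMDiff.contMDiffOn (s := (chartAt H x₀).source)).clm_bundle_apply₂
    (F₃ := ℝ) (E₃ := Bundle.Trivial M ℝ) (hv i) (hv j)
  have h' := fun x hx => (Bundle.contMDiffWithinAt_totalSpace.1 (h x hx)).2
  have h2 : ContinuousOn (fun x => g.inner x (coordFrame I x₀ x i) (coordFrame I x₀ x j))
      (chartAt H x₀).source := fun x hx => (h' x hx).continuousWithinAt
  exact h2.domRestrict

theorem measurable_formInner [MeasurableSpace M] [BorelSpace M] [SecondCountableTopology M]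
    (g : RiemMetric I M) {φ η : DForm I M k} (hφ : φ.IsMeasurable) (hη : η.IsMeasurable) :
    Measurable fun x => formInner g x (φ x) (η x) := by
  have h : ∀ x₀ : M, Measurable fun x : (chartAt H x₀).source =>
      formInner g (x : M) (φ x) (η x) := by
    intro x₀
    have h1 : (fun x : (chartAt H x₀).source => formInner g (x : M) (φ x) (η x)) =
        fun x : (chartAt H x₀).source =>
          covInner (g.inner x) (coordFrame I x₀ (x : M)) (φ x) (η x) :=
      funext fun x => formInner_eq_coordFrame g x.2 _ _
    rw [h1]
    have hG := continuous_gram g x₀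
    have hGi : ∀ i j, Measurable fun x : (chartAt H x₀).source =>
        (gram (g.inner x) (coordFrame I x₀ (x : M)))⁻¹ i j := by
      intro i j
      simp only [Matrix.inv_def, Matrix.smul_apply, Ring.inverse_eq_inv', smul_eq_mul]
      exact (hG.matrix_det.measurable.inv).mul (hG.matrix_adjugate.matrix_elem i j).measurable
    unfold covInner
    refine Measurable.const_mul (Finset.measurable_sum _ fun p _ => Finset.measurable_sum _
      fun q _ => ?_) _
    exact ((Finset.measurable_prod _ fun a _ => hGi _ _).mul (hφ x₀ _)).mul (hη x₀ _)
  obtain ⟨s, hs, hs'⟩ := TopologicalSpace.countable_cover_nhds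
    (f := fun x₀ : M => (chartAt H x₀).source) fun x₀ =>
      (chartAt H x₀).open_source.mem_nhds (mem_chart_source H x₀)
  intro t ht
  have : (fun x => formInner g x (φ x) (η x)) ⁻¹' t = ⋃ x₀ ∈ s, Subtype.val ''
      ((fun x : (chartAt H x₀).source => formInner g (x : M) (φ x) (η x)) ⁻¹' t) := by
    ext x
    rw [Set.mem_iUnion₂]
    constructor
    · intro hx
      have := hs' ▸ Set.mem_univ x
      rw [Set.mem_iUnion₂] at this
      obtain ⟨x₀, h1, h2⟩ := this
      exact ⟨x₀, h1, ⟨x, h2⟩, hx, rfl⟩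
    · rintro ⟨x₀, h1, y, hx, rfl⟩
      exact hx
  rw [this]
  exact MeasurableSet.biUnion hs fun x₀ _ =>
    (chartAt H x₀).open_source.measurableSet.subtype_image (h x₀ ht)

end Metric
section Cohomology

variable {E : Type*} [NormedAddCommGroup E] [NormedSpace ℝ E] [FiniteDimensional ℝ E]
  [MeasurableSpace E] [BorelSpace E]
  {H : Type*} [TopologicalSpace H] {I : ModelWithCorners ℝ E H}
  {M : Type*} [TopologicalSpace M] [ChartedSpace H M] [IsManifold I ∞ M]
  [MeasurableSpace M] [BorelSpace M] [SecondCountableTopology M]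

theorem integrable_formInner {k : ℕ} (g : RiemMetric I M) {φ η : DForm I M k}
    (hφ : φ.IsMeasurable) (hη : η.IsMeasurable)
    (hφ' : Integrable (fun x => formInner g x (φ x) (φ x)) (riemVolume g))
    (hη' : Integrable (fun x => formInner g x (η x) (η x)) (riemVolume g)) :
    Integrable (fun x => formInner g x (φ x) (η x)) (riemVolume g) :=
  (hφ'.add hη').mono' (measurable_formInner g hφ hη).aestronglyMeasurable
    (Filter.Eventually.of_forall fun x => abs_formInner_le g x _ _)

/-- The space of measurable, square integrable differential forms of degree `k`. -/
def sqIntegrable (g : RiemMetric I M) (k : ℕ) : Submodule ℝ (DForm I M k) where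
  carrier := {φ | φ.IsMeasurable ∧
    Integrable (fun x => formInner g x (φ x) (φ x)) (riemVolume g)}
  zero_mem' := by
    refine ⟨fun x₀ v => measurable_const, ?_⟩
    have : ∀ x, formInner g x ((0 : DForm I M k) x) ((0 : DForm I M k) x) = 0 := fun x => by
      have h := formInner_smul_left g x (0 : ℝ) (0 : TangentSpace I x [⋀^Fin k]→L[ℝ] ℝ) 0
      rwa [zero_smul, zero_mul] at h
    simp only [this]
    exact integrable_zero _ _ _
  add_mem' := by
    rintro φ η ⟨hφ, hφ'⟩ ⟨hη, hη'⟩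
    refine ⟨fun x₀ v => (hφ x₀ v).add (hη x₀ v), ?_⟩
    have : ∀ x, formInner g x ((φ + η) x) ((φ + η) x) = formInner g x (φ x) (φ x)
        + 2 * formInner g x (φ x) (η x) + formInner g x (η x) (η x) :=
      fun x => formInner_add_add g x _ _
    simp only [this]
    exact (hφ'.add ((integrable_formInner g hφ hη hφ' hη').const_mul 2)).add hη'
  smul_mem' := by
    rintro c φ ⟨hφ, hφ'⟩
    refine ⟨fun x₀ v => (hφ x₀ v).const_mul c, ?_⟩
    have : ∀ x, formInner g x ((c • φ) x) ((c • φ) x) = c * (c * formInner g x (φ x) (φ x)) := by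
      intro x
      change formInner g x (c • φ x) (c • φ x) = _
      rw [formInner_smul_left, formInner_comm, formInner_smul_left]
    simp only [this]
    exact (hφ'.const_mul c).const_mul c

/-- Measurable, square integrable differential forms of degree `k` (before identification of forms
which are equal almost everywhere). -/
def SqIntForm (g : RiemMetric I M) (k : ℕ) : Type _ := sqIntegrable g k

instance (g : RiemMetric I M) (k : ℕ) : AddCommGroup (SqIntForm g k) :=
  inferInstanceAs (AddCommGroup (sqIntegrable g k))

instance (g : RiemMetric I M) (k : ℕ) : Module ℝ (SqIntForm g k) :=
  inferInstanceAs (Module ℝ (sqIntegrable g k))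

/-- The `L²` inner product `∫ ⟨φ, η⟩ dvol` on square integrable forms. -/
@[reducible] def l2Core (g : RiemMetric I M) (k : ℕ) : PreInnerProductSpace.Core ℝ (SqIntForm g k) where
  inner φ η := ∫ x, formInner g x (φ.1 x) (η.1 x) ∂(riemVolume g)
  conj_inner_symm φ η := by
    simp only [formInner_comm g _ (η.1 _) (φ.1 _)]
    exact conj_trivial _
  re_inner_nonneg φ := integral_nonneg fun x => formInner_self_nonneg g x _
  add_left φ φ' η := by
    rw [← integral_add (integrable_formInner g φ.2.1 η.2.1 φ.2.2 η.2.2)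
      (integrable_formInner g φ'.2.1 η.2.1 φ'.2.2 η.2.2)]
    exact integral_congr_ae (Filter.Eventually.of_forall fun x => formInner_add_left g x _ _ _)
  smul_left φ η c := by
    rw [conj_trivial, ← integral_const_mul]
    exact integral_congr_ae (Filter.Eventually.of_forall fun x => formInner_smul_left g x _ _ _)

instance (g : RiemMetric I M) (k : ℕ) : SeminormedAddCommGroup (SqIntForm g k) :=
  @InnerProductSpace.Core.toSeminormedAddCommGroup ℝ _ _ _ _ (l2Core g k)

instance (g : RiemMetric I M) (k : ℕ) : InnerProductSpace ℝ (SqIntForm g k) :=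
  InnerProductSpace.ofCore (l2Core g k)

/-- The Hilbert space `L²Ωᵏ(M, g)`: square integrable forms modulo equality almost everywhere, that
is, modulo forms of `L²` seminorm zero. -/
abbrev L2Form (g : RiemMetric I M) (k : ℕ) : Type _ := SeparationQuotient (SqIntForm g k)

/-- The class in `L²Ωᵏ(M, g)` of a square integrable form. -/
def L2Form.mk {g : RiemMetric I M} {k : ℕ} (φ : SqIntForm g k) : L2Form g k := SeparationQuotient.mk φ

/-- `θ = δ ζ`, where `δ` is the formal adjoint of `d`: `⟨dχ, ζ⟩ = ⟨χ, θ⟩` in `L²` for all smooth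
compactly supported forms `χ`. It is used for smooth compactly supported `ζ` and `θ`; then `θ` is
uniquely determined by `ζ`. -/
def IsCodifferential (g : RiemMetric I M) {k : ℕ} (ζ : DForm I M (k + 1)) (θ : DForm I M k) : Prop :=
  ∀ χ : DForm I M k, χ.IsTest →
    ∫ x, formInner g x (χ.d x) (ζ x) ∂(riemVolume g)
      = ∫ x, formInner g x (χ x) (θ x) ∂(riemVolume g)

/-- The graph of the maximal extension `d_max` of the exterior derivative on forms of degree `k`:
the pairs `(φ, η)` in `L²Ωᵏ × L²Ωᵏ⁺¹` with `⟨φ, δ ζ⟩ = ⟨η, ζ⟩` for all smooth compactly supported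
forms `ζ` of degree `k + 1`. -/
def dMaxGraph (g : RiemMetric I M) (k : ℕ) : Submodule ℝ (L2Form g k × L2Form g (k + 1)) where
  carrier := {p | ∀ (ζ : SqIntForm g (k + 1)) (θ : SqIntForm g k), ζ.1.IsTest → θ.1.IsTest →
    IsCodifferential g ζ.1 θ.1 → inner ℝ p.1 (L2Form.mk θ) = inner ℝ p.2 (L2Form.mk ζ)}
  zero_mem' := by
    intro ζ θ _ _ _
    simp
  add_mem' := by
    intro p q hp hq ζ θ h1 h2 h3
    simp only [Prod.fst_add, Prod.snd_add, inner_add_left, hp ζ θ h1 h2 h3, hq ζ θ h1 h2 h3]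
  smul_mem' := by
    intro c p hp ζ θ h1 h2 h3
    simp only [Prod.smul_fst, Prod.smul_snd, inner_smul_left, hp ζ θ h1 h2 h3]

/-- The kernel of `d_max` in `L²Ωᵏ`. -/
def dMaxKer (g : RiemMetric I M) (k : ℕ) : Submodule ℝ (L2Form g k) :=
  (dMaxGraph g k).comap (LinearMap.inl ℝ (L2Form g k) (L2Form g (k + 1)))

/-- The range in `L²Ωᵏ⁺¹` of `d_max`, defined on forms of degree `k`. -/
def dMaxRange (g : RiemMetric I M) (k : ℕ) : Submodule ℝ (L2Form g (k + 1)) :=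
  (dMaxGraph g k).map (LinearMap.snd ℝ (L2Form g k) (L2Form g (k + 1)))

/-- The coboundaries of degree `k` of the complex `(L²Ω*, d_max)`. -/
def l2Coboundaries (g : RiemMetric I M) : (k : ℕ) → Submodule ℝ (L2Form g k)
  | 0 => ⊥
  | k + 1 => dMaxRange g k

/-- The maximal `L²` cohomology `Hᵏ_{2,max}(M, g) = ker d_max / ran d_max`. -/
abbrev L2Cohomology (g : RiemMetric I M) (k : ℕ) : Type _ :=
  dMaxKer g k ⧸ (l2Coboundaries g k).comap (dMaxKer g k).subtype

end Cohomology

section Cone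

/-- The interval `(0, 1)` as an open submanifold of the line. -/
abbrev unitIoo : TopologicalSpace.Opens ℝ := ⟨Set.Ioo 0 1, isOpen_Ioo⟩

variable {E : Type*} [NormedAddCommGroup E] [NormedSpace ℝ E] [FiniteDimensional ℝ E]
  {H : Type*} [TopologicalSpace H] {I : ModelWithCorners ℝ E H}
  {F : Type*} [TopologicalSpace F] [ChartedSpace H F] [IsManifold I ∞ F]

/-- The differential of the projection `F × (0, 1) → F`. -/
def dProj (p : F × unitIoo) : TangentSpace (I.prod 𝓘(ℝ, ℝ)) p →L[ℝ] TangentSpace I p.1 :=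
  mfderiv (I.prod 𝓘(ℝ, ℝ)) I Prod.fst p

/-- The differential `dr` of the radial coordinate `r : F × (0, 1) → ℝ`. -/
def dRad (p : F × unitIoo) : TangentSpace (I.prod 𝓘(ℝ, ℝ)) p →L[ℝ] ℝ :=
  mfderiv (I.prod 𝓘(ℝ, ℝ)) 𝓘(ℝ, ℝ) (fun q : F × unitIoo => (q.2 : ℝ)) p

/-- The symmetric tensor `dr ⊗ dr + r^{2c} π^* g` at a point of `F × (0, 1)`. -/
def coneInner (g : RiemMetric I F) (c : ℝ) (p : F × unitIoo) :
    TangentSpace (I.prod 𝓘(ℝ, ℝ)) p →L[ℝ] TangentSpace (I.prod 𝓘(ℝ, ℝ)) p →L[ℝ] ℝ :=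
  (dRad p).smulRight (dRad p) + ((p.2 : ℝ) ^ (2 * c)) •
    ((dProj p).precomp ℝ).comp ((g.inner p.1).comp (dProj p))

theorem coneInner_apply (g : RiemMetric I F) (c : ℝ) (p : F × unitIoo)
    (v w : TangentSpace (I.prod 𝓘(ℝ, ℝ)) p) :
    coneInner g c p v w = dRad p v * dRad p w
      + (p.2 : ℝ) ^ (2 * c) * g.inner p.1 (dProj p v) (dProj p w) := rfl

theorem eq_zero_of_dRad_dProj {p : F × unitIoo} {v : TangentSpace (I.prod 𝓘(ℝ, ℝ)) p}
    (h1 : dRad p v = 0) (h2 : dProj p v = 0) : v = 0 := by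
  have h3 : mfderiv (I.prod 𝓘(ℝ, ℝ)) 𝓘(ℝ, ℝ) (fun q : F × unitIoo => (q.2 : ℝ)) p =
      (mfderiv 𝓘(ℝ, ℝ) 𝓘(ℝ, ℝ) (Subtype.val : unitIoo → ℝ) p.2).comp
        (mfderiv (I.prod 𝓘(ℝ, ℝ)) 𝓘(ℝ, ℝ) Prod.snd p) :=
    mfderiv_comp p ((contMDiff_subtype_val (n := 1)).mdifferentiable one_ne_zero _)
      mdifferentiableAt_snd
  have h4 : (mfderiv 𝓘(ℝ, ℝ) 𝓘(ℝ, ℝ) (Subtype.val : unitIoo → ℝ) p.2).IsInvertible := by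
    have h5 : (Subtype.val : unitIoo → ℝ) = extChartAt 𝓘(ℝ, ℝ) p.2 := by
      ext x; rfl
    rw [h5]
    exact isInvertible_mfderiv_extChartAt (mem_extChartAt_source _)
  rw [dProj, mfderiv_fst] at h2
  rw [dRad, h3, mfderiv_snd] at h1
  have h6 : v.2 = 0 := h4.injective (Eq.trans h1 (map_zero _).symm)
  exact Prod.ext h2 h6

theorem isVonNBounded_of_pos {E : Type*} [NormedAddCommGroup E] [NormedSpace ℝ E]
    [FiniteDimensional ℝ E] (B : E →L[ℝ] E →L[ℝ] ℝ) (hB : ∀ v, v ≠ 0 → 0 < B v v) :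
    Bornology.IsVonNBounded ℝ {v : E | B v v < 1} := by
  rw [NormedSpace.isVonNBounded_iff]
  have hc : Continuous fun v : E => B v v := by fun_prop
  rcases (Metric.sphere (0 : E) 1).eq_empty_or_nonempty with h | h
  · refine (Bornology.isBounded_singleton (x := (0 : E))).subset fun v _ => ?_
    by_contra hv
    have : ‖v‖⁻¹ • v ∈ Metric.sphere (0 : E) 1 := by
      simp [norm_smul, inv_mul_cancel₀ (norm_ne_zero_iff.2 hv)]
    simp [h] at this
  · obtain ⟨u, hu, hmin⟩ := (isCompact_sphere (0 : E) 1).exists_isMinOn h hc.continuousOn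
    have hu0 : u ≠ 0 := by
      rintro rfl; simp at hu
    have hm := hB u hu0
    refine (Metric.isBounded_closedBall (x := (0 : E)) (r := √(1 / B u u))).subset fun v hv => ?_
    rw [mem_closedBall_zero_iff]
    rcases eq_or_ne v 0 with rfl | hv0
    · simp
    · have hn : ‖v‖ ≠ 0 := norm_ne_zero_iff.2 hv0
      have h1 : ‖v‖⁻¹ • v ∈ Metric.sphere (0 : E) 1 := by
        simp [norm_smul, inv_mul_cancel₀ hn]
      have h2 : B u u ≤ B (‖v‖⁻¹ • v) (‖v‖⁻¹ • v) := hmin h1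
      have h3 : B (‖v‖⁻¹ • v) (‖v‖⁻¹ • v) * ‖v‖ ^ 2 = B v v := by
        simp only [map_smul, _root_.smul_apply, smul_eq_mul]
        field_simp
      have h4 : B v v < 1 := hv
      apply Real.le_sqrt_of_sq_le
      rw [le_div_iff₀ hm]
      nlinarith [sq_nonneg ‖v‖]

theorem coneInner_pos (g : RiemMetric I F) (c : ℝ) (p : F × unitIoo)
    (v : TangentSpace (I.prod 𝓘(ℝ, ℝ)) p) (hv : v ≠ 0) : 0 < coneInner g c p v v := by
  rw [coneInner_apply]
  have hr : 0 < (p.2 : ℝ) ^ (2 * c) := Real.rpow_pos_of_pos p.2.2.1 _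
  by_cases h2 : dProj p v = 0
  · have h1 : dRad p v ≠ 0 := fun h1 => hv (eq_zero_of_dRad_dProj h1 h2)
    have := mul_self_pos.2 h1
    simpa [h2] using this
  · have := mul_pos hr (g.pos p.1 _ h2)
    have h0 := mul_self_nonneg (dRad p v)
    linarith

theorem contMDiff_pullback_bilin
    {E' : Type*} [NormedAddCommGroup E'] [NormedSpace ℝ E']
    {H' : Type*} [TopologicalSpace H'] {J : ModelWithCorners ℝ E' H'}
    {N : Type*} [TopologicalSpace N] [ChartedSpace H' N] [IsManifold J ∞ N]
    {f : N → F} (hf : ContMDiff J I ∞ f)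
    {B : (x : F) → TangentSpace I x →L[ℝ] TangentSpace I x →L[ℝ] ℝ}
    (hB : ContMDiff I (I.prod 𝓘(ℝ, E →L[ℝ] E →L[ℝ] ℝ)) ∞
      fun x : F => Bundle.TotalSpace.mk' (E →L[ℝ] E →L[ℝ] ℝ)
        (E := fun x : F => TangentSpace I x →L[ℝ] TangentSpace I x →L[ℝ] ℝ) x (B x)) :
    ContMDiff J (J.prod 𝓘(ℝ, E' →L[ℝ] E' →L[ℝ] ℝ)) ∞
      fun p : N => Bundle.TotalSpace.mk' (E' →L[ℝ] E' →L[ℝ] ℝ)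
        (E := fun p : N => TangentSpace J p →L[ℝ] TangentSpace J p →L[ℝ] ℝ) p
        (((mfderiv J I f p).precomp ℝ).comp ((B (f p)).comp (mfderiv J I f p))) := by
  intro p₀
  rw [Bundle.contMDiffAt_section]
  have hP := hf.contMDiffAt.mfderiv_const (m := ∞) (x₀ := p₀) (by simp)
  have hG := ((Bundle.contMDiffAt_section (f p₀)).1 hB.contMDiffAt).comp p₀ hf.contMDiffAt
  have hc1 := hG.clm_comp hP
  have hc2 := hP.clm_precomp (F₃ := ℝ)
  have hc := hc2.clm_comp hc1
  refine hc.congr_of_eventuallyEq ?_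
  have hb : ∀ᶠ p in 𝓝 p₀, p ∈ (trivializationAt E' (TangentSpace J : N → Type _) p₀).baseSet :=
    (trivializationAt E' (TangentSpace J : N → Type _) p₀).open_baseSet.mem_nhds
      (FiberBundle.mem_baseSet_trivializationAt' p₀)
  have hb1 : ∀ᶠ p in 𝓝 p₀, f p ∈ (trivializationAt E
      (TangentSpace I : F → Type _) (f p₀)).baseSet :=
    hf.continuous.continuousAt.eventually
      ((trivializationAt E (TangentSpace I : F → Type _) (f p₀)).open_baseSet.mem_nhds
        (FiberBundle.mem_baseSet_trivializationAt' (f p₀)))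
  filter_upwards [hb, hb1] with p hp hp1

  ext v w
  have h1 := inCoordinates_apply_eq₂ (𝕜 := ℝ) (x₀ := p₀) (x := p) (F₃ := ℝ)
    (E₃ := Bundle.Trivial N ℝ)
    (ϕ := ((mfderiv J I f p).precomp ℝ).comp ((B (f p)).comp (mfderiv J I f p)))
    (v := v) (w := w) hp hp (Set.mem_univ _)
  have h2 := fun v w : E => inCoordinates_apply_eq₂ (𝕜 := ℝ) (x₀ := f p₀)
    (x := f p) (F₃ := ℝ) (E₃ := Bundle.Trivial F ℝ) (ϕ := B (f p))
    (v := v) (w := w) hp1 hp1 (Set.mem_univ _)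
  refine h1.trans ?_
  refine Eq.trans ?_ (h2 (inTangentCoordinates J I id f (mfderiv J I f) p₀ p v)
    (inTangentCoordinates J I id f (mfderiv J I f) p₀ p w)).symm
  have h3 : ∀ u : E', (trivializationAt E (TangentSpace I : F → Type _) (f p₀)).symm (f p)
      (inTangentCoordinates J I id f (mfderiv J I f) p₀ p u) = mfderiv J I f p
        ((trivializationAt E' (TangentSpace J : N → Type _) p₀).symm p u) := by
    intro u
    have := (trivializationAt E (TangentSpace I : F → Type _) (f p₀)).symmL_continuousLinearMapAt
      (R := ℝ) hp1 (mfderiv J I f p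
        ((trivializationAt E' (TangentSpace J : N → Type _) p₀).symmL ℝ p u))
    have h0 : inTangentCoordinates J I id f (mfderiv J I f) p₀ p u =
        (trivializationAt E (TangentSpace I : F → Type _) (f p₀)).continuousLinearMapAt ℝ (f p)
          (mfderiv J I f p
            ((trivializationAt E' (TangentSpace J : N → Type _) p₀).symmL ℝ p u)) := rfl
    rw [h0, ← Bundle.Trivialization.symmL_apply (R := ℝ) _ hp1,
      ← Bundle.Trivialization.symmL_apply (R := ℝ) _ hp]
    exact this
  rw [h3 v, h3 w]
  rfl


/-- The standard Riemannian metric of the line, as a family of bilinear forms. -/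
def lineInner (x : ℝ) : TangentSpace 𝓘(ℝ, ℝ) x →L[ℝ] TangentSpace 𝓘(ℝ, ℝ) x →L[ℝ] ℝ :=
  ContinuousLinearMap.mul ℝ ℝ

theorem contMDiff_mul_bilin :
    ContMDiff 𝓘(ℝ, ℝ) (𝓘(ℝ, ℝ).prod 𝓘(ℝ, ℝ →L[ℝ] ℝ →L[ℝ] ℝ)) ∞
      fun x : ℝ => Bundle.TotalSpace.mk' (ℝ →L[ℝ] ℝ →L[ℝ] ℝ)
        (E := fun x : ℝ => TangentSpace 𝓘(ℝ, ℝ) x →L[ℝ] TangentSpace 𝓘(ℝ, ℝ) x →L[ℝ] ℝ) x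
        (lineInner x) := by
  intro x₀
  rw [Bundle.contMDiffAt_section]
  refine (contMDiffAt_const (c := ContinuousLinearMap.mul ℝ ℝ)).congr_of_eventuallyEq
    (Filter.Eventually.of_forall fun x => ?_)
  ext
  have hx : x ∈ (trivializationAt ℝ (TangentSpace 𝓘(ℝ, ℝ) : ℝ → Type) x₀).baseSet := by
    simp [chartAt_self_eq]
  have h1 := inCoordinates_apply_eq₂ (𝕜 := ℝ) (x₀ := x₀) (x := x) (F₁ := ℝ) (F₂ := ℝ) (F₃ := ℝ)
    (E₁ := (TangentSpace 𝓘(ℝ, ℝ) : ℝ → Type)) (E₂ := (TangentSpace 𝓘(ℝ, ℝ) : ℝ → Type))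
    (E₃ := Bundle.Trivial ℝ ℝ) (ϕ := lineInner x) (v := 1) (w := 1)
    hx hx (Set.mem_univ _)
  refine h1.trans ?_
  have h2 : (trivializationAt ℝ (TangentSpace 𝓘(ℝ, ℝ) : ℝ → Type) x₀).symm x (1 : ℝ) = (1 : ℝ) := by
    rw [← Bundle.Trivialization.symmL_apply (R := ℝ) _ hx, TangentBundle.symmL_model_space]
    rfl
  rw [h2]
  simp [lineInner]
  exact mul_one (1 : ℝ)

theorem contMDiff_coneInner (g : RiemMetric I F) (c : ℝ) :
    ContMDiff (I.prod 𝓘(ℝ, ℝ)) ((I.prod 𝓘(ℝ, ℝ)).prod 𝓘(ℝ, E × ℝ →L[ℝ] E × ℝ →L[ℝ] ℝ)) ∞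
      fun p : F × unitIoo => Bundle.TotalSpace.mk' (E × ℝ →L[ℝ] E × ℝ →L[ℝ] ℝ)
        (E := fun p : F × unitIoo => TangentSpace (I.prod 𝓘(ℝ, ℝ)) p →L[ℝ]
          TangentSpace (I.prod 𝓘(ℝ, ℝ)) p →L[ℝ] ℝ) p (coneInner g c p) := by
  have hval : ContMDiff (I.prod 𝓘(ℝ, ℝ)) 𝓘(ℝ, ℝ) ∞ fun q : F × unitIoo => (q.2 : ℝ) :=
    contMDiff_subtype_val.comp contMDiff_snd
  have hr : ContMDiff (I.prod 𝓘(ℝ, ℝ)) 𝓘(ℝ, ℝ) ∞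
      (fun q : F × unitIoo => (q.2 : ℝ) ^ (2 * c)) := fun p₀ =>
    (Real.contDiffAt_rpow_const_of_ne (p := 2 * c) (n := ∞) p₀.2.2.1.ne').contMDiffAt.comp p₀
      hval.contMDiffAt
  have h1 := contMDiff_pullback_bilin hval contMDiff_mul_bilin
  have h2 := contMDiff_pullback_bilin
    (contMDiff_fst (I := I) (J := 𝓘(ℝ, ℝ)) (M := F) (N := unitIoo) (n := ∞)) g.contMDiff
  refine (h1.add_section (hr.smul_section h2)).congr fun p => ?_
  rfl

/-- The metric `g_c = dr ⊗ dr + r^{2c} π^* g` on the regular part `F × (0, 1)` of the cone over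
`F`. -/
def coneMetric (g : RiemMetric I F) (c : ℝ) : RiemMetric (I.prod 𝓘(ℝ, ℝ)) (F × unitIoo) where
  inner := coneInner g c
  symm p v w := by
    rw [coneInner_apply, coneInner_apply, g.symm, mul_comm (dRad p v)]
  pos := coneInner_pos g c
  isVonNBounded p :=
    isVonNBounded_of_pos (E := E × ℝ) (coneInner g c p) (coneInner_pos g c p)
  contMDiff := contMDiff_coneInner g c

/-- The pull-back `π^* φ` of a form on `F` to `F × (0, 1)`. -/
def conePullback {k : ℕ} (φ : DForm I F k) : DForm (I.prod 𝓘(ℝ, ℝ)) (F × unitIoo) k :=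
  fun p => (φ p.1).compContinuousLinearMap (dProj p)

end Cone

end ConeL2

end

open ConeL2

open scoped Manifold ContDiff Topology
open MeasureTheory

noncomputable section

/-! A form of degree k+1 on the cone is α + dr ∧ β, where α and β are families of forms on F
depending on r. For a k-form φ on F one has |π^*φ|² dvol = r^w |φ|² dvol_F dr with w = c(f - 2k), so
all estimates take place in L² spaces with a power weight; the exponent w is `expo`. The inequality
i < f/2 + 1/(2c) says that the exponent in degree i exceeds -1, that is, that forms constant in r
are square integrable up to the tip.

Closedness of α + dr ∧ β means, weakly, d_F α = 0 and ∂_r α = d_F β. Let b = -cut' be a bump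
function on (0,1) with integral 1. Integrating the second equation from a starting point distributed
according to b gives the homotopy formula α(r) = d_F ∫ κ(r,s) β(s) ds + ∫ b α with κ(r,s) = 1_{s<r}
- cut(s) (`ae_pairing_hor_eq`). Hence α + dr ∧ β = d(Kβ) + π^*(∫ b α), provided that Kβ is square
integrable. The kernel is Hilbert–Schmidt as soon as the exponent in degree k exceeds -1
(`isHSKernel_cutKer_one`).

Below the threshold this gives surjectivity of π^* in cohomology. Injectivity holds because
averaging a primitive of π^*φ against b gives a primitive of φ (`mk_mem_dMaxRange_of_conePull`). In
degree 0 the weak radial derivative vanishes and the function is π^* of its average (`l2Pull_avg`).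

Above the threshold let v ≤ -1 be the exponent in degree k+1 and w = v + 2c that in degree k.
Averages of α against bumps moving to the tip tend to 0 in L²
(`HForm.SqInt.tendsto_radInt_cutBump`). If w < 1, then β is integrable up to r = 0 and the limit of
the homotopy formula shows that ∫_0^r β is a primitive (`mem_range_of_expo_lt_one`). The
inequalities v ≤ -1 and w ≥ 1 force f = 2k+1 and w = c ≥ 1, which is where the three alternatives of
the theorem enter. In that case two averages of α differ by an element of the range of d_max on F,
so the average of α is a limit of such elements; closed range makes it dτ, and Kβ + π^*τ is a
primitive (`mem_range_of_isClosed`).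

All identities are weak and are tested only on pairs (ζ, δζ) of smooth compactly supported forms
(`IsCoPair`). Pairs on F multiplied by radial bumps are pairs on the cone, which extracts the
equations for α and β. Conversely the slices of a pair on the cone are pairs on F
(`IsCoPair.slice`), which yields the criterion `mem_dMaxGraph_cone` for a primitive. No
approximation of square integrable forms by smooth ones is needed. -/

namespace ConeL2

set_option linter.unusedSectionVars false

/-! ### Transition maps and chart independence of the exterior derivative -/

section Charts

variable {E : Type*} [NormedAddCommGroup E] [NormedSpace ℝ E]
  {H : Type*} [TopologicalSpace H] {I : ModelWithCorners ℝ E H}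
  {M : Type*} [TopologicalSpace M] [ChartedSpace H M]

/-- The domain of the transition map from the preferred chart at `x₀` to that at `x₁`. -/
def overlap (I : ModelWithCorners ℝ E H) {M : Type*} [TopologicalSpace M] [ChartedSpace H M]
    (x₀ x₁ : M) : Set E :=
  (extChartAt I x₀).target ∩ (extChartAt I x₀).symm ⁻¹' (chartAt H x₁).source

/-- The transition map from the preferred chart at `x₀` to that at `x₁`. -/
def transition (I : ModelWithCorners ℝ E H) {M : Type*} [TopologicalSpace M] [ChartedSpace H M]
    (x₀ x₁ : M) : E → E :=
  extChartAt I x₁ ∘ (extChartAt I x₀).symm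

theorem isOpen_overlap [I.Boundaryless] (x₀ x₁ : M) : IsOpen (overlap I x₀ x₁) :=
  (continuousOn_extChartAt_symm x₀).isOpen_inter_preimage (isOpen_extChartAt_target x₀)
    (chartAt H x₁).open_source

theorem mem_overlap {x₀ x₁ x : M} (h₀ : x ∈ (chartAt H x₀).source)
    (h₁ : x ∈ (chartAt H x₁).source) : extChartAt I x₀ x ∈ overlap I x₀ x₁ := by
  have h₀' : x ∈ (extChartAt I x₀).source := by rwa [extChartAt_source]
  refine ⟨(extChartAt I x₀).map_source h₀', ?_⟩
  rw [Set.mem_preimage, (extChartAt I x₀).left_inv h₀']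
  exact h₁

theorem symm_mem_source {x₀ : M} {y : E} (hy : y ∈ (extChartAt I x₀).target) :
    (extChartAt I x₀).symm y ∈ (chartAt H x₀).source := by
  rw [← extChartAt_source I]; exact (extChartAt I x₀).map_target hy

theorem transition_mem_overlap {x₀ x₁ : M} {y : E} (hy : y ∈ overlap I x₀ x₁) :
    transition I x₀ x₁ y ∈ overlap I x₁ x₀ :=
  mem_overlap hy.2 (symm_mem_source hy.1)

theorem symm_transition {x₀ x₁ : M} {y : E} (hy : y ∈ overlap I x₀ x₁) :
    (extChartAt I x₁).symm (transition I x₀ x₁ y) = (extChartAt I x₀).symm y :=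
  (extChartAt I x₁).left_inv (by rw [extChartAt_source]; exact hy.2)

theorem transition_transition {x₀ x₁ : M} {y : E} (hy : y ∈ overlap I x₀ x₁) :
    transition I x₁ x₀ (transition I x₀ x₁ y) = y := by
  have : transition I x₁ x₀ (transition I x₀ x₁ y)
      = extChartAt I x₀ ((extChartAt I x₁).symm (transition I x₀ x₁ y)) := rfl
  rw [this, symm_transition hy, (extChartAt I x₀).right_inv hy.1]

variable [IsManifold I ∞ M] [I.Boundaryless]

theorem contDiffOn_transition (x₀ x₁ : M) :
    ContDiffOn ℝ ∞ (transition I x₀ x₁) (overlap I x₀ x₁) := by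
  refine (contDiffOn_ext_coord_change (I := I) (n := ∞) x₁ x₀).mono fun y hy => ?_
  rw [PartialEquiv.trans_source]
  refine ⟨hy.1, ?_⟩
  rw [Set.mem_preimage, extChartAt_source]
  exact hy.2

theorem contDiffAt_transition {x₀ x₁ : M} {y : E} (hy : y ∈ overlap I x₀ x₁) :
    ContDiffAt ℝ ∞ (transition I x₀ x₁) y :=
  (contDiffOn_transition x₀ x₁).contDiffAt ((isOpen_overlap x₀ x₁).mem_nhds hy)

theorem differentiableAt_transition {x₀ x₁ : M} {y : E} (hy : y ∈ overlap I x₀ x₁) :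
    DifferentiableAt ℝ (transition I x₀ x₁) y :=
  (contDiffAt_transition hy).differentiableAt (by simp)

/-- The tangent space at x is modelled on E through the preferred chart at x itself, so a frame of
another chart is expressed by the derivative of the transition map to that chart. -/
theorem chartVec_eq {x₀ x : M} (hx : x ∈ (chartAt H x₀).source) :
    (chartVec I x₀ x : E →L[ℝ] E) = fderiv ℝ (transition I x₀ x) (extChartAt I x₀ x) := by
  rw [chartVec]
  refine (TangentBundle.symmL_trivializationAt_eq_core hx).trans ?_
  rw [tangentBundleCore_coordChange_achart, I.range_eq_univ, fderivWithin_univ]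
  rfl

theorem chartVec_self (x : M) :
    (chartVec I x x : E →L[ℝ] E) = ContinuousLinearMap.id ℝ E := by
  rw [chartVec_eq (mem_chart_source H x)]
  have h : transition I x x =ᶠ[𝓝 (extChartAt I x x)] id := by
    filter_upwards [extChartAt_target_mem_nhds (I := I) x] with y hy
    exact (extChartAt I x).right_inv hy
  rw [h.fderiv_eq, fderiv_id]

theorem chartVec_trans {x₀ x₁ : M} {y : E} (hy : y ∈ overlap I x₀ x₁) :
    (chartVec I x₀ ((extChartAt I x₀).symm y) : E →L[ℝ] E)
      = ContinuousLinearMap.comp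
        (chartVec I x₁ ((extChartAt I x₀).symm y) : E →L[ℝ] E)
        (fderiv ℝ (transition I x₀ x₁) y) := by
  set x := (extChartAt I x₀).symm y with hx
  have hxy : extChartAt I x₀ x = y := (extChartAt I x₀).right_inv hy.1
  have h0 : x ∈ (chartAt H x₀).source := symm_mem_source hy.1
  have h1 : x ∈ (chartAt H x₁).source := hy.2
  have hT : extChartAt I x₁ x = transition I x₀ x₁ y := rfl
  have e0 := chartVec_eq (I := I) h0
  have e1 := chartVec_eq (I := I) h1
  rw [hxy] at e0
  rw [hT] at e1
  have key : fderiv ℝ (transition I x₀ x) y = (fderiv ℝ (transition I x₁ x)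
      (transition I x₀ x₁ y)).comp (fderiv ℝ (transition I x₀ x₁) y) := by
    rw [← fderiv_comp _ _ (differentiableAt_transition hy)]
    · refine Filter.EventuallyEq.fderiv_eq ?_
      filter_upwards [(isOpen_overlap x₀ x₁).mem_nhds hy] with z hz
      change transition I x₀ x z = extChartAt I x ((extChartAt I x₁).symm (transition I x₀ x₁ z))
      rw [symm_transition hz]
      rfl
    · rw [← hT]
      exact differentiableAt_transition (mem_overlap h1 (mem_chart_source H x))
  exact e0.trans (key.trans (congrArg (fun L : E →L[ℝ] E => L.comp
    (fderiv ℝ (transition I x₀ x₁) y)) e1.symm))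

/-- The coordinate frame of a chart is a basis at each point of its domain. -/
def chartVecEquiv {x₀ x : M} (hx : x ∈ (chartAt H x₀).source) : E ≃L[ℝ] TangentSpace I x :=
  ((trivializationAt E (TangentSpace I : M → Type _) x₀).continuousLinearEquivAt ℝ x
    (by simpa using hx)).symm

theorem chartVecEquiv_apply {x₀ x : M} (hx : x ∈ (chartAt H x₀).source) (v : E) :
    chartVecEquiv (I := I) hx v = chartVec I x₀ x v := by
  rw [chartVec, ← Bundle.Trivialization.symm_continuousLinearEquivAt_eq _ (by simpa using hx)]
  rfl

variable {k : ℕ}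

theorem DForm.inChart_trans (φ : DForm I M k) {x₀ x₁ : M} {y : E} (hy : y ∈ overlap I x₀ x₁) :
    φ.inChart x₀ y = (φ.inChart x₁ (transition I x₀ x₁ y)).compContinuousLinearMap
      (fderiv ℝ (transition I x₀ x₁) y) := by
  have h : φ.inChart x₁ (transition I x₀ x₁ y)
      = (φ ((extChartAt I x₀).symm y)).compContinuousLinearMap
        (chartVec I x₁ ((extChartAt I x₀).symm y)) := by
    rw [DForm.inChart, symm_transition hy]
  rw [h, DForm.inChart]
  ext v
  change φ _ _ = φ _ _
  congr 1
  ext j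
  exact congrArg (fun L : E →L[ℝ] E => L (v j)) (chartVec_trans hy)

theorem DForm.inChart_self (φ : DForm I M k) (x : M) :
    φ.inChart x (extChartAt I x x) = φ x := by
  rw [DForm.inChart, extChartAt_to_inv]
  ext v
  change φ _ _ = φ _ _
  congr 1
  ext j
  exact congrArg (fun L : E →L[ℝ] E => L (v j)) (chartVec_self x)

theorem DForm.IsSmooth.contDiffAt {φ : DForm I M k} (h : φ.IsSmooth) {x₀ : M} {y : E}
    (hy : y ∈ (extChartAt I x₀).target) : ContDiffAt ℝ ∞ (φ.inChart x₀) y :=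
  (h x₀).contDiffAt ((isOpen_extChartAt_target x₀).mem_nhds hy)

theorem DForm.d_apply (φ : DForm I M k) (x : M) :
    φ.d x = (extDeriv (φ.inChart x) (extChartAt I x x) : E [⋀^Fin (k + 1)]→L[ℝ] ℝ) := by
  rw [DForm.d]
  ext v
  change extDeriv (φ.inChart x) (extChartAt I x x) _ = extDeriv (φ.inChart x) (extChartAt I x x) v
  congr 1
  ext j
  have h := TangentBundle.continuousLinearMapAt_trivializationAt_eq_core (I := I)
    (mem_chart_source H x)
  change ((trivializationAt E (TangentSpace I : M → Type _) x).continuousLinearMapAt ℝ x) (v j) = _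
  rw [h]
  exact tangentCoordChange_self (I := I) (by rw [extChartAt_source]; exact mem_chart_source H x)

/-- The exterior derivative may be computed in any chart. -/
theorem DForm.IsSmooth.d_inChart {φ : DForm I M k} (h : φ.IsSmooth) {x₀ : M} {y : E}
    (hy : y ∈ (extChartAt I x₀).target) : φ.d.inChart x₀ y = extDeriv (φ.inChart x₀) y := by
  set x := (extChartAt I x₀).symm y with hx
  have hxy : extChartAt I x₀ x = y := (extChartAt I x₀).right_inv hy
  have h0 : x ∈ (chartAt H x₀).source := symm_mem_source hy
  have hyo : y ∈ overlap I x₀ x := ⟨hy, mem_chart_source H x⟩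
  have hT : transition I x₀ x y = extChartAt I x x := rfl
  have h1 : φ.inChart x₀ =ᶠ[𝓝 y] fun z => (φ.inChart x (transition I x₀ x z)).compContinuousLinearMap
      (fderiv ℝ (transition I x₀ x) z) := by
    filter_upwards [(isOpen_overlap x₀ x).mem_nhds hyo] with z hz
    exact φ.inChart_trans hz
  -- `DForm.d` is defined with a chart that varies with the point; naturality of the exterior
  -- derivative under the transition map compares it with the fixed chart at x₀.
  rw [h1.extDeriv_eq, extDeriv_pullback (r := ∞) _ (contDiffAt_transition hyo)
    (by rw [minSmoothness_of_isRCLikeNormedField]; exact ENat.LEInfty.out), hT]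
  · rw [DForm.inChart]
    ext v
    change φ.d x _ = _
    rw [DForm.d_apply]
    change extDeriv (φ.inChart x) (extChartAt I x x) _ = extDeriv (φ.inChart x) (extChartAt I x x) _
    congr 1
    ext j
    have := chartVec_eq (I := I) h0
    rw [hxy] at this
    exact congrArg (fun L : E →L[ℝ] E => L (v j)) this
  · rw [hT]
    exact (h.contDiffAt (mem_extChartAt_target x)).differentiableAt (by simp)

theorem DForm.IsSmooth.d {φ : DForm I M k} (h : φ.IsSmooth) : φ.d.IsSmooth := by
  intro x₀
  have h1 : ContDiffOn ℝ ∞ (extDeriv (φ.inChart x₀)) (extChartAt I x₀).target := by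
    have h2 : ContDiffOn ℝ ∞ (fderiv ℝ (φ.inChart x₀)) (extChartAt I x₀).target :=
      (h x₀).fderiv_of_isOpen (isOpen_extChartAt_target x₀) (by simp)
    exact (ContinuousAlternatingMap.alternatizeUncurryFinCLM ℝ E ℝ).contDiff.comp_contDiffOn h2
  exact h1.congr fun y hy => h.d_inChart hy

theorem DForm.d_eq_zero_of_eventually {φ : DForm I M k} {x : M} (h : ∀ᶠ z in 𝓝 x, φ z = 0) :
    φ.d x = 0 := by
  have h1 : φ.inChart x =ᶠ[𝓝 (extChartAt I x x)] fun _ => 0 := by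
    have h2 := (continuousAt_extChartAt_symm (I := I) x).tendsto
    rw [extChartAt_to_inv] at h2
    filter_upwards [h2.eventually h] with y hy
    rw [DForm.inChart, hy]
    ext v; rfl
  have h2 : extDeriv (fun _ : E => (0 : E [⋀^Fin k]→L[ℝ] ℝ)) (extChartAt I x x) = 0 := by
    ext v
    simp [extDeriv, ContinuousAlternatingMap.alternatizeUncurryFin_apply]
  exact (DForm.d_apply φ x).trans (h1.extDeriv_eq.trans h2)

theorem DForm.IsTest.d [T2Space M] {φ : DForm I M k} (h : φ.IsTest) : φ.d.IsTest := by
  obtain ⟨hs, K, hK, hK'⟩ := h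
  refine ⟨hs.d, K, hK, fun x hx => DForm.d_eq_zero_of_eventually ?_⟩
  filter_upwards [hK.isClosed.isOpen_compl.mem_nhds hx] with z hz
  exact hK' z hz

end Charts

/-! ### Gram determinants under a change of frame -/

section GramDet

variable {V W : Type*} [AddCommGroup V] [Module ℝ V] [TopologicalSpace V]
  [AddCommGroup W] [Module ℝ W] {ι : Type*} [Fintype ι] [DecidableEq ι]

theorem det_gram_comp (B : V →L[ℝ] V →L[ℝ] ℝ) (b : Module.Basis ι ℝ W) (L : W →ₗ[ℝ] V)
    (A : W →ₗ[ℝ] W) :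
    (gram B fun i => L (A (b i))).det = LinearMap.det A ^ 2 * (gram B fun i => L (b i)).det := by
  have h : (gram B fun i => L (A (b i)))
      = (LinearMap.toMatrix b b A).transpose * (gram B fun i => L (b i)) *
        LinearMap.toMatrix b b A := by
    have hA : ∀ j, L (A (b j)) = ∑ i, LinearMap.toMatrix b b A i j • L (b i) := by
      intro j
      conv_lhs => rw [← b.sum_repr (A (b j)), map_sum]
      simp only [LinearMap.toMatrix_apply, map_smul]
    ext i j
    simp only [gram, Matrix.of_apply, hA, map_sum, map_smul, _root_.sum_apply,
      _root_.smul_apply, smul_eq_mul, Matrix.mul_apply, Matrix.transpose_apply, Finset.sum_mul]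
    refine Finset.sum_congr rfl fun p _ => ?_
    rw [Finset.mul_sum]
    refine Finset.sum_congr rfl fun q _ => ?_
    ring
  rw [h, Matrix.det_mul, Matrix.det_mul, Matrix.det_transpose, LinearMap.det_toMatrix]
  ring

end GramDet

/-! ### The Riemannian measure in charts -/

section Volume

variable {E : Type*} [NormedAddCommGroup E] [NormedSpace ℝ E] [FiniteDimensional ℝ E]
  [MeasurableSpace E] [BorelSpace E]
  {H : Type*} [TopologicalSpace H] {I : ModelWithCorners ℝ E H} [I.Boundaryless]
  {M : Type*} [TopologicalSpace M] [ChartedSpace H M] [IsManifold I ∞ M]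
  [MeasurableSpace M] [BorelSpace M]

/-- The density `√(det gᵢⱼ)` of the Riemannian measure in the preferred chart at `x₀`. -/
def chartDensity (g : RiemMetric I M) (x₀ : M) (y : E) : ℝ :=
  √(gram (g.inner ((extChartAt I x₀).symm y)) (coordFrame I x₀ ((extChartAt I x₀).symm y))).det

theorem continuousOn_chartDensity (g : RiemMetric I M) (x₀ : M) :
    ContinuousOn (chartDensity g x₀) (extChartAt I x₀).target := by
  have h := (continuous_gram g x₀).matrix_det.sqrt
  have h2 : ContinuousOn (fun x : M => √(gram (g.inner x) (coordFrame I x₀ x)).det)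
      (chartAt H x₀).source := continuousOn_iff_continuous_domRestrict.2 h
  exact h2.comp (continuousOn_extChartAt_symm x₀) fun y hy => symm_mem_source hy

theorem chartDensity_transition (g : RiemMetric I M) {x₀ x₁ : M} {y : E}
    (hy : y ∈ overlap I x₀ x₁) :
    chartDensity g x₀ y = |(fderiv ℝ (transition I x₀ x₁) y).det| *
      chartDensity g x₁ (transition I x₀ x₁ y) := by
  rw [chartDensity, chartDensity, symm_transition hy]
  set x := (extChartAt I x₀).symm y
  have h1 : coordFrame I x₀ x = fun i => (chartVec I x₁ x : E →ₗ[ℝ] TangentSpace I x)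
      ((fderiv ℝ (transition I x₀ x₁) y : E →ₗ[ℝ] E) (Module.finBasis ℝ E i)) := by
    funext i
    exact congrArg (fun L : E →L[ℝ] E => L (Module.finBasis ℝ E i)) (chartVec_trans hy)
  rw [h1, det_gram_comp, Real.sqrt_mul (sq_nonneg _), Real.sqrt_sq_eq_abs]
  rfl

theorem aemeasurable_extChartAt_symm (x₀ : M) (μ : Measure E) (ρ : E → ENNReal) :
    AEMeasurable (extChartAt I x₀).symm ((μ.restrict (extChartAt I x₀).target).withDensity ρ) :=
  ((continuousOn_extChartAt_symm x₀).aemeasurable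
    (isOpen_extChartAt_target x₀).measurableSet).mono_ac (withDensity_absolutelyContinuous _ _)

theorem measurableSet_target_inter (x₀ : M) {S : Set M} (hS : MeasurableSet S) :
    MeasurableSet ((extChartAt I x₀).target ∩ (extChartAt I x₀).symm ⁻¹' S) := by
  have h : Measurable ((extChartAt I x₀).target.domRestrict (extChartAt I x₀).symm) :=
    (continuousOn_extChartAt_symm (I := I) x₀).domRestrict.measurable
  have h2 := (isOpen_extChartAt_target (I := I) x₀).measurableSet.subtype_image (h hS)
  convert h2 using 1
  ext y
  simp only [Set.mem_inter_iff, Set.mem_preimage, Set.mem_image, Subtype.exists]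
  constructor
  · rintro ⟨h1, h2⟩
    exact ⟨y, h1, h2, rfl⟩
  · rintro ⟨z, hz, hz', rfl⟩
    exact ⟨hz, hz'⟩

theorem chartVolume_apply (g : RiemMetric I M) (x₀ : M) {S : Set M} (hS : MeasurableSet S) :
    chartVolume g x₀ S = ∫⁻ y in (extChartAt I x₀).target ∩ (extChartAt I x₀).symm ⁻¹' S,
      ENNReal.ofReal (chartDensity g x₀ y) ∂(Module.finBasis ℝ E).addHaar := by
  have hT := measurableSet_target_inter (I := I) x₀ hS
  rw [chartVolume, Measure.map_apply_of_aemeasurable (aemeasurable_extChartAt_symm x₀ _ _) hS,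
    ← measure_inter_add_sdiff _ (isOpen_extChartAt_target (I := I) x₀).measurableSet]
  have h0 : ((((Module.finBasis ℝ E).addHaar.restrict (extChartAt I x₀).target).withDensity fun y =>
      ENNReal.ofReal √(gram (g.inner ((extChartAt I x₀).symm y))
      (coordFrame I x₀ ((extChartAt I x₀).symm y))).det)
        ((extChartAt I x₀).symm ⁻¹' S \ (extChartAt I x₀).target)) = 0 := by
    refine (withDensity_absolutelyContinuous _ _) ?_
    refine measure_mono_null (Set.sdiff_subset_compl _ _) ?_
    rw [Measure.restrict_apply (isOpen_extChartAt_target (I := I) x₀).measurableSet.compl]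
    simp
  rw [h0, add_zero, Set.inter_comm, withDensity_apply _ hT, Measure.restrict_restrict hT,
    Set.inter_eq_left.2 (Set.inter_subset_left : _ ∩ (extChartAt I x₀).symm ⁻¹' S ⊆ _)]
  rfl

theorem chartVolume_compl_source (g : RiemMetric I M) (x₀ : M) :
    chartVolume g x₀ (chartAt H x₀).sourceᶜ = 0 := by
  rw [chartVolume_apply g x₀ (chartAt H x₀).open_source.measurableSet.compl]
  have : (extChartAt I x₀).target ∩ (extChartAt I x₀).symm ⁻¹' (chartAt H x₀).sourceᶜ = ∅ := by
    ext y
    simp only [Set.mem_inter_iff, Set.mem_preimage, Set.mem_compl_iff, Set.mem_empty_iff_false,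
      iff_false, not_and, not_not]
    exact fun hy => symm_mem_source hy
  rw [this]
  simp

/-- The Jacobian determinant in the change of variables is exactly the factor by which the densities
√(det gᵢⱼ) of the two charts differ. -/
theorem chartVolume_congr (g : RiemMetric I M) {x₀ x₁ : M} {S : Set M} (hS : MeasurableSet S)
    (h₀ : S ⊆ (chartAt H x₀).source) (h₁ : S ⊆ (chartAt H x₁).source) :
    chartVolume g x₀ S = chartVolume g x₁ S := by
  have h2 : (extChartAt I x₁).target ∩ (extChartAt I x₁).symm ⁻¹' S =
      transition I x₀ x₁ '' ((extChartAt I x₀).target ∩ (extChartAt I x₀).symm ⁻¹' S) := by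
    ext z
    constructor
    · rintro ⟨hz, hz'⟩
      have hzo : z ∈ overlap I x₁ x₀ := ⟨hz, h₀ hz'⟩
      refine ⟨transition I x₁ x₀ z, ⟨(transition_mem_overlap hzo).1, ?_⟩, transition_transition hzo⟩
      rw [Set.mem_preimage, symm_transition hzo]
      exact hz'
    · rintro ⟨y, ⟨hy, hy'⟩, rfl⟩
      have hyo : y ∈ overlap I x₀ x₁ := ⟨hy, h₁ hy'⟩
      refine ⟨(transition_mem_overlap hyo).1, ?_⟩
      rw [Set.mem_preimage, symm_transition hyo]
      exact hy'
  have hsub : ∀ y ∈ (extChartAt I x₀).target ∩ (extChartAt I x₀).symm ⁻¹' S,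
      y ∈ overlap I x₀ x₁ := fun y hy => ⟨hy.1, h₁ hy.2⟩
  rw [chartVolume_apply g x₀ hS, chartVolume_apply g x₁ hS, h2,
    lintegral_image_eq_lintegral_abs_det_fderiv_mul _ (measurableSet_target_inter x₀ hS)
      (f' := fderiv ℝ (transition I x₀ x₁))]
  · refine setLIntegral_congr_fun (measurableSet_target_inter x₀ hS) fun y hy => ?_
    rw [← ENNReal.ofReal_mul (abs_nonneg _)]
    exact congrArg _ (chartDensity_transition g (hsub y hy))
  · exact fun y hy => (differentiableAt_transition (hsub y hy)).hasFDerivAt.hasFDerivWithinAt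
  · intro y hy z hz hyz
    rw [← transition_transition (hsub y hy), hyz, transition_transition (hsub z hz)]

variable [SecondCountableTopology M]

variable (H M) in
theorem exists_countable_charts : ∃ s : Set M, s.Countable ∧ ⋃ x ∈ s, (chartAt H x).source = Set.univ :=
  TopologicalSpace.countable_cover_nhds fun x₀ : M =>
    (chartAt H x₀).open_source.mem_nhds (mem_chart_source H x₀)

/-- A countable atlas is cut into disjoint Borel pieces, each inside one chart, and the chart
measures on the pieces are added. Any measure dominating all chart measures dominates this sum piece
by piece, so the sum is the supremum that defines `riemVolume`. -/
theorem exists_measure_restrict_source (g : RiemMetric I M) : ∃ ν : Measure M,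
    (∀ x₀, ν.restrict (chartAt H x₀).source = chartVolume g x₀) ∧
      ∀ ν' : Measure M, (∀ x₀, chartVolume g x₀ ≤ ν') → ν ≤ ν' := by
  rcases isEmpty_or_nonempty M with hM | hM
  · exact ⟨0, fun x₀ => (hM.false x₀).elim, fun _ _ => Measure.zero_le _⟩
  obtain ⟨s, hs, hsU⟩ := exists_countable_charts H M
  have hne : s.Nonempty := by
    by_contra hcon
    rw [Set.not_nonempty_iff_eq_empty] at hcon
    subst hcon
    rw [Set.biUnion_empty] at hsU
    exact Set.empty_ne_univ hsU
  obtain ⟨u, hu⟩ := hs.exists_eq_range hne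
  let A : ℕ → Set M := disjointed fun n => (chartAt H (u n)).source
  have hAm : ∀ n, MeasurableSet (A n) := fun n => MeasurableSet.disjointed
    (fun n => (chartAt H (u n)).open_source.measurableSet) n
  have hAd : Pairwise (Function.onFun Disjoint A) := disjoint_disjointed _
  have hAU : ⋃ n, A n = Set.univ := by
    rw [iUnion_disjointed, ← hsU, hu, Set.biUnion_range]
  have hAs : ∀ n, A n ⊆ (chartAt H (u n)).source := fun n => disjointed_subset _ n
  have hsum : ∀ (ν' : Measure M) {S : Set M}, MeasurableSet S → ν' S = ∑' n, ν' (S ∩ A n) := by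
    intro ν' S hS
    rw [← measure_iUnion (fun i j hij => (hAd hij).mono Set.inter_subset_right
      Set.inter_subset_right) (fun n => hS.inter (hAm n)), ← Set.inter_iUnion, hAU, Set.inter_univ]
  refine ⟨Measure.sum fun n => (chartVolume g (u n)).restrict (A n), fun x₀ => ?_, fun ν' h => ?_⟩
  · ext S hS
    have hS' := hS.inter (chartAt H x₀).open_source.measurableSet
    rw [Measure.restrict_apply hS, Measure.sum_apply _ hS']
    have h0 : chartVolume g x₀ S = chartVolume g x₀ (S ∩ (chartAt H x₀).source) :=
      (measure_inter_conull (chartVolume_compl_source g x₀)).symm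
    rw [h0, hsum _ hS']
    refine tsum_congr fun n => ?_
    rw [Measure.restrict_apply hS']
    exact chartVolume_congr g (hS'.inter (hAm n)) (Set.inter_subset_right.trans (hAs n))
      (Set.inter_subset_left.trans Set.inter_subset_right)
  · refine Measure.le_iff.2 fun S hS => ?_
    rw [Measure.sum_apply _ hS, hsum ν' hS]
    refine ENNReal.tsum_le_tsum fun n => ?_
    rw [Measure.restrict_apply hS]
    exact h _ _

theorem riemVolume_restrict_source (g : RiemMetric I M) (x₀ : M) :
    (riemVolume g).restrict (chartAt H x₀).source = chartVolume g x₀ := by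
  obtain ⟨ν, h1, h2⟩ := exists_measure_restrict_source g
  have : riemVolume g = ν := by
    refine le_antisymm (iSup_le fun x => ?_) (h2 _ fun x => le_iSup (chartVolume g) x)
    rw [← h1 x]
    exact Measure.restrict_le_self
  rw [this, h1]

theorem eq_riemVolume (g : RiemMetric I M) {ν : Measure M}
    (h : ∀ x₀, ν.restrict (chartAt H x₀).source = chartVolume g x₀) : ν = riemVolume g := by
  obtain ⟨s, hs, hsU⟩ := exists_countable_charts H M
  rw [Measure.ext_iff_of_biUnion_eq_univ hs hsU]
  intro x₀ _
  rw [h, riemVolume_restrict_source]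

instance (g : RiemMetric I M) : IsLocallyFiniteMeasure (riemVolume g) := by
  refine ⟨fun x₀ => ?_⟩
  obtain ⟨K, hK, hKt, hKc⟩ := local_compact_nhds (extChartAt_target_mem_nhds (I := I) x₀)
  have hN : (chartAt H x₀).source ∩ extChartAt I x₀ ⁻¹' K ∈ 𝓝 x₀ :=
    Filter.inter_mem ((chartAt H x₀).open_source.mem_nhds (mem_chart_source H x₀))
      ((continuousAt_extChartAt x₀).preimage_mem_nhds hK)
  obtain ⟨S, hSs, hSo, hxS⟩ := mem_nhds_iff.1 hN
  refine ⟨S, hSo.mem_nhds hxS, ?_⟩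
  have h1 : riemVolume g S = chartVolume g x₀ S := by
    rw [← riemVolume_restrict_source, Measure.restrict_apply hSo.measurableSet,
      Set.inter_eq_left.2 fun x hx => (hSs hx).1]
  have h2 : (extChartAt I x₀).target ∩ (extChartAt I x₀).symm ⁻¹' S ⊆ K := by
    rintro y ⟨hy, hyS⟩
    have := (hSs hyS).2
    rwa [Set.mem_preimage, (extChartAt I x₀).right_inv hy] at this
  have h3 : IntegrableOn (chartDensity g x₀) K (Module.finBasis ℝ E).addHaar :=
    ((continuousOn_chartDensity g x₀).mono hKt).integrableOn_compact hKc
  rw [h1, chartVolume_apply g x₀ hSo.measurableSet]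
  refine (lintegral_mono_set h2).trans_lt ?_
  have h4 := h3.hasFiniteIntegral
  rw [hasFiniteIntegral_iff_ofReal (f := chartDensity g x₀)
    (Filter.Eventually.of_forall fun y => Real.sqrt_nonneg _)] at h4
  exact h4

end Volume

/-! ### Orthonormal bases and the inner product of covectors -/

section CovInner

variable {V : Type*} [AddCommGroup V] [Module ℝ V] [TopologicalSpace V]
  {ι : Type*} [Fintype ι] [DecidableEq ι] {k : ℕ}

theorem gram_posDef {B : V →L[ℝ] V →L[ℝ] ℝ} (hB : ∀ v w, B v w = B w v)
    (hB' : ∀ v, v ≠ 0 → 0 < B v v) {b : ι → V} (hb : LinearIndependent ℝ b) :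
    (gram B b).PosDef := by
  refine Matrix.PosDef.of_dotProduct_mulVec_pos ?_ ?_
  · ext i j; simp [gram, hB (b j) (b i)]
  · intro x hx
    have h : star x ⬝ᵥ (gram B b).mulVec x = B (∑ i, x i • b i) (∑ i, x i • b i) := by
      simp [dotProduct, Matrix.mulVec, gram, map_sum, Finset.mul_sum]
      rw [Finset.sum_comm]
      refine Finset.sum_congr rfl fun p _ => Finset.sum_congr rfl fun q _ => ?_
      ring
    rw [h]
    refine hB' _ fun h0 => hx ?_
    funext i
    exact Fintype.linearIndependent_iff.1 hb x h0 i

/-- In an orthonormal basis `covInner` is a multiple of the euclidean inner product. -/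
theorem covInner_of_gram_eq_one {B : V →L[ℝ] V →L[ℝ] ℝ} {b : ι → V} (h : gram B b = 1)
    (α β : V [⋀^Fin k]→L[ℝ] ℝ) :
    covInner B b α β = ((k.factorial : ℝ))⁻¹ *
      ∑ p : Fin k → ι, α (fun a => b (p a)) * β (fun a => b (p a)) := by
  unfold covInner
  congr 1
  refine Finset.sum_congr rfl fun p _ => ?_
  rw [Finset.sum_eq_single p]
  · simp [h]
  · intro q _ hq
    obtain ⟨a, ha⟩ := Function.ne_iff.1 hq
    rw [h, inv_one, Finset.prod_eq_zero (Finset.mem_univ a), zero_mul, zero_mul]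
    exact Matrix.one_apply_ne ha.symm
  · simp

open scoped MatrixOrder in
-- Positivity gives a factorisation Dᵀ D of the Gram matrix with D invertible, and the change of
-- basis by D⁻¹ turns the Gram matrix into 1.
theorem exists_orthonormal_basis {B : V →L[ℝ] V →L[ℝ] ℝ} (hB : ∀ v w, B v w = B w v)
    (hB' : ∀ v, v ≠ 0 → 0 < B v v) (b : Module.Basis ι ℝ V) :
    ∃ b' : Module.Basis ι ℝ V, gram B b' = 1 ∧
      ∀ (k : ℕ) (α β : V [⋀^Fin k]→L[ℝ] ℝ), covInner B b' α β = covInner B b α β := by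
  have hG := gram_posDef hB hB' b.linearIndependent
  obtain ⟨D, hD⟩ : ∃ D : Matrix ι ι ℝ, gram B b = D.conjTranspose * D :=
    CStarAlgebra.nonneg_iff_eq_star_mul_self.1 hG.posSemidef.nonneg
  rw [Matrix.conjTranspose_eq_transpose_of_trivial] at hD
  have hdet : IsUnit D.det := by
    have h := hG.det_pos.ne'
    rw [hD, Matrix.det_mul] at h
    exact isUnit_iff_ne_zero.2 (right_ne_zero_of_mul h)
  have hP : IsUnit (D⁻¹).det := by
    rw [Matrix.det_nonsing_inv]
    rw [Ring.inverse_eq_inv']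
    exact isUnit_iff_ne_zero.2 (inv_ne_zero hdet.ne_zero)
  have hU : IsUnit D⁻¹ := (Matrix.isUnit_iff_isUnit_det _).2 hP
  let e : V ≃ₗ[ℝ] V := LinearEquiv.ofIsUnitDet (f := Matrix.toLin b b D⁻¹) (v := b) (v' := b)
    (by rwa [LinearMap.toMatrix_toLin])
  let b' := b.map e
  have hb' : ∀ j, b' j = ∑ i, D⁻¹ i j • b i := by
    intro j
    change Matrix.toLin b b D⁻¹ (b j) = _
    rw [Matrix.toLin_self]
  refine ⟨b', ?_, fun k α β => covInner_change_basis hP hb' α β⟩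
  have h1 : gram B b' = (D⁻¹).transpose * gram B b * D⁻¹ := by
    ext i j
    simp only [gram, Matrix.of_apply, hb', map_sum, map_smul, _root_.sum_apply,
      _root_.smul_apply, smul_eq_mul, Matrix.mul_apply, Matrix.transpose_apply, Finset.sum_mul]
    refine Finset.sum_congr rfl fun p _ => ?_
    rw [Finset.mul_sum]
    refine Finset.sum_congr rfl fun q _ => ?_
    ring
  have h2 : D * D⁻¹ = 1 := Matrix.mul_nonsing_inv _ hdet
  rw [h1, hD, ← Matrix.mul_assoc, ← Matrix.transpose_mul, h2, Matrix.mul_assoc, h2]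
  simp

end CovInner

/-! ### Continuity, Cauchy–Schwarz and integrability of inner products of forms -/

section Metric

variable {E : Type*} [NormedAddCommGroup E] [NormedSpace ℝ E] [FiniteDimensional ℝ E]
  {H : Type*} [TopologicalSpace H] {I : ModelWithCorners ℝ E H} [I.Boundaryless]
  {M : Type*} [TopologicalSpace M] [ChartedSpace H M] [IsManifold I ∞ M] {k : ℕ}

/-- The coordinate frame of a chart as a basis of the tangent space. -/
def coordBasis {x₀ x : M} (hx : x ∈ (chartAt H x₀).source) :
    Module.Basis (Fin (Module.finrank ℝ E)) ℝ (TangentSpace I x) :=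
  (Module.finBasis ℝ E).map (chartVecEquiv (I := I) hx).toLinearEquiv

theorem coordBasis_apply {x₀ x : M} (hx : x ∈ (chartAt H x₀).source) (i) :
    coordBasis (I := I) hx i = coordFrame I x₀ x i := by
  rw [coordBasis, Module.Basis.map_apply, coordFrame, ← chartVecEquiv_apply hx]
  rfl

/-- This makes single components of a form controllable by its norm: each squared component is at
most k! times the squared norm. -/
theorem exists_formInner_eq_sum (g : RiemMetric I M) (x : M) :
    ∃ b : Module.Basis (Fin (Module.finrank ℝ E)) ℝ (TangentSpace I x), gram (g.inner x) b = 1 ∧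
      ∀ (k : ℕ) (α β : TangentSpace I x [⋀^Fin k]→L[ℝ] ℝ), formInner g x α β =
        ((k.factorial : ℝ))⁻¹ * ∑ p : Fin k → Fin (Module.finrank ℝ E),
          α (fun a => b (p a)) * β (fun a => b (p a)) := by
  obtain ⟨b, hb, hb'⟩ := exists_orthonormal_basis (g.symm x) (g.pos x)
    (coordBasis (I := I) (mem_chart_source H x))
  refine ⟨b, hb, fun k α β => ?_⟩
  rw [← covInner_of_gram_eq_one hb, hb']
  have : ⇑(coordBasis (I := I) (mem_chart_source H x)) = coordFrame I x x :=
    funext fun i => coordBasis_apply _ i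
  rw [this]
  rfl

theorem isUnit_det_gram (g : RiemMetric I M) {x₀ x : M} (hx : x ∈ (chartAt H x₀).source) :
    (gram (g.inner x) (coordFrame I x₀ x)).det ≠ 0 := by
  have : coordFrame I x₀ x = coordBasis (I := I) hx := funext fun i => (coordBasis_apply hx i).symm
  rw [this]
  exact (gram_posDef (g.symm x) (g.pos x) (Module.Basis.linearIndependent _)).det_pos.ne'

theorem DForm.IsSmooth.continuous_apply {φ : DForm I M k} (h : φ.IsSmooth) (x₀ : M)
    (v : Fin k → E) :
    Continuous fun x : (chartAt H x₀).source => φ x fun j => chartVec I x₀ x (v j) := by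
  have h1 : ContinuousOn (fun x : M => φ.inChart x₀ (extChartAt I x₀ x) v)
      (chartAt H x₀).source := by
    have h2 : ContinuousOn (fun y => φ.inChart x₀ y v) (extChartAt I x₀).target :=
      (h x₀).continuousOn.eval_const v
    refine h2.comp ((continuousOn_extChartAt x₀).mono (by rw [extChartAt_source])) fun x hx => ?_
    exact (extChartAt I x₀).map_source (by rwa [extChartAt_source])
  refine h1.domRestrict.congr fun x => ?_
  rw [Set.domRestrict_apply, DForm.inChart,
    (extChartAt I x₀).left_inv (by rw [extChartAt_source]; exact x.2)]
  rfl

theorem DForm.IsSmooth.isMeasurable [MeasurableSpace M] [BorelSpace M] {φ : DForm I M k}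
    (h : φ.IsSmooth) : φ.IsMeasurable :=
  fun x₀ v => (h.continuous_apply x₀ v).measurable

theorem DForm.IsSmooth.continuous_formInner (g : RiemMetric I M) {φ η : DForm I M k}
    (hφ : φ.IsSmooth) (hη : η.IsSmooth) : Continuous fun x => formInner g x (φ x) (η x) := by
  have h : ∀ x₀ : M, ContinuousOn (fun x => formInner g x (φ x) (η x)) (chartAt H x₀).source := by
    intro x₀
    rw [continuousOn_iff_continuous_domRestrict]
    have h1 : (chartAt H x₀).source.domRestrict (fun x => formInner g x (φ x) (η x)) =
        fun x : (chartAt H x₀).source =>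
          covInner (g.inner x) (coordFrame I x₀ (x : M)) (φ x) (η x) :=
      funext fun x => formInner_eq_coordFrame g x.2 _ _
    rw [h1]
    have hG := continuous_gram g x₀
    have hGi : ∀ i j, Continuous fun x : (chartAt H x₀).source =>
        (gram (g.inner x) (coordFrame I x₀ (x : M)))⁻¹ i j := by
      intro i j
      simp only [Matrix.inv_def, Matrix.smul_apply, Ring.inverse_eq_inv', smul_eq_mul]
      exact (hG.matrix_det.inv₀ fun x => isUnit_det_gram g x.2).mul
        (hG.matrix_adjugate.matrix_elem i j)
    unfold covInner
    refine continuous_const.mul (continuous_finsetSum _ fun p _ => continuous_finsetSum _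
      fun q _ => ?_)
    exact ((continuous_finsetProd _ fun a _ => hGi _ _).mul (hφ.continuous_apply x₀ _)).mul
      (hη.continuous_apply x₀ _)
  rw [continuous_iff_continuousAt]
  exact fun x => (h x).continuousAt ((chartAt H x).open_source.mem_nhds (mem_chart_source H x))

theorem formInner_zero_left (g : RiemMetric I M) (x : M) (β : TangentSpace I x [⋀^Fin k]→L[ℝ] ℝ) :
    formInner g x 0 β = 0 := by
  have h := formInner_smul_left g x (0 : ℝ) (0 : TangentSpace I x [⋀^Fin k]→L[ℝ] ℝ) β
  rwa [zero_smul, zero_mul] at h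

theorem formInner_zero_right (g : RiemMetric I M) (x : M) (α : TangentSpace I x [⋀^Fin k]→L[ℝ] ℝ) :
    formInner g x α 0 = 0 := by
  rw [formInner_comm, formInner_zero_left]

theorem formInner_smul_right (g : RiemMetric I M) (x : M) (c : ℝ)
    (α β : TangentSpace I x [⋀^Fin k]→L[ℝ] ℝ) :
    formInner g x α (c • β) = c * formInner g x α β := by
  rw [formInner_comm, formInner_smul_left, formInner_comm]

theorem formInner_add_right (g : RiemMetric I M) (x : M)
    (α β β' : TangentSpace I x [⋀^Fin k]→L[ℝ] ℝ) :
    formInner g x α (β + β') = formInner g x α β + formInner g x α β' := by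
  rw [formInner_comm, formInner_add_left, formInner_comm g x β, formInner_comm g x β']

theorem formInner_sq_le (g : RiemMetric I M) (x : M) (α β : TangentSpace I x [⋀^Fin k]→L[ℝ] ℝ) :
    formInner g x α β ^ 2 ≤ formInner g x α α * formInner g x β β := by
  have h : ∀ t : ℝ, 0 ≤ formInner g x β β * (t * t) + 2 * formInner g x α β * t
      + formInner g x α α := by
    intro t
    have h1 := formInner_self_nonneg g x (α + t • β)
    rw [formInner_add_add, formInner_smul_right, formInner_smul_left, formInner_smul_right] at h1
    linarith
  have h2 := discrim_le_zero h
  rw [discrim] at h2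
  linarith

theorem DForm.IsTest.integrable_formInner [MeasurableSpace E] [BorelSpace E] [MeasurableSpace M]
    [BorelSpace M] [SecondCountableTopology M] [T2Space M] (g : RiemMetric I M) {φ η : DForm I M k}
    (hφ : φ.IsSmooth) (hη : η.IsTest) :
    Integrable (fun x => formInner g x (φ x) (η x)) (riemVolume g) := by
  obtain ⟨hs, K, hK, hK'⟩ := hη
  refine (hφ.continuous_formInner g hs).integrable_of_hasCompactSupport
    (HasCompactSupport.intro hK fun x hx => ?_)
  rw [hK' x hx, formInner_zero_right]

theorem DForm.IsTest.mem_sqIntegrable [MeasurableSpace E] [BorelSpace E] [MeasurableSpace M]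
    [BorelSpace M] [SecondCountableTopology M] [T2Space M] (g : RiemMetric I M) {φ : DForm I M k}
    (hφ : φ.IsTest) : φ ∈ sqIntegrable g k :=
  ⟨hφ.1.isMeasurable, hφ.integrable_formInner g hφ.1⟩

end Metric

/-! ### The maximal extension tested on representatives -/

section Graph

variable {E : Type*} [NormedAddCommGroup E] [NormedSpace ℝ E] [FiniteDimensional ℝ E]
  [MeasurableSpace E] [BorelSpace E]
  {H : Type*} [TopologicalSpace H] {I : ModelWithCorners ℝ E H}
  {M : Type*} [TopologicalSpace M] [ChartedSpace H M] [IsManifold I ∞ M]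
  [MeasurableSpace M] [BorelSpace M] [SecondCountableTopology M] {k : ℕ}

theorem L2Form.inner_mk (g : RiemMetric I M) (φ η : SqIntForm g k) :
    inner ℝ (L2Form.mk φ) (L2Form.mk η)
      = ∫ x, formInner g x (φ.1 x) (η.1 x) ∂(riemVolume g) := rfl

theorem L2Form.norm_mk_sq (g : RiemMetric I M) (φ : SqIntForm g k) :
    ‖L2Form.mk φ‖ ^ 2 = ∫ x, formInner g x (φ.1 x) (φ.1 x) ∂(riemVolume g) := by
  rw [← L2Form.inner_mk, real_inner_self_eq_norm_sq]

theorem L2Form.mk_surjective {g : RiemMetric I M} (y : L2Form g k) : ∃ φ, L2Form.mk φ = y :=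
  Quotient.exists_rep y

/-- A pair of smooth compactly supported forms `(ζ, δ ζ)`. -/
structure IsCoPair (g : RiemMetric I M) (ζ : DForm I M (k + 1)) (θ : DForm I M k) : Prop where
  left : ζ.IsTest
  right : θ.IsTest
  codiff : IsCodifferential g ζ θ

/-- Test forms are automatically square integrable, so the definition by classes in L² becomes a
statement about integrals of representatives. -/
theorem mk_mem_dMaxGraph [T2Space M] [I.Boundaryless] {g : RiemMetric I M} {φ : SqIntForm g k}
    {η : SqIntForm g (k + 1)} :
    (L2Form.mk φ, L2Form.mk η) ∈ dMaxGraph g k ↔ ∀ ζ θ, IsCoPair g ζ θ →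
      ∫ x, formInner g x (φ.1 x) (θ x) ∂(riemVolume g)
        = ∫ x, formInner g x (η.1 x) (ζ x) ∂(riemVolume g) := by
  constructor
  · intro h ζ θ hp
    exact h ⟨ζ, hp.left.mem_sqIntegrable g⟩ ⟨θ, hp.right.mem_sqIntegrable g⟩ hp.left hp.right
      hp.codiff
  · intro h ζ θ h1 h2 h3
    exact h ζ.1 θ.1 ⟨h1, h2, h3⟩

theorem mk_mem_dMaxKer [T2Space M] [I.Boundaryless] {g : RiemMetric I M} {φ : SqIntForm g k} :
    L2Form.mk φ ∈ dMaxKer g k ↔ ∀ ζ θ, IsCoPair g ζ θ →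
      ∫ x, formInner g x (φ.1 x) (θ x) ∂(riemVolume g) = 0 := by
  have h : L2Form.mk φ ∈ dMaxKer g k ↔
      (L2Form.mk φ, L2Form.mk (0 : SqIntForm g (k + 1))) ∈ dMaxGraph g k := Iff.rfl
  rw [h, mk_mem_dMaxGraph]
  refine forall₂_congr fun ζ θ => imp_congr_right fun hp => ?_
  have h0 : ∀ x, formInner g x ((0 : SqIntForm g (k + 1)).1 x) (ζ x) = 0 :=
    fun x => formInner_zero_left g x _
  simp only [h0, integral_zero]

end Graph

/-! ### Splitting covectors of E × ℝ -/

section AltProd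

variable (E : Type*) [NormedAddCommGroup E] [NormedSpace ℝ E] (k : ℕ)

/-- Restriction of a covector of `E × ℝ` to `E`. -/
def altRes : (E × ℝ) [⋀^Fin k]→L[ℝ] ℝ →L[ℝ] E [⋀^Fin k]→L[ℝ] ℝ :=
  ContinuousAlternatingMap.compContinuousLinearMapCLM (ContinuousLinearMap.inl ℝ E ℝ)

/-- Contraction of a covector of `E × ℝ` with `(0, 1)`, restricted to `E`. -/
def altContr : (E × ℝ) [⋀^Fin (k + 1)]→L[ℝ] ℝ →L[ℝ] E [⋀^Fin k]→L[ℝ] ℝ :=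
  (altRes E k).comp ((ContinuousLinearMap.apply ℝ _ ((0, 1) : E × ℝ)).comp
    (ContinuousAlternatingMap.curryLeftLI
      (𝕜 := ℝ) (E := E × ℝ) (F := ℝ) (n := k)).toContinuousLinearMap)

/-- Pull-back of a covector of `E` to `E × ℝ`. -/
def altPull : E [⋀^Fin k]→L[ℝ] ℝ →L[ℝ] (E × ℝ) [⋀^Fin k]→L[ℝ] ℝ :=
  ContinuousAlternatingMap.compContinuousLinearMapCLM (ContinuousLinearMap.fst ℝ E ℝ)

/-- Exterior product of the last coordinate with the pull-back of a covector of `E`. -/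
def altWedge : E [⋀^Fin k]→L[ℝ] ℝ →L[ℝ] (E × ℝ) [⋀^Fin (k + 1)]→L[ℝ] ℝ :=
  (ContinuousAlternatingMap.alternatizeUncurryFinCLM ℝ (E × ℝ) ℝ).comp
    ((ContinuousLinearMap.smulRightL ℝ (E × ℝ) _ (ContinuousLinearMap.snd ℝ E ℝ)).comp
      (altPull E k))

variable {E k}

theorem altRes_apply (χ : (E × ℝ) [⋀^Fin k]→L[ℝ] ℝ) (v : Fin k → E) :
    altRes E k χ v = χ fun j => (v j, 0) := rfl

theorem altContr_apply (χ : (E × ℝ) [⋀^Fin (k + 1)]→L[ℝ] ℝ) (v : Fin k → E) :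
    altContr E k χ v = χ (Matrix.vecCons (0, 1) fun j => (v j, 0)) := rfl

theorem altPull_apply (φ : E [⋀^Fin k]→L[ℝ] ℝ) (v : Fin k → E × ℝ) :
    altPull E k φ v = φ fun j => (v j).1 := rfl

theorem altWedge_apply (φ : E [⋀^Fin k]→L[ℝ] ℝ) (v : Fin (k + 1) → E × ℝ) :
    altWedge E k φ v = ∑ i : Fin (k + 1), (-1 : ℤ) ^ (i : ℕ) •
      ((v i).2 • φ fun j => (i.removeNth v j).1) := by
  change ContinuousAlternatingMap.alternatizeUncurryFin _ v = _
  rw [ContinuousAlternatingMap.alternatizeUncurryFin_apply]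
  rfl

theorem altRes_altPull (φ : E [⋀^Fin k]→L[ℝ] ℝ) : altRes E k (altPull E k φ) = φ := by
  ext v
  rfl

theorem altContr_altPull (φ : E [⋀^Fin (k + 1)]→L[ℝ] ℝ) :
    altContr E k (altPull E (k + 1) φ) = 0 := by
  ext v
  rw [altContr_apply, altPull_apply]
  exact φ.map_coord_zero 0 rfl

theorem altRes_altWedge (φ : E [⋀^Fin k]→L[ℝ] ℝ) : altRes E (k + 1) (altWedge E k φ) = 0 := by
  ext v
  rw [altRes_apply, altWedge_apply]
  simp

theorem altContr_altWedge (φ : E [⋀^Fin k]→L[ℝ] ℝ) : altContr E k (altWedge E k φ) = φ := by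
  ext v
  rw [altContr_apply, altWedge_apply, Fin.sum_univ_succ]
  simp only [Matrix.cons_val_zero, Matrix.cons_val_succ, zero_smul, smul_zero,
    Finset.sum_const_zero, add_zero, Fin.val_zero, pow_zero, one_smul]
  rfl

end AltProd

/-! ### Charts, frames and metric of the cone -/

section ConeVectors

variable {E : Type*} [NormedAddCommGroup E] [NormedSpace ℝ E] [FiniteDimensional ℝ E]
  {H : Type*} [TopologicalSpace H] {I : ModelWithCorners ℝ E H} [I.Boundaryless]
  {F : Type*} [TopologicalSpace F] [ChartedSpace H F] [IsManifold I ∞ F]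

theorem dProj_apply (p : F × unitIoo) (v : TangentSpace (I.prod 𝓘(ℝ, ℝ)) p) :
    dProj (I := I) p v = (v : E × ℝ).1 := by
  rw [dProj, mfderiv_fst]
  rfl

theorem extChartAt_unitIoo_target (r₀ : unitIoo) :
    (extChartAt 𝓘(ℝ, ℝ) r₀).target = Set.Ioo 0 1 := by
  have h : (extChartAt 𝓘(ℝ, ℝ) r₀).target = (extChartAt 𝓘(ℝ, ℝ) r₀) '' (extChartAt 𝓘(ℝ, ℝ) r₀).source :=
    (PartialEquiv.image_source_eq_target _).symm
  rw [h]
  have hs : (extChartAt 𝓘(ℝ, ℝ) r₀).source = Set.univ := by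
    rw [extChartAt_source]
    ext r
    simp [TopologicalSpace.Opens.chartAt_eq, chartAt_self_eq]
  rw [hs, Set.image_univ]
  ext t
  constructor
  · rintro ⟨r, rfl⟩
    exact r.2
  · intro ht
    exact ⟨⟨t, ht⟩, rfl⟩

/-- The point of `(0, 1)` with a given coordinate. -/
def toIoo (t : ℝ) : unitIoo :=
  (extChartAt 𝓘(ℝ, ℝ) (⟨1 / 2, by norm_num⟩ : unitIoo)).symm t

theorem coe_toIoo {t : ℝ} (ht : t ∈ Set.Ioo (0 : ℝ) 1) : (toIoo t : ℝ) = t := by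
  have := (extChartAt 𝓘(ℝ, ℝ) (⟨1 / 2, by norm_num⟩ : unitIoo)).right_inv
    (by rw [extChartAt_unitIoo_target]; exact ht)
  exact this

theorem toIoo_coe (r : unitIoo) : toIoo (r : ℝ) = r :=
  Subtype.ext (coe_toIoo r.2)

theorem mfderiv_coe_unitIoo (r : unitIoo) :
    (mfderiv 𝓘(ℝ, ℝ) 𝓘(ℝ, ℝ) (Subtype.val : unitIoo → ℝ) r : ℝ →L[ℝ] ℝ)
      = ContinuousLinearMap.id ℝ ℝ := by
  have h5 : (Subtype.val : unitIoo → ℝ) = extChartAt 𝓘(ℝ, ℝ) r := by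
    ext x; rfl
  have h := TangentBundle.continuousLinearMapAt_trivializationAt_eq_core (I := 𝓘(ℝ, ℝ))
    (mem_chart_source ℝ r)
  rw [TangentBundle.continuousLinearMapAt_trivializationAt (mem_chart_source ℝ r), ← h5] at h
  refine h.trans ?_
  ext
  exact tangentCoordChange_self (I := 𝓘(ℝ, ℝ))
    (by rw [extChartAt_source]; exact mem_chart_source ℝ r)

theorem dRad_apply (p : F × unitIoo) (v : TangentSpace (I.prod 𝓘(ℝ, ℝ)) p) :
    dRad (I := I) p v = (v : E × ℝ).2 := by
  have h3 : mfderiv (I.prod 𝓘(ℝ, ℝ)) 𝓘(ℝ, ℝ) (fun q : F × unitIoo => (q.2 : ℝ)) p =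
      (mfderiv 𝓘(ℝ, ℝ) 𝓘(ℝ, ℝ) (Subtype.val : unitIoo → ℝ) p.2).comp
        (mfderiv (I.prod 𝓘(ℝ, ℝ)) 𝓘(ℝ, ℝ) Prod.snd p) :=
    mfderiv_comp p ((contMDiff_subtype_val (n := 1)).mdifferentiable one_ne_zero _)
      mdifferentiableAt_snd
  rw [dRad, h3, mfderiv_snd]
  exact congrArg (fun L : ℝ →L[ℝ] ℝ => L (v : E × ℝ).2) (mfderiv_coe_unitIoo p.2)

theorem coneMetric_inner (g : RiemMetric I F) (c : ℝ) (p : F × unitIoo)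
    (v w : TangentSpace (I.prod 𝓘(ℝ, ℝ)) p) :
    (coneMetric g c).inner p v w = (v : E × ℝ).2 * (w : E × ℝ).2
      + (p.2 : ℝ) ^ (2 * c) * g.inner p.1 (v : E × ℝ).1 (w : E × ℝ).1 := by
  rw [← dRad_apply p v, ← dRad_apply p w, ← dProj_apply p v, ← dProj_apply p w]
  rfl

theorem mem_chart_source_cone {p₀ p : F × unitIoo} :
    p ∈ (chartAt (ModelProd H ℝ) p₀).source ↔ p.1 ∈ (chartAt H p₀.1).source := by
  rw [prodChartedSpace_chartAt]
  simp [TopologicalSpace.Opens.chartAt_eq, chartAt_self_eq]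

theorem extChartAt_cone_target (p₀ : F × unitIoo) :
    (extChartAt (I.prod 𝓘(ℝ, ℝ)) p₀).target = (extChartAt I p₀.1).target ×ˢ Set.Ioo (0 : ℝ) 1 := by
  rw [extChartAt_prod, PartialEquiv.prod_target, extChartAt_unitIoo_target]

theorem extChartAt_cone_symm (p₀ : F × unitIoo) (y : E × ℝ) :
    (extChartAt (I.prod 𝓘(ℝ, ℝ)) p₀).symm y = ((extChartAt I p₀.1).symm y.1, toIoo y.2) := by
  rw [extChartAt_prod]
  rfl

theorem extChartAt_cone_apply (p₀ p : F × unitIoo) :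
    extChartAt (I.prod 𝓘(ℝ, ℝ)) p₀ p = (extChartAt I p₀.1 p.1, (p.2 : ℝ)) := by
  rw [extChartAt_prod]
  rfl

/-- The interval has the inclusion into ℝ as its chart, so transition maps of the cone are
transition maps of F times the identity. -/
theorem chartVec_cone {p₀ p : F × unitIoo} (hp : p.1 ∈ (chartAt H p₀.1).source) :
    (chartVec (I.prod 𝓘(ℝ, ℝ)) p₀ p : E × ℝ →L[ℝ] E × ℝ)
      = (chartVec I p₀.1 p.1 : E →L[ℝ] E).prodMap (ContinuousLinearMap.id ℝ ℝ) := by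
  rw [chartVec_eq (mem_chart_source_cone.2 hp), chartVec_eq hp, extChartAt_cone_apply]
  have hd := differentiableAt_transition (I := I) (mem_overlap hp (mem_chart_source H p.1))
  have h1 : HasFDerivAt (Prod.map (transition I p₀.1 p.1) (id : ℝ → ℝ))
      ((fderiv ℝ (transition I p₀.1 p.1) (extChartAt I p₀.1 p.1)).prodMap
        (ContinuousLinearMap.id ℝ ℝ)) (extChartAt I p₀.1 p.1, (p.2 : ℝ)) :=
    HasFDerivAt.prodMap (p := (extChartAt I p₀.1 p.1, (p.2 : ℝ))) hd.hasFDerivAt (hasFDerivAt_id _)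
  refine (h1.congr_of_eventuallyEq ?_).fderiv
  have h2 : ∀ᶠ y : E × ℝ in 𝓝 (extChartAt I p₀.1 p.1, (p.2 : ℝ)), y.2 ∈ Set.Ioo (0 : ℝ) 1 :=
    continuousAt_snd.preimage_mem_nhds (isOpen_Ioo.mem_nhds p.2.2)
  filter_upwards [h2] with y hy
  change extChartAt (I.prod 𝓘(ℝ, ℝ)) p ((extChartAt (I.prod 𝓘(ℝ, ℝ)) p₀).symm y) = _
  rw [extChartAt_cone_symm, extChartAt_cone_apply, coe_toIoo hy]
  rfl

end ConeVectors

/-! ### Components with and without a distinguished vector -/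

section Split

variable {V : Type*} [NormedAddCommGroup V] [NormedSpace ℝ V] {ι : Type*} [Fintype ι]

/-- The sum of the products of the components of two covectors in a finite family of vectors. -/
def tensorSum {κ : Type*} [Fintype κ] (B : κ → V) {k : ℕ} (α β : V [⋀^Fin k]→L[ℝ] ℝ) : ℝ :=
  ∑ p : Fin k → κ, α (fun a => B (p a)) * β (fun a => B (p a))

theorem tensorSum_succ {κ : Type*} [Fintype κ] (B : κ → V) {k : ℕ}
    (α β : V [⋀^Fin (k + 1)]→L[ℝ] ℝ) :
    tensorSum B α β = ∑ i, tensorSum B (α.curryLeft (B i)) (β.curryLeft (B i)) := by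
  unfold tensorSum
  rw [← (Fin.consEquiv fun _ : Fin (k + 1) => κ).sum_comp, Fintype.sum_prod_type]
  refine Finset.sum_congr rfl fun i _ => Finset.sum_congr rfl fun p _ => ?_
  have h : (fun a => B ((Fin.consEquiv fun _ : Fin (k + 1) => κ) (i, p) a))
      = Matrix.vecCons (B i) fun a => B (p a) := by
    funext a
    refine Fin.cases ?_ (fun a => ?_) a <;> simp [Fin.consEquiv]
  rw [h]
  rfl

/-- Polarisation of α(u+v, u+v, …) = 0. -/
theorem curryLeft_comm {k : ℕ} (α : V [⋀^Fin (k + 2)]→L[ℝ] ℝ) (u v : V) :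
    (α.curryLeft u).curryLeft v = -(α.curryLeft v).curryLeft u := by
  have h := (α.curryLeft_same (u + v))
  have h1 : α.curryLeft (u + v) = α.curryLeft u + α.curryLeft v := map_add _ _ _
  rw [map_add, h1, ContinuousAlternatingMap.curryLeft_add] at h
  simp only [_root_.add_apply, ContinuousAlternatingMap.curryLeft_same, zero_add,
    add_zero] at h
  exact eq_neg_of_add_eq_zero_right h

theorem tensorSum_neg {κ : Type*} [Fintype κ] (B : κ → V) {k : ℕ}
    (α β : V [⋀^Fin k]→L[ℝ] ℝ) : tensorSum B (-α) (-β) = tensorSum B α β := by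
  simp [tensorSum]

theorem tensorSum_zero {κ : Type*} [Fintype κ] (B : κ → V) {k : ℕ} :
    tensorSum B (0 : V [⋀^Fin k]→L[ℝ] ℝ) 0 = 0 := by
  simp [tensorSum]

/-- An alternating form vanishes when the distinguished vector occurs twice, and the k+1 places
where it may occur once contribute equally by antisymmetry. The induction splits off the first
index. -/
theorem tensorSum_sum (B : ι ⊕ Unit → V) : ∀ {k : ℕ} (α β : V [⋀^Fin (k + 1)]→L[ℝ] ℝ),
    tensorSum B α β = tensorSum (fun i => B (Sum.inl i)) α β
      + (k + 1) * tensorSum (fun i => B (Sum.inl i)) (α.curryLeft (B (Sum.inr ())))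
        (β.curryLeft (B (Sum.inr ())))
  | 0, α, β => by
    rw [tensorSum_succ, Fintype.sum_sum_type, tensorSum_succ (fun i => B (Sum.inl i))]
    have h0 : ∀ a : Fin 0 → ι ⊕ Unit, (fun i => B (a i)) = ![] := fun a => Subsingleton.elim _ _
    simp [tensorSum, h0]
  | k + 1, α, β => by
    rw [tensorSum_succ, Fintype.sum_sum_type]
    simp only [tensorSum_sum B, Finset.sum_add_distrib, ContinuousAlternatingMap.curryLeft_same,
      tensorSum_zero, mul_zero, add_zero, Finset.univ_unique, Finset.sum_singleton,
      PUnit.default_eq_unit]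
    rw [← tensorSum_succ (fun i => B (Sum.inl i)) α β, ← Finset.mul_sum,
      tensorSum_succ (fun i => B (Sum.inl i)) (α.curryLeft (B (Sum.inr ())))]
    have h : ∀ i, tensorSum (fun i => B (Sum.inl i))
        ((α.curryLeft (B (Sum.inl i))).curryLeft (B (Sum.inr ())))
        ((β.curryLeft (B (Sum.inl i))).curryLeft (B (Sum.inr ()))) =
        tensorSum (fun i => B (Sum.inl i))
        ((α.curryLeft (B (Sum.inr ()))).curryLeft (B (Sum.inl i)))
        ((β.curryLeft (B (Sum.inr ()))).curryLeft (B (Sum.inl i))) := by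
      intro i
      rw [curryLeft_comm α, curryLeft_comm β, tensorSum_neg]
    simp only [h]
    push_cast
    ring

end Split

theorem covInner_congr_basis {V : Type*} [AddCommGroup V] [Module ℝ V] [TopologicalSpace V]
    {ι : Type*} [Fintype ι] [DecidableEq ι] {k : ℕ} (B : V →L[ℝ] V →L[ℝ] ℝ)
    (b b' : Module.Basis ι ℝ V) (α β : V [⋀^Fin k]→L[ℝ] ℝ) :
    covInner B b' α β = covInner B b α β := by
  refine covInner_change_basis (P := b.toMatrix b') ?_ (fun j => ?_) α β
  · have := b.invertibleToMatrix b'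
    exact (Matrix.isUnit_iff_isUnit_det _).1 (isUnit_of_invertible _)
  · exact (b.sum_toMatrix_smul_self b' j).symm

/-! ### The inner product of covectors for a warped product metric -/

section ProdInner

variable {E : Type*} [NormedAddCommGroup E] [NormedSpace ℝ E] {ι κ : Type*} [Fintype ι]
  [DecidableEq ι] [Fintype κ] [DecidableEq κ] {k : ℕ} {G : E →L[ℝ] E →L[ℝ] ℝ}
  {C : E × ℝ →L[ℝ] E × ℝ →L[ℝ] ℝ} {s t : ℝ}

/-- The basis `(t bᵢ, 0), (0, 1)` of `E × ℝ`. -/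
def stretchBasis (b : Module.Basis ι ℝ E) (ht : t ≠ 0) : Module.Basis (ι ⊕ Unit) ℝ (E × ℝ) :=
  (b.map (LinearEquiv.smulOfUnit (Units.mk0 t ht))).prod (Module.Basis.singleton Unit ℝ)

theorem stretchBasis_inl (b : Module.Basis ι ℝ E) (ht : t ≠ 0) (i : ι) :
    stretchBasis b ht (Sum.inl i) = (t • b i, (0 : ℝ)) := by
  rw [stretchBasis]
  refine Prod.ext ?_ ?_
  · rw [Module.Basis.prod_apply_inl_fst]; rfl
  · rw [Module.Basis.prod_apply_inl_snd]

theorem stretchBasis_inr (b : Module.Basis ι ℝ E) (ht : t ≠ 0) (i : Unit) :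
    stretchBasis b ht (Sum.inr i) = ((0 : E), (1 : ℝ)) := by
  rw [stretchBasis]
  refine Prod.ext ?_ ?_
  · rw [Module.Basis.prod_apply_inr_fst]
  · rw [Module.Basis.prod_apply_inr_snd]; simp

theorem gram_stretchBasis (hC : ∀ u v, C u v = u.2 * v.2 + s * G u.1 v.1) (hst : s * t ^ 2 = 1)
    {b : Module.Basis ι ℝ E} (hb : gram G b = 1) (ht : t ≠ 0) :
    gram C (stretchBasis b ht) = 1 := by
  have h1 : ∀ i j, G (b i) (b j) = (1 : Matrix _ _ ℝ) i j := fun i j => by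
    rw [← hb]; rfl
  ext i j
  rw [gram, Matrix.of_apply, hC]
  rcases i with i | i <;> rcases j with j | j
  · rw [stretchBasis_inl, stretchBasis_inl]
    simp only [mul_zero, zero_add, map_smul, _root_.smul_apply, smul_eq_mul, h1,
      Matrix.one_apply, Sum.inl.injEq]
    split_ifs
    · linarith
    · ring
  · rw [stretchBasis_inl, stretchBasis_inr]
    simp
  · rw [stretchBasis_inr, stretchBasis_inl]
    simp
  · rw [stretchBasis_inr]
    simp

theorem covInner_eq_tensorSum (hC : ∀ u v, C u v = u.2 * v.2 + s * G u.1 v.1) (hst : s * t ^ 2 = 1)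
    {b : Module.Basis ι ℝ E} (hb : gram G b = 1) (ht : t ≠ 0) (b' : Module.Basis κ ℝ (E × ℝ))
    (α β : (E × ℝ) [⋀^Fin k]→L[ℝ] ℝ) :
    covInner C b' α β = ((k.factorial : ℝ))⁻¹ * tensorSum (stretchBasis b ht) α β := by
  let e : ι ⊕ Unit ≃ κ := (stretchBasis b ht).indexEquiv b'
  have hg : gram C ((stretchBasis b ht).reindex e) = 1 := by
    have h2 := gram_stretchBasis hC hst hb ht
    ext i j
    have h3 := congrFun (congrFun h2 (e.symm i)) (e.symm j)
    simp only [gram, Matrix.of_apply, Module.Basis.reindex_apply] at h3 ⊢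
    rw [h3]
    simp [Matrix.one_apply]
  rw [← covInner_congr_basis _ b' ((stretchBasis b ht).reindex e), covInner_of_gram_eq_one hg]
  congr 1
  unfold tensorSum
  refine Fintype.sum_equiv ((Equiv.refl (Fin k)).arrowCongr e.symm) _ _ fun q => ?_
  simp only [Module.Basis.reindex_apply]
  rfl

theorem tensorSum_inl {b : Module.Basis ι ℝ E} (hb : gram G b = 1) (ht : t ≠ 0)
    (α β : (E × ℝ) [⋀^Fin k]→L[ℝ] ℝ) :
    ((k.factorial : ℝ))⁻¹ * tensorSum (fun i => stretchBasis b ht (Sum.inl i)) α β =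
      t ^ (2 * k) * covInner G b (altRes E k α) (altRes E k β) := by
  have h1 : ∀ (γ : (E × ℝ) [⋀^Fin k]→L[ℝ] ℝ) (q : Fin k → ι),
      γ (fun a => stretchBasis b ht (Sum.inl (q a))) = t ^ k * altRes E k γ fun a => b (q a) := by
    intro γ q
    have h2 : (fun a => stretchBasis b ht (Sum.inl (q a)))
        = fun a => t • ((b (q a), (0 : ℝ)) : E × ℝ) := by
      funext a
      rw [stretchBasis_inl]
      simp
    rw [h2]
    have h3 := γ.toMultilinearMap.map_smul_univ (fun _ => t)
      (fun a => ((b (q a), (0 : ℝ)) : E × ℝ))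
    refine h3.trans ?_
    rw [Finset.prod_const, Finset.card_univ, Fintype.card_fin]
    rfl
  rw [covInner_of_gram_eq_one hb]
  unfold tensorSum
  simp only [h1]
  rw [Finset.mul_sum, Finset.mul_sum, Finset.mul_sum]
  refine Finset.sum_congr rfl fun q _ => ?_
  ring

theorem covInner_prod_zero (hC : ∀ u v, C u v = u.2 * v.2 + s * G u.1 v.1) (hst : s * t ^ 2 = 1)
    (ht : t ≠ 0) (hG : ∀ v w, G v w = G w v) (hG' : ∀ v, v ≠ 0 → 0 < G v v)
    (b : Module.Basis ι ℝ E) (b' : Module.Basis κ ℝ (E × ℝ)) (α β : (E × ℝ) [⋀^Fin 0]→L[ℝ] ℝ) :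
    covInner C b' α β = covInner G b (altRes E 0 α) (altRes E 0 β) := by
  obtain ⟨b₁, hb₁, hb₁'⟩ := exists_orthonormal_basis hG hG' b
  rw [covInner_eq_tensorSum hC hst hb₁ ht, ← hb₁', covInner_of_gram_eq_one hb₁]
  have h0 : ∀ a : Fin 0 → ι ⊕ Unit, (fun i => stretchBasis b₁ ht (a i)) = ![] :=
    fun a => Subsingleton.elim _ _
  have h1 : ∀ a : Fin 0 → ι, (fun i => b₁ (a i)) = ![] := fun a => Subsingleton.elim _ _
  have h2 : ∀ γ : (E × ℝ) [⋀^Fin 0]→L[ℝ] ℝ, altRes E 0 γ ![] = γ ![] := fun γ =>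
    congrArg γ (Subsingleton.elim _ _)
  simp [tensorSum, h0, h1, h2]

/-- Scaling an orthonormal basis of E by t = s^{-1/2} makes it orthonormal for the warped metric, so
each horizontal slot contributes t². The k+1 positions of the vertical vector are absorbed by (k+1)!
= (k+1) k!. -/
theorem covInner_prod_succ (hC : ∀ u v, C u v = u.2 * v.2 + s * G u.1 v.1) (hst : s * t ^ 2 = 1)
    (ht : t ≠ 0) (hG : ∀ v w, G v w = G w v) (hG' : ∀ v, v ≠ 0 → 0 < G v v)
    (b : Module.Basis ι ℝ E) (b' : Module.Basis κ ℝ (E × ℝ))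
    (α β : (E × ℝ) [⋀^Fin (k + 1)]→L[ℝ] ℝ) :
    covInner C b' α β = t ^ (2 * (k + 1)) * covInner G b (altRes E (k + 1) α) (altRes E (k + 1) β)
      + t ^ (2 * k) * covInner G b (altContr E k α) (altContr E k β) := by
  obtain ⟨b₁, hb₁, hb₁'⟩ := exists_orthonormal_basis hG hG' b
  have h1 := tensorSum_inl hb₁ ht α β
  have h2 := tensorSum_inl hb₁ ht (α.curryLeft (0, 1)) (β.curryLeft (0, 1))
  have h3 : ∀ γ : (E × ℝ) [⋀^Fin (k + 1)]→L[ℝ] ℝ,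
      altRes E k (γ.curryLeft (0, 1)) = altContr E k γ := fun γ => rfl
  rw [h3, h3] at h2
  rw [covInner_eq_tensorSum hC hst hb₁ ht, ← hb₁', ← hb₁', tensorSum_sum, ← h1, ← h2,
    stretchBasis_inr, Nat.factorial_succ]
  have : ((k : ℝ) + 1) ≠ 0 := by positivity
  have h3 : (k.factorial : ℝ) ≠ 0 := by positivity
  push_cast
  field_simp

end ProdInner

/-! ### Horizontal and vertical parts of forms on the cone -/

section Cone

variable {E : Type*} [NormedAddCommGroup E] [NormedSpace ℝ E] [FiniteDimensional ℝ E]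
  {H : Type*} [TopologicalSpace H] {I : ModelWithCorners ℝ E H} [I.Boundaryless]
  {F : Type*} [TopologicalSpace F] [ChartedSpace H F] [IsManifold I ∞ F] {k : ℕ}

variable (I F) in
/-- Families of differential forms on `F` depending on a parameter in `(0, 1)`. -/
abbrev HForm (k : ℕ) : Type _ := (p : F × unitIoo) → TangentSpace I p.1 [⋀^Fin k]→L[ℝ] ℝ

/-- The component without `dr` of a form on the cone. -/
def hor (χ : DForm (I.prod 𝓘(ℝ, ℝ)) (F × unitIoo) k) : HForm I F k :=
  fun p => altRes E k (χ p : (E × ℝ) [⋀^Fin k]→L[ℝ] ℝ)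

/-- The coefficient of `dr` in a form on the cone. -/
def vert (χ : DForm (I.prod 𝓘(ℝ, ℝ)) (F × unitIoo) (k + 1)) : HForm I F k :=
  fun p => altContr E k (χ p : (E × ℝ) [⋀^Fin (k + 1)]→L[ℝ] ℝ)

/-- A family of forms on `F` as a form on the cone. -/
def pull (Φ : HForm I F k) : DForm (I.prod 𝓘(ℝ, ℝ)) (F × unitIoo) k :=
  fun p => (altPull E k (Φ p : E [⋀^Fin k]→L[ℝ] ℝ) : (E × ℝ) [⋀^Fin k]→L[ℝ] ℝ)

/-- The product of `dr` with a family of forms on `F`. -/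
def wedge (Ψ : HForm I F k) : DForm (I.prod 𝓘(ℝ, ℝ)) (F × unitIoo) (k + 1) :=
  fun p => (altWedge E k (Ψ p : E [⋀^Fin k]→L[ℝ] ℝ) : (E × ℝ) [⋀^Fin (k + 1)]→L[ℝ] ℝ)

theorem hor_pull (Φ : HForm I F k) : hor (pull Φ) = Φ := funext fun _ => altRes_altPull _

theorem vert_pull (Φ : HForm I F (k + 1)) : vert (pull Φ) = 0 := funext fun _ => altContr_altPull _

theorem hor_wedge (Ψ : HForm I F k) : hor (wedge Ψ) = 0 := funext fun _ => altRes_altWedge _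

theorem vert_wedge (Ψ : HForm I F k) : vert (wedge Ψ) = Ψ := funext fun _ => altContr_altWedge _

theorem conePullback_eq (φ : DForm I F k) : conePullback φ = pull fun p => φ p.1 := by
  funext p
  refine ContinuousAlternatingMap.ext fun v => ?_
  change φ p.1 _ = φ p.1 _
  congr 1
  ext j
  exact dProj_apply p (v j)

/-- The weight `r ^ (c (n - 2 k))` of the family of `k`-forms on the fibres of the cone. -/
def weight (n : ℕ) (c : ℝ) (k : ℕ) (r : unitIoo) : ℝ := (r : ℝ) ^ (c * (n - 2 * k))

theorem weight_pos (n : ℕ) (c : ℝ) (k : ℕ) (r : unitIoo) : 0 < weight n c k r :=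
  Real.rpow_pos_of_pos r.2.1 _

theorem weight_eq (n : ℕ) (c : ℝ) (k : ℕ) (r : unitIoo) :
    weight n c k r = (r : ℝ) ^ (c * n) * ((r : ℝ) ^ (-c)) ^ (2 * k) := by
  have hr : (0 : ℝ) < r := r.2.1
  rw [weight, ← Real.rpow_natCast, ← Real.rpow_mul hr.le, ← Real.rpow_add hr]
  congr 1
  push_cast
  ring

theorem formInner_eq_covInner {M : Type*} [TopologicalSpace M] [ChartedSpace H M]
    [IsManifold I ∞ M] (g : RiemMetric I M) (x : M)
    (α β : TangentSpace I x [⋀^Fin k]→L[ℝ] ℝ) : formInner g x α β =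
      covInner (g.inner x) (coordBasis (I := I) (mem_chart_source H x)) α β := by
  have : ⇑(coordBasis (I := I) (mem_chart_source H x)) = coordFrame I x x :=
    funext fun i => coordBasis_apply _ i
  rw [this]
  rfl

theorem rpow_mul_sq_rpow_neg (c : ℝ) (r : unitIoo) :
    (r : ℝ) ^ (2 * c) * ((r : ℝ) ^ (-c)) ^ 2 = 1 := by
  have hr : (0 : ℝ) < r := r.2.1
  rw [← Real.rpow_natCast, ← Real.rpow_mul hr.le, ← Real.rpow_add hr]
  push_cast
  ring_nf
  exact Real.rpow_zero _

theorem formInner_cone_zero (g : RiemMetric I F) (c : ℝ) (p : F × unitIoo) (n : ℕ)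
    (α β : DForm (I.prod 𝓘(ℝ, ℝ)) (F × unitIoo) 0) :
    (p.2 : ℝ) ^ (c * n) * formInner (coneMetric g c) p (α p) (β p)
      = weight n c 0 p.2 * formInner g p.1 (hor α p) (hor β p) := by
  have h := covInner_prod_zero (E := E) (G := g.inner p.1) (C := (coneMetric g c).inner p)
    (fun u v => coneMetric_inner g c p u v) (rpow_mul_sq_rpow_neg c p.2)
    (Real.rpow_pos_of_pos p.2.2.1 _).ne' (g.symm p.1) (g.pos p.1)
    (coordBasis (I := I) (mem_chart_source H p.1))
    (coordBasis (I := I.prod 𝓘(ℝ, ℝ)) (mem_chart_source (ModelProd H ℝ) p)) (α p) (β p)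
  rw [weight_eq, mul_zero, pow_zero, mul_one, formInner_eq_covInner, formInner_eq_covInner]
  exact congrArg _ h

/-- For n = dim F the factor r^{cn} is the density of the cone measure relative to dvol_F dr.
Including it here makes the two parts of a form appear directly with the weights of degrees k+1 and
k. -/
theorem formInner_cone_succ (g : RiemMetric I F) (c : ℝ) (p : F × unitIoo) (n : ℕ)
    (α β : DForm (I.prod 𝓘(ℝ, ℝ)) (F × unitIoo) (k + 1)) :
    (p.2 : ℝ) ^ (c * n) * formInner (coneMetric g c) p (α p) (β p)
      = weight n c (k + 1) p.2 * formInner g p.1 (hor α p) (hor β p)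
        + weight n c k p.2 * formInner g p.1 (vert α p) (vert β p) := by
  have h := covInner_prod_succ (E := E) (G := g.inner p.1) (C := (coneMetric g c).inner p)
    (fun u v => coneMetric_inner g c p u v) (rpow_mul_sq_rpow_neg c p.2)
    (Real.rpow_pos_of_pos p.2.2.1 _).ne' (g.symm p.1) (g.pos p.1)
    (coordBasis (I := I) (mem_chart_source H p.1))
    (coordBasis (I := I.prod 𝓘(ℝ, ℝ)) (mem_chart_source (ModelProd H ℝ) p)) (α p) (β p)
  rw [weight_eq, weight_eq, formInner_eq_covInner, formInner_eq_covInner, formInner_eq_covInner,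
    mul_assoc, mul_assoc, ← mul_add]
  exact congrArg _ h

end Cone

/-! ### Haar measure and a change of basis -/

theorem addHaar_change_basis {V ι : Type*} [NormedAddCommGroup V] [NormedSpace ℝ V]
    [MeasurableSpace V] [BorelSpace V] [Fintype ι] [DecidableEq ι] (b b' : Module.Basis ι ℝ V) :
    b'.addHaar = ENNReal.ofReal |b'.det b| • b.addHaar := by
  have : FiniteDimensional ℝ V := b.finiteDimensional_of_finite
  have h := Measure.isAddLeftInvariant_eq_smul b'.addHaar b.addHaar
  have h1 := congrArg (fun μ : Measure V => μ (parallelepiped b)) h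
  simp only [Measure.smul_apply, Measure.addHaar_parallelepiped, Module.Basis.det_self, abs_one,
    ENNReal.ofReal_one] at h1
  rw [h]
  ext S hS
  rw [Measure.smul_apply, Measure.smul_apply, h1]
  simp [ENNReal.smul_def]

open scoped Pointwise in
theorem addHaar_singleton : (Module.Basis.singleton Unit ℝ).addHaar = volume := by
  rw [Module.Basis.addHaar_eq_iff, Module.Basis.coe_parallelepiped, parallelepiped_eq_sum_segment]
  simp [segment_eq_Icc, one_smul]

/-! ### Gram determinant of the cone metric -/

section GramProd

variable {E : Type*} [NormedAddCommGroup E] [NormedSpace ℝ E] {ι κ : Type*} [Fintype ι]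
  [DecidableEq ι] [Fintype κ] [DecidableEq κ] {G : E →L[ℝ] E →L[ℝ] ℝ}
  {C : E × ℝ →L[ℝ] E × ℝ →L[ℝ] ℝ} {s : ℝ}

theorem det_gram_prod (hC : ∀ u v, C u v = u.2 * v.2 + s * G u.1 v.1) (L : E →L[ℝ] E)
    (b : Module.Basis ι ℝ E) :
    (gram C fun i : ι ⊕ Unit => L.prodMap (ContinuousLinearMap.id ℝ ℝ)
      (b.prod (Module.Basis.singleton Unit ℝ) i)).det
      = s ^ Fintype.card ι * (gram G fun i => L (b i)).det := by
  have h : (gram C fun i : ι ⊕ Unit => L.prodMap (ContinuousLinearMap.id ℝ ℝ)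
      (b.prod (Module.Basis.singleton Unit ℝ) i))
      = Matrix.fromBlocks (s • gram G fun i => L (b i)) 0 0 1 := by
    ext i j
    rcases i with i | i <;> rcases j with j | j <;>
      simp [gram, hC, Module.Basis.prod_apply]
  rw [h, Matrix.det_fromBlocks_zero₂₁, Matrix.det_smul, Matrix.det_one, mul_one]

end GramProd

/-! ### The Riemannian measure of the cone as a product -/

section Cone

variable {E : Type*} [NormedAddCommGroup E] [NormedSpace ℝ E] [FiniteDimensional ℝ E]
  [MeasurableSpace E] [BorelSpace E]
  {H : Type*} [TopologicalSpace H] {I : ModelWithCorners ℝ E H} [I.Boundaryless]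
  {F : Type*} [TopologicalSpace F] [ChartedSpace H F] [IsManifold I ∞ F]
  [MeasurableSpace F] [BorelSpace F] [SecondCountableTopology F] {k : ℕ}

/-- Lebesgue measure on `(0, 1)`. -/
def iooVol : Measure unitIoo := (volume : Measure ℝ).comap Subtype.val

instance : IsFiniteMeasure iooVol := by
  refine ⟨?_⟩
  rw [iooVol, comap_subtype_coe_apply measurableSet_Ioo, Set.image_univ, Subtype.range_coe]
  change volume (Set.Ioo (0 : ℝ) 1) < ⊤
  simp

/-- The measure `r ^ (c n) dr` on `(0, 1)`. -/
def radVol (n : ℕ) (c : ℝ) : Measure unitIoo :=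
  iooVol.withDensity fun r => ENNReal.ofReal ((r : ℝ) ^ (c * n))

instance (n : ℕ) (c : ℝ) : SigmaFinite (radVol n c) :=
  SigmaFinite.withDensity_ofReal _

theorem radVol_apply (n : ℕ) (c : ℝ) {B : Set unitIoo} (hB : MeasurableSet B) :
    radVol n c B = ∫⁻ t in Set.Ioo 0 1 ∩ toIoo ⁻¹' B, ENNReal.ofReal (t ^ (c * n)) := by
  have h1 : Set.Ioo (0 : ℝ) 1 ∩ toIoo ⁻¹' B = Subtype.val '' B := by
    ext t
    constructor
    · rintro ⟨ht, htB⟩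
      exact ⟨toIoo t, htB, coe_toIoo ht⟩
    · rintro ⟨r, hr, rfl⟩
      exact ⟨r.2, by rwa [Set.mem_preimage, toIoo_coe]⟩
  have hemb : MeasurableEmbedding (Subtype.val : unitIoo → ℝ) :=
    MeasurableEmbedding.subtype_coe measurableSet_Ioo
  rw [radVol, withDensity_apply _ hB, h1, iooVol,
    ← hemb.lintegral_map (fun t => ENNReal.ofReal (t ^ (c * n))),
    ← Set.preimage_image_eq B Subtype.val_injective, ← hemb.restrict_map, hemb.map_comap,
    Measure.restrict_restrict (hemb.measurableSet_image.2 hB),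
    Set.preimage_image_eq B Subtype.val_injective, Set.inter_eq_left.2 (Set.image_subset_range _ _)]

/-- The chosen basis of E × ℝ need not be the product of the chosen basis of E with 1; the
determinant records the discrepancy. -/
theorem chartDensity_cone (g : RiemMetric I F) (c : ℝ) (p₀ : F × unitIoo) {y : E × ℝ}
    (hy : y.1 ∈ (extChartAt I p₀.1).target) (ht : y.2 ∈ Set.Ioo (0 : ℝ) 1)
    (e : Fin (Module.finrank ℝ E) ⊕ Unit ≃ Fin (Module.finrank ℝ (E × ℝ))) :
    chartDensity (coneMetric g c) p₀ y =
      |((((Module.finBasis ℝ E).prod (Module.Basis.singleton Unit ℝ)).reindex e).det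
        (Module.finBasis ℝ (E × ℝ)))| *
      (y.2 ^ (c * Module.finrank ℝ E) * chartDensity g p₀.1 y.1) := by
  set b' := ((Module.finBasis ℝ E).prod (Module.Basis.singleton Unit ℝ)).reindex e with hb'
  set b := Module.finBasis ℝ (E × ℝ) with hb
  set p : F × unitIoo := ((extChartAt I p₀.1).symm y.1, toIoo y.2) with hp
  have hps : p.1 ∈ (chartAt H p₀.1).source := symm_mem_source hy
  let L : E →L[ℝ] E := chartVec I p₀.1 p.1
  let L' : E × ℝ →L[ℝ] E × ℝ := L.prodMap (ContinuousLinearMap.id ℝ ℝ)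
  let Cm : E × ℝ →L[ℝ] E × ℝ →L[ℝ] ℝ := (coneMetric g c).inner p
  let A : E × ℝ →ₗ[ℝ] E × ℝ := b'.constr ℕ b
  have hA : ∀ i, A (b' i) = b i := fun i => b'.constr_basis ℕ b i
  have h1 : chartDensity (coneMetric g c) p₀ y = √(gram Cm fun i => L' (b i)).det := by
    rw [chartDensity, extChartAt_cone_symm]
    have : coordFrame (I.prod 𝓘(ℝ, ℝ)) p₀ p = fun i => L' (b i) := by
      funext i
      exact congrArg (fun T : E × ℝ →L[ℝ] E × ℝ => T (b i)) (chartVec_cone hps)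
    rw [this]
    rfl
  have h2 : (gram Cm fun i => L' (b i)).det = LinearMap.det A ^ 2 *
      (gram Cm fun i => L' (b' i)).det := by
    have := det_gram_comp Cm b' (L' : E × ℝ →ₗ[ℝ] E × ℝ) A
    simp only [hA] at this
    exact this
  have h3 : (gram Cm fun i => L' (b' i)).det = (gram Cm fun i =>
      L' ((Module.finBasis ℝ E).prod (Module.Basis.singleton Unit ℝ) i)).det := by
    rw [← Matrix.det_submatrix_equiv_self e.symm]
    congr 1
    ext i j
    simp [gram, hb']
  have h4 := det_gram_prod (E := E) (G := g.inner p.1) (C := Cm) (s := (p.2 : ℝ) ^ (2 * c))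
    (fun u v => coneMetric_inner g c p u v) L (Module.finBasis ℝ E)
  have h5 : LinearMap.det A = b'.det b := by
    rw [← LinearMap.det_toMatrix b', Module.Basis.det_apply, ← Module.Basis.toMatrix_eq_toMatrix_constr]
  have h6 : (p.2 : ℝ) = y.2 := coe_toIoo ht
  have h7 : √((y.2 ^ (2 * c)) ^ Module.finrank ℝ E) = y.2 ^ (c * Module.finrank ℝ E) := by
    rw [Real.sqrt_eq_iff_mul_self_eq (by have := ht.1; positivity) (by have := ht.1; positivity),
      ← Real.rpow_add ht.1, ← Real.rpow_natCast, ← Real.rpow_mul ht.1.le]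
    congr 1
    ring
  rw [h1, h2, h3.trans h4, h5, h6, Real.sqrt_mul (sq_nonneg _), Real.sqrt_sq_eq_abs, Fintype.card_fin,
    Real.sqrt_mul (by have := ht.1; positivity), h7]
  rfl

theorem aemeasurable_chartDensity (g : RiemMetric I F) (x₀ : F) {S : Set E} (hS : MeasurableSet S)
    (h : S ⊆ (extChartAt I x₀).target) (μ : Measure E) :
    AEMeasurable (fun y => ENNReal.ofReal (chartDensity g x₀ y)) (μ.restrict S) :=
  (((continuousOn_chartDensity g x₀).mono h).aemeasurable hS).ennreal_ofReal

theorem chartVolume_cone (g : RiemMetric I F) (c : ℝ) (p₀ : F × unitIoo) :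
    chartVolume (coneMetric g c) p₀
      = (chartVolume g p₀.1).prod (radVol (Module.finrank ℝ E) c) := by
  obtain ⟨e⟩ : Nonempty (Fin (Module.finrank ℝ E) ⊕ Unit ≃ Fin (Module.finrank ℝ (E × ℝ))) :=
    ⟨Fintype.equivOfCardEq (by simp [Module.finrank_prod])⟩
  have : SigmaFinite (chartVolume g p₀.1) := by
    rw [← riemVolume_restrict_source]
    infer_instance
  refine (Measure.prod_eq fun A B hA hB => ?_).symm
  have hTA := measurableSet_target_inter (I := I) p₀.1 hA
  have hTB : MeasurableSet (Set.Ioo (0 : ℝ) 1 ∩ toIoo ⁻¹' B) := by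
    have h := measurableSet_target_inter (I := 𝓘(ℝ, ℝ)) p₀.2 hB
    rwa [extChartAt_unitIoo_target] at h
  have h1 : (extChartAt (I.prod 𝓘(ℝ, ℝ)) p₀).target ∩
      (extChartAt (I.prod 𝓘(ℝ, ℝ)) p₀).symm ⁻¹' (A ×ˢ B) =
      ((extChartAt I p₀.1).target ∩ (extChartAt I p₀.1).symm ⁻¹' A) ×ˢ
        (Set.Ioo (0 : ℝ) 1 ∩ toIoo ⁻¹' B) := by
    rw [extChartAt_cone_target]
    ext y
    simp only [Set.mem_inter_iff, Set.mem_prod, Set.mem_preimage, extChartAt_cone_symm]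
    tauto
  set b' := ((Module.finBasis ℝ E).prod (Module.Basis.singleton Unit ℝ)).reindex e with hb'
  -- The same determinant relates the two Haar measures, so it cancels against the one in
  -- `chartDensity_cone`.
  have hHaar : (Module.finBasis ℝ E).addHaar.prod (volume : Measure ℝ) =
      ENNReal.ofReal |b'.det (Module.finBasis ℝ (E × ℝ))| • (Module.finBasis ℝ (E × ℝ)).addHaar := by
    rw [← addHaar_change_basis, hb', Module.Basis.addHaar_reindex, Module.Basis.prod_addHaar,
      addHaar_singleton]
  rw [chartVolume_apply _ _ (hA.prod hB), h1, chartVolume_apply _ _ hA, radVol_apply _ _ hB,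
    ← lintegral_prod_mul (aemeasurable_chartDensity g p₀.1 hTA Set.inter_subset_left _)
      (g := fun t : ℝ => ENNReal.ofReal (t ^ (c * Module.finrank ℝ E)))
      (by fun_prop),
    Measure.prod_restrict, hHaar, Measure.restrict_smul, lintegral_smul_measure, smul_eq_mul,
    ← lintegral_const_mul' _ _ ENNReal.ofReal_ne_top]
  refine setLIntegral_congr_fun (hTA.prod hTB) fun y hy => ?_
  rw [chartDensity_cone g c p₀ hy.1.1 hy.2.1 e, ENNReal.ofReal_mul (abs_nonneg _),
    ENNReal.ofReal_mul (Real.rpow_nonneg hy.2.1.1.le _), mul_comm (ENNReal.ofReal (y.2 ^ _))]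

theorem riemVolume_cone_prod (g : RiemMetric I F) (c : ℝ) :
    riemVolume (coneMetric g c) = (riemVolume g).prod (radVol (Module.finrank ℝ E) c) := by
  refine (eq_riemVolume (coneMetric g c) fun p₀ => ?_).symm
  have h : (chartAt (ModelProd H ℝ) p₀).source = (chartAt H p₀.1).source ×ˢ Set.univ := by
    ext p
    rw [mem_chart_source_cone]
    simp
  rw [h, ← Measure.prod_restrict, Measure.restrict_univ, riemVolume_restrict_source,
    chartVolume_cone]

/-- The product of the Riemannian measure of `F` and Lebesgue measure on `(0, 1)`. -/
def baseVol (g : RiemMetric I F) : Measure (F × unitIoo) := (riemVolume g).prod iooVol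

theorem riemVolume_cone (g : RiemMetric I F) (c : ℝ) :
    riemVolume (coneMetric g c) = (baseVol g).withDensity fun p =>
      ENNReal.ofReal ((p.2 : ℝ) ^ (c * Module.finrank ℝ E)) := by
  rw [riemVolume_cone_prod, radVol, prod_withDensity_right]
  · rfl
  · fun_prop

theorem integral_cone (g : RiemMetric I F) (c : ℝ) (h : F × unitIoo → ℝ) :
    ∫ p, h p ∂(riemVolume (coneMetric g c)) =
      ∫ p, (p.2 : ℝ) ^ (c * Module.finrank ℝ E) * h p ∂(baseVol g) := by
  rw [riemVolume_cone, integral_withDensity_eq_integral_toReal_smul (by fun_prop)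
    (Filter.Eventually.of_forall fun _ => ENNReal.ofReal_lt_top)]
  refine integral_congr_ae (Filter.Eventually.of_forall fun p => ?_)
  beta_reduce
  rw [ENNReal.toReal_ofReal (Real.rpow_nonneg p.2.2.1.le _), smul_eq_mul]

theorem integrable_cone (g : RiemMetric I F) (c : ℝ) (h : F × unitIoo → ℝ) :
    Integrable h (riemVolume (coneMetric g c)) ↔
      Integrable (fun p => (p.2 : ℝ) ^ (c * Module.finrank ℝ E) * h p) (baseVol g) := by
  rw [riemVolume_cone, integrable_withDensity_iff_integrable_smul' (by fun_prop)
    (Filter.Eventually.of_forall fun _ => ENNReal.ofReal_lt_top)]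
  refine integrable_congr (Filter.Eventually.of_forall fun p => ?_)
  beta_reduce
  rw [ENNReal.toReal_ofReal (Real.rpow_nonneg p.2.2.1.le _), smul_eq_mul]

end Cone

/-! ### The exterior derivative on E × ℝ -/

section LinearAlgebra

variable {E : Type*} [NormedAddCommGroup E] [NormedSpace ℝ E] {k : ℕ}

theorem altRes_prodMap (χ : (E × ℝ) [⋀^Fin k]→L[ℝ] ℝ) (L : E →L[ℝ] E) :
    altRes E k (χ.compContinuousLinearMap (L.prodMap (ContinuousLinearMap.id ℝ ℝ)))
      = (altRes E k χ).compContinuousLinearMap L := by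
  ext v
  simp only [altRes_apply, ContinuousAlternatingMap.compContinuousLinearMap_apply]
  rfl

theorem altContr_prodMap (χ : (E × ℝ) [⋀^Fin (k + 1)]→L[ℝ] ℝ) (L : E →L[ℝ] E) :
    altContr E k (χ.compContinuousLinearMap (L.prodMap (ContinuousLinearMap.id ℝ ℝ)))
      = (altContr E k χ).compContinuousLinearMap L := by
  ext v
  simp only [altContr_apply, ContinuousAlternatingMap.compContinuousLinearMap_apply]
  congr 1
  funext j
  refine Fin.cases ?_ (fun i => ?_) j
  · simp
  · simp

theorem altPull_prodMap (φ : E [⋀^Fin k]→L[ℝ] ℝ) (L : E →L[ℝ] E) :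
    (altPull E k φ).compContinuousLinearMap (L.prodMap (ContinuousLinearMap.id ℝ ℝ))
      = altPull E k (φ.compContinuousLinearMap L) := by
  ext v
  simp only [altPull_apply, ContinuousAlternatingMap.compContinuousLinearMap_apply]
  rfl

theorem altWedge_prodMap (φ : E [⋀^Fin k]→L[ℝ] ℝ) (L : E →L[ℝ] E) :
    (altWedge E k φ).compContinuousLinearMap (L.prodMap (ContinuousLinearMap.id ℝ ℝ))
      = altWedge E k (φ.compContinuousLinearMap L) := by
  ext v
  simp only [altWedge_apply, ContinuousAlternatingMap.compContinuousLinearMap_apply]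
  rfl

theorem extDeriv_apply_eq_sum {V : Type*} [NormedAddCommGroup V] [NormedSpace ℝ V]
    (f : V → V [⋀^Fin k]→L[ℝ] ℝ) (y : V) (v : Fin (k + 1) → V) :
    extDeriv f y v = ∑ i : Fin (k + 1), (-1 : ℤ) ^ (i : ℕ) • fderiv ℝ f y (v i) (i.removeNth v) := by
  rw [extDeriv, ContinuousAlternatingMap.alternatizeUncurryFin_apply]

theorem altRes_extDeriv {f : E × ℝ → (E × ℝ) [⋀^Fin k]→L[ℝ] ℝ} {y : E × ℝ}
    (hf : DifferentiableAt ℝ f y) :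
    altRes E (k + 1) (extDeriv f y) = extDeriv (fun z => altRes E k (f (z, y.2))) y.1 := by
  have h : HasFDerivAt (fun z => altRes E k (f (z, y.2)))
      (((altRes E k).comp (fderiv ℝ f y)).comp (ContinuousLinearMap.inl ℝ E ℝ)) y.1 :=
    ((altRes E k).hasFDerivAt.comp y hf.hasFDerivAt).comp (f := fun z => (z, y.2)) y.1
      (hasFDerivAt_prodMk_left y.1 y.2)
  ext v
  rw [altRes_apply, extDeriv_apply_eq_sum, extDeriv_apply_eq_sum, h.fderiv]
  rfl

theorem altContr_extDeriv_zero {f : E × ℝ → (E × ℝ) [⋀^Fin 0]→L[ℝ] ℝ} {y : E × ℝ}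
    (hf : DifferentiableAt ℝ f y) :
    altContr E 0 (extDeriv f y) = deriv (fun t => altRes E 0 (f (y.1, t))) y.2 := by
  have h : HasFDerivAt (fun t => altRes E 0 (f (y.1, t)))
      (((altRes E 0).comp (fderiv ℝ f y)).comp (ContinuousLinearMap.inr ℝ E ℝ)) y.2 :=
    ((altRes E 0).hasFDerivAt.comp y hf.hasFDerivAt).comp (f := fun t => (y.1, t)) y.2
      (hasFDerivAt_prodMk_right y.1 y.2)
  ext v
  rw [altContr_apply, extDeriv_apply_eq_sum, h.hasDerivAt.deriv]
  simp [altRes_apply]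

/-- The coefficient of dr in d(α + dr ∧ β) is ∂_r α - d_F β: in the alternating sum the term that
differentiates in the direction (0,1) gives ∂_r α, and the others carry a shifted sign because (0,1)
occupies the first slot. -/
theorem altContr_extDeriv_succ {f : E × ℝ → (E × ℝ) [⋀^Fin (k + 1)]→L[ℝ] ℝ} {y : E × ℝ}
    (hf : DifferentiableAt ℝ f y) :
    altContr E (k + 1) (extDeriv f y) = deriv (fun t => altRes E (k + 1) (f (y.1, t))) y.2
      - extDeriv (fun z => altContr E k (f (z, y.2))) y.1 := by
  have h : HasFDerivAt (fun t => altRes E (k + 1) (f (y.1, t)))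
      (((altRes E (k + 1)).comp (fderiv ℝ f y)).comp (ContinuousLinearMap.inr ℝ E ℝ)) y.2 :=
    ((altRes E (k + 1)).hasFDerivAt.comp y hf.hasFDerivAt).comp (f := fun t => (y.1, t)) y.2
      (hasFDerivAt_prodMk_right y.1 y.2)
  have h' : HasFDerivAt (fun z => altContr E k (f (z, y.2)))
      (((altContr E k).comp (fderiv ℝ f y)).comp (ContinuousLinearMap.inl ℝ E ℝ)) y.1 :=
    ((altContr E k).hasFDerivAt.comp y hf.hasFDerivAt).comp (f := fun z => (z, y.2)) y.1
      (hasFDerivAt_prodMk_left y.1 y.2)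
  ext v
  rw [altContr_apply, extDeriv_apply_eq_sum, ContinuousAlternatingMap.sub_apply,
    extDeriv_apply_eq_sum,
    h.hasDerivAt.deriv, h'.fderiv, Fin.sum_univ_succ, sub_eq_add_neg, ← Finset.sum_neg_distrib]
  congr 1
  · simp [altRes_apply]
  · refine Finset.sum_congr rfl fun i _ => ?_
    simp only [Fin.val_succ, pow_succ, mul_neg, mul_one, neg_smul, Matrix.cons_val_succ,
      ContinuousLinearMap.comp_apply, altContr_apply, ContinuousLinearMap.inl_apply]
    congr 3
    funext j
    refine Fin.cases ?_ (fun l => ?_) j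
    · simp [Fin.removeNth]
    · simp [Fin.removeNth, Fin.succ_succAbove_succ]

end LinearAlgebra

/-! ### Smooth families of forms and their derivatives -/

section Smooth

variable {E : Type*} [NormedAddCommGroup E] [NormedSpace ℝ E] [FiniteDimensional ℝ E]
  {H : Type*} [TopologicalSpace H] {I : ModelWithCorners ℝ E H} [I.Boundaryless]
  {F : Type*} [TopologicalSpace F] [ChartedSpace H F] [IsManifold I ∞ F] {k : ℕ}

/-- The coordinate expression of a family of forms on `F`. -/
def HForm.inChart (Φ : HForm I F k) (x₀ : F) (y : E × ℝ) : E [⋀^Fin k]→L[ℝ] ℝ :=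
  (Φ ((extChartAt I x₀).symm y.1, toIoo y.2)).compContinuousLinearMap
    (chartVec I x₀ ((extChartAt I x₀).symm y.1))

/-- The form on `F` obtained by fixing the radial coordinate. -/
def HForm.slice (Φ : HForm I F k) (r : unitIoo) : DForm I F k := fun x => Φ (x, r)

/-- Smooth families of forms. -/
def HForm.IsSmooth (Φ : HForm I F k) : Prop :=
  ∀ x₀ : F, ContDiffOn ℝ ∞ (Φ.inChart x₀) ((extChartAt I x₀).target ×ˢ Set.Ioo 0 1)

/-- Smooth families of forms with compact support. -/
def HForm.IsTest (Φ : HForm I F k) : Prop :=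
  Φ.IsSmooth ∧ ∃ K : Set (F × unitIoo), IsCompact K ∧ ∀ p ∉ K, Φ p = 0

/-- The values of a family of forms along a radial line. -/
def HForm.curve (Φ : HForm I F k) (x : F) (t : ℝ) : E [⋀^Fin k]→L[ℝ] ℝ := Φ (x, toIoo t)

/-- The radial derivative. -/
def HForm.dR (Φ : HForm I F k) : HForm I F k := fun p =>
  deriv (Φ.curve p.1) (p.2 : ℝ)

/-- The exterior derivative along `F`. -/
def HForm.dF (Φ : HForm I F k) : HForm I F (k + 1) := fun p => (Φ.slice p.2).d p.1

theorem HForm.slice_inChart (Φ : HForm I F k) (r : unitIoo) (x₀ : F) (y : E) :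
    (Φ.slice r).inChart x₀ y = Φ.inChart x₀ (y, (r : ℝ)) := by
  rw [HForm.inChart, toIoo_coe]
  rfl

theorem inChart_pull (Φ : HForm I F k) {p₀ : F × unitIoo} {y : E × ℝ}
    (hy : y ∈ (extChartAt I p₀.1).target ×ˢ Set.Ioo (0 : ℝ) 1) :
    (pull Φ).inChart p₀ y = altPull E k (Φ.inChart p₀.1 y) :=
  (congrArg (fun L : E × ℝ →L[ℝ] E × ℝ => (altPull E k
    (Φ ((extChartAt I p₀.1).symm y.1, toIoo y.2) : E [⋀^Fin k]→L[ℝ] ℝ)).compContinuousLinearMap L)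
    (chartVec_cone (I := I) (p₀ := p₀) (p := ((extChartAt I p₀.1).symm y.1, toIoo y.2))
      (symm_mem_source hy.1))).trans (altPull_prodMap _ _)

theorem inChart_wedge (Φ : HForm I F k) {p₀ : F × unitIoo} {y : E × ℝ}
    (hy : y ∈ (extChartAt I p₀.1).target ×ˢ Set.Ioo (0 : ℝ) 1) :
    (wedge Φ).inChart p₀ y = altWedge E k (Φ.inChart p₀.1 y) :=
  (congrArg (fun L : E × ℝ →L[ℝ] E × ℝ => (altWedge E k
    (Φ ((extChartAt I p₀.1).symm y.1, toIoo y.2) : E [⋀^Fin k]→L[ℝ] ℝ)).compContinuousLinearMap L)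
    (chartVec_cone (I := I) (p₀ := p₀) (p := ((extChartAt I p₀.1).symm y.1, toIoo y.2))
      (symm_mem_source hy.1))).trans (altWedge_prodMap _ _)

theorem inChart_hor (χ : DForm (I.prod 𝓘(ℝ, ℝ)) (F × unitIoo) k) (p₀ : F × unitIoo) {y : E × ℝ}
    (hy : y ∈ (extChartAt I p₀.1).target ×ˢ Set.Ioo (0 : ℝ) 1) :
    (hor χ).inChart p₀.1 y = altRes E k (χ.inChart p₀ y) :=
  ((congrArg (fun L : E × ℝ →L[ℝ] E × ℝ => altRes E k
    ((χ ((extChartAt I p₀.1).symm y.1, toIoo y.2) :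
      (E × ℝ) [⋀^Fin k]→L[ℝ] ℝ).compContinuousLinearMap L))
    (chartVec_cone (I := I) (p₀ := p₀) (p := ((extChartAt I p₀.1).symm y.1, toIoo y.2))
      (symm_mem_source hy.1))).trans (altRes_prodMap _ _)).symm

theorem inChart_vert (χ : DForm (I.prod 𝓘(ℝ, ℝ)) (F × unitIoo) (k + 1)) (p₀ : F × unitIoo)
    {y : E × ℝ} (hy : y ∈ (extChartAt I p₀.1).target ×ˢ Set.Ioo (0 : ℝ) 1) :
    (vert χ).inChart p₀.1 y = altContr E k (χ.inChart p₀ y) :=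
  ((congrArg (fun L : E × ℝ →L[ℝ] E × ℝ => altContr E k
    ((χ ((extChartAt I p₀.1).symm y.1, toIoo y.2) :
      (E × ℝ) [⋀^Fin (k + 1)]→L[ℝ] ℝ).compContinuousLinearMap L))
    (chartVec_cone (I := I) (p₀ := p₀) (p := ((extChartAt I p₀.1).symm y.1, toIoo y.2))
      (symm_mem_source hy.1))).trans (altContr_prodMap _ _)).symm

theorem HForm.IsSmooth.pull {Φ : HForm I F k} (h : Φ.IsSmooth) : (pull Φ).IsSmooth := fun p₀ => by
  rw [extChartAt_cone_target]
  exact ((altPull E k).contDiff.comp_contDiffOn (h p₀.1)).congr fun y hy => inChart_pull Φ hy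

theorem HForm.IsSmooth.wedge {Φ : HForm I F k} (h : Φ.IsSmooth) : (wedge Φ).IsSmooth :=
  fun p₀ => by
    rw [extChartAt_cone_target]
    exact ((altWedge E k).contDiff.comp_contDiffOn (h p₀.1)).congr fun y hy => inChart_wedge Φ hy

theorem DForm.IsSmooth.hor {χ : DForm (I.prod 𝓘(ℝ, ℝ)) (F × unitIoo) k} (h : χ.IsSmooth) :
    (hor χ).IsSmooth := fun x₀ => by
  have h1 := h (x₀, toIoo (1 / 2))
  rw [extChartAt_cone_target] at h1
  exact ((altRes E k).contDiff.comp_contDiffOn h1).congr fun y hy =>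
    inChart_hor χ (x₀, toIoo (1 / 2)) hy

theorem DForm.IsSmooth.vert {χ : DForm (I.prod 𝓘(ℝ, ℝ)) (F × unitIoo) (k + 1)} (h : χ.IsSmooth) :
    (vert χ).IsSmooth := fun x₀ => by
  have h1 := h (x₀, toIoo (1 / 2))
  rw [extChartAt_cone_target] at h1
  exact ((altContr E k).contDiff.comp_contDiffOn h1).congr fun y hy =>
    inChart_vert χ (x₀, toIoo (1 / 2)) hy

theorem HForm.IsTest.pull {Φ : HForm I F k} (h : Φ.IsTest) : (pull Φ).IsTest := by
  obtain ⟨h1, K, hK, h2⟩ := h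
  exact ⟨h1.pull, K, hK, fun p hp => (congrArg (altPull E k) (h2 p hp)).trans (map_zero _)⟩

theorem HForm.IsTest.wedge {Φ : HForm I F k} (h : Φ.IsTest) : (wedge Φ).IsTest := by
  obtain ⟨h1, K, hK, h2⟩ := h
  exact ⟨h1.wedge, K, hK, fun p hp => (congrArg (altWedge E k) (h2 p hp)).trans (map_zero _)⟩

theorem DForm.IsTest.hor {χ : DForm (I.prod 𝓘(ℝ, ℝ)) (F × unitIoo) k} (h : χ.IsTest) :
    (hor χ).IsTest := by
  obtain ⟨h1, K, hK, h2⟩ := h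
  exact ⟨h1.hor, K, hK, fun p hp => (congrArg (altRes E k) (h2 p hp)).trans (map_zero _)⟩

theorem DForm.IsTest.vert {χ : DForm (I.prod 𝓘(ℝ, ℝ)) (F × unitIoo) (k + 1)} (h : χ.IsTest) :
    (vert χ).IsTest := by
  obtain ⟨h1, K, hK, h2⟩ := h
  exact ⟨h1.vert, K, hK, fun p hp => (congrArg (altContr E k) (h2 p hp)).trans (map_zero _)⟩

theorem isOpen_target_prod (x₀ : F) : IsOpen ((extChartAt I x₀).target ×ˢ Set.Ioo (0 : ℝ) 1) :=
  (isOpen_extChartAt_target x₀).prod isOpen_Ioo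

theorem HForm.IsSmooth.contDiffAt {Φ : HForm I F k} (h : Φ.IsSmooth) {x₀ : F} {y : E × ℝ}
    (hy : y ∈ (extChartAt I x₀).target ×ˢ Set.Ioo (0 : ℝ) 1) : ContDiffAt ℝ ∞ (Φ.inChart x₀) y :=
  (h x₀).contDiffAt ((isOpen_target_prod x₀).mem_nhds hy)

theorem HForm.inChart_self (Φ : HForm I F k) (x : F) (t : ℝ) :
    Φ.inChart x (extChartAt I x x, t) = Φ (x, toIoo t) := by
  have h := DForm.inChart_self (Φ.slice (toIoo t)) x
  rw [HForm.inChart]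
  exact h

theorem HForm.IsSmooth.contDiffAt_radial {Φ : HForm I F k} (h : Φ.IsSmooth) (x : F) {t : ℝ}
    (ht : t ∈ Set.Ioo (0 : ℝ) 1) :
    ContDiffAt ℝ ∞ (Φ.curve x) t := by
  have h1 : Φ.curve x = fun t => Φ.inChart x (extChartAt I x x, t) :=
    funext fun t => (HForm.inChart_self Φ x t).symm
  rw [h1]
  exact ContDiffAt.comp t (h.contDiffAt ⟨mem_extChartAt_target x, ht⟩) (by fun_prop)

theorem HForm.IsSmooth.hasDerivAt {Φ : HForm I F k} (h : Φ.IsSmooth) (x : F) {t : ℝ}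
    (ht : t ∈ Set.Ioo (0 : ℝ) 1) :
    HasDerivAt (Φ.curve x) (Φ.dR (x, toIoo t)) t := by
  have h1 := ((h.contDiffAt_radial x ht).differentiableAt (by simp)).hasDerivAt
  rw [HForm.dR, coe_toIoo ht]
  exact h1

theorem HForm.IsSmooth.inChart_dR {Φ : HForm I F k} (h : Φ.IsSmooth) {x₀ : F} {y : E × ℝ}
    (hy : y ∈ (extChartAt I x₀).target ×ˢ Set.Ioo (0 : ℝ) 1) :
    Φ.dR.inChart x₀ y = fderiv ℝ (Φ.inChart x₀) y (0, 1) := by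
  have h1 := h.hasDerivAt ((extChartAt I x₀).symm y.1) hy.2
  have h2 := (ContinuousAlternatingMap.compContinuousLinearMapCLM (ι := Fin k)
    (chartVec I x₀ ((extChartAt I x₀).symm y.1) : E →L[ℝ] E)).hasFDerivAt.comp_hasDerivAt y.2 h1
  have h3 : HasDerivAt (fun t => Φ.inChart x₀ (y.1, t)) (fderiv ℝ (Φ.inChart x₀) y (0, 1)) y.2 :=
    HasFDerivAt.comp_hasDerivAt (l := Φ.inChart x₀) (f := fun t => (y.1, t)) y.2
      ((h.contDiffAt hy).differentiableAt (by simp)).hasFDerivAt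
      ((hasDerivAt_const _ _).prodMk (hasDerivAt_id _))
  exact h2.unique h3

theorem HForm.IsSmooth.dR {Φ : HForm I F k} (h : Φ.IsSmooth) : Φ.dR.IsSmooth := fun x₀ => by
  have h1 := (h x₀).fderiv_of_isOpen (m := ∞) (isOpen_target_prod x₀) (by simp)
  exact (h1.clm_apply contDiffOn_const).congr fun y hy => h.inChart_dR hy

theorem HForm.IsTest.dR [T2Space F] {Φ : HForm I F k} (h : Φ.IsTest) : Φ.dR.IsTest := by
  obtain ⟨h1, K, hK, h2⟩ := h
  refine ⟨h1.dR, K, hK, fun p hp => ?_⟩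
  have h3 : Φ.curve p.1 =ᶠ[𝓝 (p.2 : ℝ)]
      fun _ => (0 : E [⋀^Fin k]→L[ℝ] ℝ) := by
    have hc : ContinuousAt (fun t : ℝ => (p.1, toIoo t)) (p.2 : ℝ) := by
      refine continuousAt_const.prodMk ?_
      have := continuousAt_extChartAt_symm (I := 𝓘(ℝ, ℝ)) p.2
      exact this
    have hp' : (p.1, toIoo (p.2 : ℝ)) ∈ Kᶜ := by rwa [toIoo_coe]
    filter_upwards [hc.preimage_mem_nhds (hK.isClosed.isOpen_compl.mem_nhds hp')] with t ht
    exact h2 _ ht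
  exact h3.deriv_eq.trans (deriv_const _ _)

theorem HForm.IsSmooth.slice {Φ : HForm I F k} (h : Φ.IsSmooth) (r : unitIoo) :
    (Φ.slice r).IsSmooth := fun x₀ => by
  have h1 : (Φ.slice r).inChart x₀ = fun y => Φ.inChart x₀ (y, (r : ℝ)) :=
    funext fun y => Φ.slice_inChart r x₀ y
  rw [h1]
  exact (h x₀).comp (by fun_prop) fun y hy => ⟨hy, r.2⟩

theorem HForm.IsTest.slice {Φ : HForm I F k} (h : Φ.IsTest) (r : unitIoo) :
    (Φ.slice r).IsTest := by
  obtain ⟨h1, K, hK, h2⟩ := h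
  exact ⟨h1.slice r, Prod.fst '' K, hK.image continuous_fst, fun x hx =>
    h2 _ fun hp => hx ⟨_, hp, rfl⟩⟩

theorem HForm.IsSmooth.radial_smul {b : ℝ → ℝ} (hb : ContDiffOn ℝ ∞ b (Set.Ioo 0 1))
    {Φ : HForm I F k} (h : Φ.IsSmooth) :
    HForm.IsSmooth (fun p => b p.2 • Φ p : HForm I F k) := fun x₀ => by
  refine ((hb.comp contDiffOn_snd fun y hy => hy.2).smul (h x₀)).congr fun y hy => ?_
  change b (toIoo y.2 : ℝ) • Φ.inChart x₀ y = _
  rw [coe_toIoo hy.2]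
  rfl

theorem HForm.IsTest.radial_smul {b : ℝ → ℝ} (hb : ContDiffOn ℝ ∞ b (Set.Ioo 0 1))
    {Φ : HForm I F k} (h : Φ.IsTest) :
    HForm.IsTest (fun p => b p.2 • Φ p : HForm I F k) := by
  obtain ⟨h1, K, hK, h2⟩ := h
  refine ⟨h1.radial_smul hb, K, hK, fun p hp => ?_⟩
  exact (congrArg (fun z => b p.2 • z) (h2 p hp)).trans (smul_zero _)

theorem HForm.IsSmooth.add {Φ Ψ : HForm I F k} (h : Φ.IsSmooth) (h' : Ψ.IsSmooth) :
    HForm.IsSmooth (Φ + Ψ) := fun x₀ => ((h x₀).add (h' x₀)).congr fun _ _ => rfl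

theorem HForm.IsTest.add {Φ Ψ : HForm I F k} (h : Φ.IsTest) (h' : Ψ.IsTest) :
    HForm.IsTest (Φ + Ψ) := by
  obtain ⟨h1, K, hK, h2⟩ := h
  obtain ⟨h1', K', hK', h2'⟩ := h'
  refine ⟨h1.add h1', K ∪ K', hK.union hK', fun p hp => ?_⟩
  rw [Pi.add_apply, h2 p fun h => hp (Or.inl h), h2' p fun h => hp (Or.inr h)]
  exact add_zero _

theorem DForm.IsTest.add {M : Type*} [TopologicalSpace M] [ChartedSpace H M] [IsManifold I ∞ M]
    {φ η : DForm I M k} (h : φ.IsTest) (h' : η.IsTest) : DForm.IsTest (φ + η) := by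
  obtain ⟨h1, K, hK, h2⟩ := h
  obtain ⟨h1', K', hK', h2'⟩ := h'
  refine ⟨fun x₀ => ((h1 x₀).add (h1' x₀)).congr fun _ _ => rfl, K ∪ K', hK.union hK',
    fun p hp => ?_⟩
  rw [Pi.add_apply, h2 p fun h => hp (Or.inl h), h2' p fun h => hp (Or.inr h)]
  exact add_zero _

theorem isCompact_preimage_coe {S : Set ℝ} (hS : IsCompact S) (h : S ⊆ Set.Ioo 0 1) :
    IsCompact ((Subtype.val : unitIoo → ℝ) ⁻¹' S) :=
  Topology.IsInducing.subtypeVal.isCompact_preimage' hS (by rwa [Subtype.range_coe])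

/-- Bump functions on `(0, 1)`. -/
structure IsBump (a : ℝ → ℝ) : Prop where
  contDiff : ContDiff ℝ ∞ a
  compact : HasCompactSupport a
  subset : tsupport a ⊆ Set.Ioo 0 1

theorem IsBump.isTest_mul {a b : ℝ → ℝ} (ha : IsBump a) (hb : ContDiffOn ℝ ∞ b (Set.Ioo 0 1))
    {φ : DForm I F k} (h : φ.IsTest) :
    HForm.IsTest (fun p => (a p.2 * b p.2) • φ p.1 : HForm I F k) := by
  obtain ⟨h1, K, hK, h2⟩ := h
  have h0 : HForm.IsSmooth (fun p => φ p.1 : HForm I F k) := fun x₀ =>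
    (h1 x₀).comp contDiffOn_fst fun y hy => hy.1
  refine ⟨h0.radial_smul (ha.contDiff.contDiffOn.mul hb), K ×ˢ (Subtype.val ⁻¹' tsupport a),
    hK.prod (isCompact_preimage_coe ha.compact ha.subset), fun p hp => ?_⟩
  by_cases hpK : p.1 ∈ K
  · have : a p.2 = 0 := image_eq_zero_of_notMem_tsupport fun h => hp ⟨hpK, h⟩
    exact (congrArg (fun z => (z * b p.2) • φ p.1) this).trans (by rw [zero_mul, zero_smul])
  · exact (congrArg (fun z => (a p.2 * b p.2) • z) (h2 _ hpK)).trans (smul_zero _)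

theorem IsBump.derivative {a : ℝ → ℝ} (ha : IsBump a) : IsBump (deriv a) :=
  ⟨(contDiff_infty_iff_deriv.1 ha.contDiff).2, ha.compact.deriv,
    (tsupport_deriv_subset).trans ha.subset⟩

theorem hor_d {χ : DForm (I.prod 𝓘(ℝ, ℝ)) (F × unitIoo) k} (h : χ.IsSmooth) :
    hor χ.d = (hor χ).dF := by
  funext p
  have hd : DifferentiableAt ℝ (χ.inChart p) (extChartAt I p.1 p.1, (p.2 : ℝ)) :=
    (h.contDiffAt (mem_extChartAt_target p)).differentiableAt (by simp)
  have h1 : hor χ.d p = altRes E (k + 1) (extDeriv (χ.inChart p) (extChartAt I p.1 p.1, (p.2 : ℝ))) :=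
    congrArg (altRes E (k + 1)) (DForm.d_apply χ p)
  rw [h1, altRes_extDeriv hd, HForm.dF, DForm.d_apply]
  refine Filter.EventuallyEq.extDeriv_eq ?_
  filter_upwards [(isOpen_extChartAt_target p.1).mem_nhds (mem_extChartAt_target p.1)] with y hy
  rw [HForm.slice_inChart, inChart_hor χ p ⟨hy, p.2.2⟩]

theorem deriv_altRes_inChart (χ : DForm (I.prod 𝓘(ℝ, ℝ)) (F × unitIoo) k) (p : F × unitIoo) :
    deriv (fun t => altRes E k (χ.inChart p (extChartAt I p.1 p.1, t))) (p.2 : ℝ)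
      = (hor χ).dR p := by
  refine Filter.EventuallyEq.deriv_eq ?_
  filter_upwards [isOpen_Ioo.mem_nhds p.2.2] with t ht
  rw [← inChart_hor χ p ⟨mem_extChartAt_target p.1, ht⟩]
  exact HForm.inChart_self _ _ _

theorem vert_d_zero {χ : DForm (I.prod 𝓘(ℝ, ℝ)) (F × unitIoo) 0} (h : χ.IsSmooth) :
    vert χ.d = (hor χ).dR := by
  funext p
  have hd : DifferentiableAt ℝ (χ.inChart p) (extChartAt I p.1 p.1, (p.2 : ℝ)) :=
    (h.contDiffAt (mem_extChartAt_target p)).differentiableAt (by simp)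
  exact (congrArg (altContr E 0) (DForm.d_apply χ p)).trans
    ((altContr_extDeriv_zero hd).trans (deriv_altRes_inChart χ p))

theorem vert_d_succ {χ : DForm (I.prod 𝓘(ℝ, ℝ)) (F × unitIoo) (k + 1)} (h : χ.IsSmooth)
    (p : F × unitIoo) : vert χ.d p = (hor χ).dR p - (vert χ).dF p := by
  have hd : DifferentiableAt ℝ (χ.inChart p) (extChartAt I p.1 p.1, (p.2 : ℝ)) :=
    (h.contDiffAt (mem_extChartAt_target p)).differentiableAt (by simp)
  have h1 : extDeriv (fun z => altContr E k (χ.inChart p (z, (p.2 : ℝ)))) (extChartAt I p.1 p.1)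
      = (vert χ).dF p := by
    rw [HForm.dF, DForm.d_apply]
    refine Filter.EventuallyEq.extDeriv_eq ?_
    filter_upwards [(isOpen_extChartAt_target p.1).mem_nhds (mem_extChartAt_target p.1)] with y hy
    rw [HForm.slice_inChart, inChart_vert χ p ⟨hy, p.2.2⟩]
  have h2 := (congrArg (altContr E (k + 1)) (DForm.d_apply χ p)).trans (altContr_extDeriv_succ hd)
  exact h2.trans (congrArg₂ (fun z z' : E [⋀^Fin (k + 1)]→L[ℝ] ℝ => z - z')
    (deriv_altRes_inChart χ p) h1)

end Smooth

/-! ### Finite dimensionality of the space of covectors -/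

section Coordinates

variable {E : Type*} [NormedAddCommGroup E] [NormedSpace ℝ E] {ι : Type*} [Fintype ι] (k : ℕ)

/-- The components of an alternating form in a basis. -/
def altCoord (b : Module.Basis ι ℝ E) : E [⋀^Fin k]→L[ℝ] ℝ →ₗ[ℝ] (Fin k → ι) → ℝ where
  toFun α p := α fun j => b (p j)
  map_add' _ _ := rfl
  map_smul' _ _ := rfl

theorem altCoord_injective (b : Module.Basis ι ℝ E) : Function.Injective (altCoord k b) := by
  intro α β h
  apply ContinuousAlternatingMap.toAlternatingMap_injective
  apply AlternatingMap.coe_multilinearMap_injective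
  exact Module.Basis.ext_multilinear (fun _ => b) fun p => congrFun h p

instance [FiniteDimensional ℝ E] : FiniteDimensional ℝ (E [⋀^Fin k]→L[ℝ] ℝ) :=
  FiniteDimensional.of_injective _ (altCoord_injective k (Module.finBasis ℝ E))

variable {k}

/-- A left inverse of the coordinate map is linear on a finite dimensional space, hence continuous.
-/
theorem stronglyMeasurable_of_components [FiniteDimensional ℝ E] {X : Type*} [MeasurableSpace X]
    {f : X → E [⋀^Fin k]→L[ℝ] ℝ} (h : ∀ v : Fin k → E, Measurable fun x => f x v) :
    StronglyMeasurable f := by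
  obtain ⟨g, hg⟩ := LinearMap.exists_leftInverse_of_injective (altCoord k (Module.finBasis ℝ E))
    (LinearMap.ker_eq_bot.2 (altCoord_injective k _))
  have h1 : f = fun x => g (altCoord k (Module.finBasis ℝ E) (f x)) := by
    funext x
    exact (LinearMap.congr_fun hg (f x)).symm
  rw [h1]
  have h2 : StronglyMeasurable fun x => altCoord k (Module.finBasis ℝ E) (f x) :=
    (measurable_pi_lambda _ fun p => h _).stronglyMeasurable
  exact (LinearMap.continuous_of_finiteDimensional g).comp_stronglyMeasurable h2

/-- The action of a linear automorphism on alternating forms. -/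
def altCongr (e : E ≃L[ℝ] E) : (E [⋀^Fin k]→L[ℝ] ℝ) ≃L[ℝ] E [⋀^Fin k]→L[ℝ] ℝ :=
  ContinuousLinearEquiv.equivOfInverse
    (ContinuousAlternatingMap.compContinuousLinearMapCLM (e : E →L[ℝ] E))
    (ContinuousAlternatingMap.compContinuousLinearMapCLM (e.symm : E →L[ℝ] E))
    (fun α => by ext v; simp [Function.comp_def]) (fun α => by ext v; simp [Function.comp_def])

theorem altCongr_apply (e : E ≃L[ℝ] E) (α : E [⋀^Fin k]→L[ℝ] ℝ) (v : Fin k → E) :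
    altCongr e α v = α fun j => e (v j) := rfl

end Coordinates

/-! ### Bump functions on the interval -/

section Radial

theorem integral_iooVol {G : Type*} [NormedAddCommGroup G] [NormedSpace ℝ G] (f : ℝ → G) :
    ∫ r, f (r : unitIoo) ∂iooVol = ∫ t in Set.Ioo (0 : ℝ) 1, f t :=
  integral_subtype_comap measurableSet_Ioo f

theorem IsBump.apply_eq_zero {a : ℝ → ℝ} (ha : IsBump a) {t : ℝ} (ht : t ∉ Set.Ioo (0 : ℝ) 1) :
    a t = 0 := image_eq_zero_of_notMem_tsupport fun h => ht (ha.subset h)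

theorem IsBump.hasDerivAt {a : ℝ → ℝ} (ha : IsBump a) (t : ℝ) : HasDerivAt a (deriv a t) t :=
  (ha.contDiff.differentiable (by simp) t).hasDerivAt

theorem IsBump.integral_deriv_mul_lt {a : ℝ → ℝ} (ha : IsBump a) (s : unitIoo) :
    ∫ r, (if s < r then 1 else 0) * deriv a (r : unitIoo) ∂iooVol = -a s := by
  have h0 : ∀ r : unitIoo, (if s < r then 1 else 0) * deriv a r
      = (Set.Ioi (s : ℝ)).indicator (deriv a) r := by
    intro r
    by_cases h : s < r
    · rw [if_pos h, Set.indicator_of_mem (show (r : ℝ) ∈ Set.Ioi (s : ℝ) from h), one_mul]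
    · rw [if_neg h, Set.indicator_of_notMem (show (r : ℝ) ∉ Set.Ioi (s : ℝ) from h), zero_mul]
  simp only [h0]
  rw [integral_iooVol, setIntegral_eq_integral_of_forall_compl_eq_zero,
    integral_indicator measurableSet_Ioi]
  · have h1 := integral_Ioi_of_hasDerivAt_of_tendsto (a := (s : ℝ)) (f := a) (m := 0)
      ha.contDiff.continuous.continuousWithinAt (fun t _ => ha.hasDerivAt t)
      (ha.derivative.contDiff.continuous.integrable_of_hasCompactSupport ha.derivative.compact).integrableOn
      (ha.compact.is_zero_at_infty.mono_left atTop_le_cocompact)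
    rw [h1, zero_sub]
  · intro t ht
    rw [Set.indicator_apply_eq_zero]
    exact fun _ => ha.derivative.apply_eq_zero ht

theorem IsBump.integral_deriv {a : ℝ → ℝ} (ha : IsBump a) :
    ∫ r, deriv a (r : unitIoo) ∂iooVol = 0 := by
  rw [integral_iooVol, setIntegral_eq_integral_of_forall_compl_eq_zero
    fun t ht => ha.derivative.apply_eq_zero ht]
  exact integral_eq_zero_of_hasDerivAt_of_integrable ha.hasDerivAt
    (ha.derivative.contDiff.continuous.integrable_of_hasCompactSupport ha.derivative.compact)
    (ha.contDiff.continuous.integrable_of_hasCompactSupport ha.compact)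

/-- Radial functions arising from families of forms are meaningful only on (0,1), because `toIoo`
takes default values elsewhere. Extension by zero repairs this. -/
theorem isBump_indicator {z : ℝ → ℝ} (hz : ContDiffOn ℝ ∞ z (Set.Ioo 0 1)) {K : Set ℝ}
    (hK : IsCompact K) (hK' : K ⊆ Set.Ioo 0 1) (h : ∀ t ∈ Set.Ioo (0 : ℝ) 1, t ∉ K → z t = 0) :
    IsBump ((Set.Ioo 0 1).indicator z) := by
  have h0 : ∀ t, t ∉ K → (Set.Ioo 0 1).indicator z t = 0 := by
    intro t ht
    rw [Set.indicator_apply_eq_zero]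
    exact fun h1 => h t h1 ht
  have hs : tsupport ((Set.Ioo 0 1).indicator z) ⊆ K :=
    closure_minimal (fun t ht => by
      by_contra hc
      exact ht (h0 t hc)) hK.isClosed
  refine ⟨?_, HasCompactSupport.intro hK h0, hs.trans hK'⟩
  rw [contDiff_iff_contDiffAt]
  intro t
  by_cases ht : t ∈ Set.Ioo (0 : ℝ) 1
  · refine (hz.contDiffAt (isOpen_Ioo.mem_nhds ht)).congr_of_eventuallyEq ?_
    filter_upwards [isOpen_Ioo.mem_nhds ht] with u hu
    exact Set.indicator_of_mem hu z
  · refine (contDiffAt_const (c := (0 : ℝ))).congr_of_eventuallyEq ?_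
    filter_upwards [hK.isClosed.isOpen_compl.mem_nhds fun h => ht (hK' h)] with u hu
    exact h0 u hu

end Radial

/-! ### Measurability of families and of fibrewise inner products -/

section Measurable

theorem measurable_of_forall_eq {X Y : Type*} [MeasurableSpace X] [MeasurableSpace Y] {f f' : X → Y}
    (h : ∀ x, f' x = f x) (hf : Measurable f) : Measurable f' := by
  rwa [show f' = f from funext h]

variable {E : Type*} [NormedAddCommGroup E] [NormedSpace ℝ E] [FiniteDimensional ℝ E]
  {H : Type*} [TopologicalSpace H] {I : ModelWithCorners ℝ E H} [I.Boundaryless]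
  {F : Type*} [TopologicalSpace F] [ChartedSpace H F] [IsManifold I ∞ F]
  [MeasurableSpace F] [BorelSpace F] [SecondCountableTopology F] {k : ℕ}

/-- Measurable families of forms. -/
def HForm.IsMeasurable (Φ : HForm I F k) : Prop :=
  ∀ (p₀ : F × unitIoo) (v : Fin k → E), Measurable fun p : (chartAt (ModelProd H ℝ) p₀).source =>
    Φ p fun j => chartVec I p₀.1 (p : F × unitIoo).1 (v j)

theorem apply_chartVec_cone {n : ℕ} (χ : DForm (I.prod 𝓘(ℝ, ℝ)) (F × unitIoo) n)
    {p₀ p : F × unitIoo} (hp : p ∈ (chartAt (ModelProd H ℝ) p₀).source) (v : Fin n → E × ℝ) :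
    (χ p fun j => chartVec (I.prod 𝓘(ℝ, ℝ)) p₀ p (v j))
      = (χ p : (E × ℝ) [⋀^Fin n]→L[ℝ] ℝ) fun j =>
        ((chartVec I p₀.1 p.1 : E →L[ℝ] E).prodMap (ContinuousLinearMap.id ℝ ℝ)) (v j) :=
  congrArg (fun L : E × ℝ →L[ℝ] E × ℝ => (χ p : (E × ℝ) [⋀^Fin n]→L[ℝ] ℝ) fun j => L (v j))
    (chartVec_cone (mem_chart_source_cone.1 hp))

theorem HForm.IsMeasurable.pull {Φ : HForm I F k} (h : Φ.IsMeasurable) :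
    (pull Φ).IsMeasurable := fun p₀ v => by
  exact measurable_of_forall_eq (fun p => apply_chartVec_cone (ConeL2.pull Φ) p.2 v)
    (h p₀ fun j => (v j).1)

theorem DForm.IsMeasurable.hor {χ : DForm (I.prod 𝓘(ℝ, ℝ)) (F × unitIoo) k}
    (h : χ.IsMeasurable) : (hor χ).IsMeasurable := fun p₀ v => by
  refine measurable_of_forall_eq (fun p => ?_) (h p₀ fun j => (v j, 0))
  exact (apply_chartVec_cone χ p.2 fun j => (v j, (0 : ℝ))).symm

theorem DForm.IsMeasurable.vert {χ : DForm (I.prod 𝓘(ℝ, ℝ)) (F × unitIoo) (k + 1)}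
    (h : χ.IsMeasurable) : (vert χ).IsMeasurable := fun p₀ v => by
  refine measurable_of_forall_eq (fun p => ?_) (h p₀ (Matrix.vecCons (0, 1) fun j => (v j, 0)))
  refine ((apply_chartVec_cone χ p.2 _).trans ?_).symm
  refine congrArg (χ (p : F × unitIoo) : (E × ℝ) [⋀^Fin (k + 1)]→L[ℝ] ℝ) (funext fun j => ?_)
  refine Fin.cases ?_ (fun i => ?_) j
  · exact Prod.ext (map_zero (chartVec I p₀.1 (p : F × unitIoo).1 : E →L[ℝ] E)) rfl
  · rfl

theorem DForm.IsMeasurable.const {φ : DForm I F k} (h : φ.IsMeasurable) :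
    HForm.IsMeasurable (fun p => φ p.1 : HForm I F k) := fun p₀ v => by
  have h1 : Measurable fun p : (chartAt (ModelProd H ℝ) p₀).source =>
      (⟨(p : F × unitIoo).1, mem_chart_source_cone.1 p.2⟩ : (chartAt H p₀.1).source) :=
    (measurable_fst.comp measurable_subtype_coe).subtype_mk
  exact (h p₀.1 v).comp h1

theorem HForm.IsMeasurable.slice {Φ : HForm I F k} (h : Φ.IsMeasurable) (r : unitIoo) :
    (Φ.slice r).IsMeasurable := fun x₀ v => by
  have h1 : Measurable fun x : (chartAt H x₀).source =>
      (⟨((x : F), r), mem_chart_source_cone.2 x.2⟩ :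
        (chartAt (ModelProd H ℝ) (x₀, r)).source) :=
    (measurable_subtype_coe.prodMk measurable_const).subtype_mk
  exact (h (x₀, r) v).comp h1

theorem HForm.IsMeasurable.smul {b : F × unitIoo → ℝ} (hb : Measurable b) {Φ : HForm I F k}
    (h : Φ.IsMeasurable) : HForm.IsMeasurable (fun p => b p • Φ p : HForm I F k) :=
  fun p₀ v => (hb.comp measurable_subtype_coe).mul (h p₀ v)

theorem HForm.IsSmooth.isMeasurable {Φ : HForm I F k} (h : Φ.IsSmooth) : Φ.IsMeasurable := by
  have := h.pull.isMeasurable.hor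
  rwa [hor_pull] at this

theorem formInner_cone_pull (g : RiemMetric I F) (c : ℝ) (p : F × unitIoo) (n : ℕ)
    (χ : DForm (I.prod 𝓘(ℝ, ℝ)) (F × unitIoo) k) (Φ : HForm I F k) :
    (p.2 : ℝ) ^ (c * n) * formInner (coneMetric g c) p (χ p) (pull Φ p)
      = weight n c k p.2 * formInner g p.1 (hor χ p) (Φ p) := by
  cases k with
  | zero => rw [formInner_cone_zero, hor_pull]
  | succ k =>
    rw [formInner_cone_succ, hor_pull, vert_pull]
    have : formInner g p.1 (vert χ p) ((0 : HForm I F k) p) = 0 := formInner_zero_right _ _ _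
    rw [this, mul_zero, add_zero]

theorem formInner_cone_wedge (g : RiemMetric I F) (c : ℝ) (p : F × unitIoo) (n : ℕ)
    (χ : DForm (I.prod 𝓘(ℝ, ℝ)) (F × unitIoo) (k + 1)) (Φ : HForm I F k) :
    (p.2 : ℝ) ^ (c * n) * formInner (coneMetric g c) p (χ p) (wedge Φ p)
      = weight n c k p.2 * formInner g p.1 (vert χ p) (Φ p) := by
  rw [formInner_cone_succ, hor_wedge, vert_wedge]
  have : formInner g p.1 (hor χ p) ((0 : HForm I F (k + 1)) p) = 0 := formInner_zero_right _ _ _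
  rw [this, mul_zero, zero_add]

/-- Up to a positive continuous factor the fibrewise inner product is that of a cone metric, here
with c = 1 and n = 0. Measurability and continuity on F × (0,1) thus follow from the statements for
a single manifold. -/
theorem formInner_eq_pull (g : RiemMetric I F) (p : F × unitIoo) (Φ Ψ : HForm I F k) :
    formInner g p.1 (Φ p) (Ψ p)
      = (weight 0 1 k p.2)⁻¹ * formInner (coneMetric g 1) p (pull Φ p) (pull Ψ p) := by
  have h := formInner_cone_pull g 1 p 0 (pull Φ) Ψ
  rw [hor_pull, Nat.cast_zero, mul_zero, Real.rpow_zero, one_mul] at h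
  rw [h, ← mul_assoc, inv_mul_cancel₀ (weight_pos 0 1 k p.2).ne', one_mul]

theorem continuous_rpow_coe (w : ℝ) : Continuous fun r : unitIoo => (r : ℝ) ^ w :=
  continuous_iff_continuousAt.2 fun r =>
    (Real.continuousAt_rpow_const (r : ℝ) w (Or.inl r.2.1.ne')).comp
      continuous_subtype_val.continuousAt

theorem continuous_weight (n : ℕ) (c : ℝ) : Continuous (weight n c k) := continuous_rpow_coe _

theorem HForm.IsMeasurable.formInner (g : RiemMetric I F) {Φ Ψ : HForm I F k}
    (hΦ : Φ.IsMeasurable) (hΨ : Ψ.IsMeasurable) :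
    Measurable fun p : F × unitIoo => formInner g p.1 (Φ p) (Ψ p) := by
  simp only [formInner_eq_pull g]
  exact ((continuous_weight 0 1).measurable.comp measurable_snd).inv.mul
    (measurable_formInner (coneMetric g 1) hΦ.pull hΨ.pull)

theorem HForm.IsSmooth.continuous_formInner (g : RiemMetric I F) {Φ Ψ : HForm I F k}
    (hΦ : Φ.IsSmooth) (hΨ : Ψ.IsSmooth) :
    Continuous fun p : F × unitIoo => ConeL2.formInner g p.1 (Φ p) (Ψ p) := by
  simp only [formInner_eq_pull g]
  exact (((continuous_weight 0 1).comp continuous_snd).inv₀ fun p =>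
    (weight_pos 0 1 k p.2).ne').mul (hΦ.pull.continuous_formInner (coneMetric g 1) hΨ.pull)

end Measurable

/-! ### Weighted square integrability and the L² inner product of the cone -/

section SqInt

variable {E : Type*} [NormedAddCommGroup E] [NormedSpace ℝ E] [FiniteDimensional ℝ E]
  [MeasurableSpace E] [BorelSpace E]
  {H : Type*} [TopologicalSpace H] {I : ModelWithCorners ℝ E H} [I.Boundaryless]
  {F : Type*} [TopologicalSpace F] [ChartedSpace H F] [IsManifold I ∞ F]
  [MeasurableSpace F] [BorelSpace F] [SecondCountableTopology F] {k : ℕ}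

/-- Families of forms which are square integrable with respect to the weight `r ^ w`. -/
structure HForm.SqInt (g : RiemMetric I F) (w : ℝ) (Φ : HForm I F k) : Prop where
  meas : Φ.IsMeasurable
  integrable : Integrable (fun p : F × unitIoo =>
    (p.2 : ℝ) ^ w * formInner g p.1 (Φ p) (Φ p)) (baseVol g)

variable (E) in
/-- The exponent of the weight of the horizontal `k`-forms in the `L²` norm of a cone. -/
def expo (c : ℝ) (k : ℕ) : ℝ := c * (Module.finrank ℝ E - 2 * k)

theorem weight_eq_rpow (c : ℝ) (k : ℕ) (r : unitIoo) :
    weight (Module.finrank ℝ E) c k r = (r : ℝ) ^ expo E c k := rfl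

theorem rpow_nonneg_coe (r : unitIoo) (w : ℝ) : 0 ≤ (r : ℝ) ^ w := Real.rpow_nonneg r.2.1.le w

theorem sqInt_hor {g : RiemMetric I F} {c : ℝ} {χ : DForm (I.prod 𝓘(ℝ, ℝ)) (F × unitIoo) k}
    (h : χ ∈ sqIntegrable (coneMetric g c) k) : (hor χ).SqInt g (expo E c k) := by
  have h2 := (integrable_cone g c _).1 h.2
  refine ⟨h.1.hor, ?_⟩
  cases k with
  | zero =>
    simp only [formInner_cone_zero, weight_eq_rpow] at h2
    exact h2
  | succ k =>
    refine h2.mono' ?_ (Filter.Eventually.of_forall fun p => ?_)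
    · exact ((continuous_rpow_coe _).measurable.comp measurable_snd |>.mul
        (h.1.hor.formInner g h.1.hor)).aestronglyMeasurable
    · have h3 := formInner_self_nonneg g p.1 (vert χ p)
      have h4 := formInner_self_nonneg g p.1 (hor χ p)
      rw [formInner_cone_succ, weight_eq_rpow, weight_eq_rpow, Real.norm_of_nonneg
        (mul_nonneg (rpow_nonneg_coe _ _) h4)]
      exact le_add_of_nonneg_right (mul_nonneg (rpow_nonneg_coe _ _) h3)

theorem sqInt_vert {g : RiemMetric I F} {c : ℝ}
    {χ : DForm (I.prod 𝓘(ℝ, ℝ)) (F × unitIoo) (k + 1)}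
    (h : χ ∈ sqIntegrable (coneMetric g c) (k + 1)) : (vert χ).SqInt g (expo E c k) := by
  have h2 := (integrable_cone g c _).1 h.2
  refine ⟨h.1.vert, ?_⟩
  refine h2.mono' ?_ (Filter.Eventually.of_forall fun p => ?_)
  · exact ((continuous_rpow_coe _).measurable.comp measurable_snd |>.mul
      (h.1.vert.formInner g h.1.vert)).aestronglyMeasurable
  · have h3 := formInner_self_nonneg g p.1 (vert χ p)
    have h4 := formInner_self_nonneg g p.1 (hor χ p)
    rw [formInner_cone_succ, weight_eq_rpow, weight_eq_rpow, Real.norm_of_nonneg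
      (mul_nonneg (rpow_nonneg_coe _ _) h3)]
    exact le_add_of_nonneg_left (mul_nonneg (rpow_nonneg_coe _ _) h4)

theorem pull_mem_sqIntegrable {g : RiemMetric I F} {c : ℝ} {Φ : HForm I F k} :
    Φ.SqInt g (expo E c k) → pull Φ ∈ sqIntegrable (coneMetric g c) k := fun h => by
  refine ⟨h.meas.pull, (integrable_cone g c _).2 ?_⟩
  simp only [formInner_cone_pull, hor_pull, weight_eq_rpow]
  exact h.integrable

theorem integral_cone_pull (g : RiemMetric I F) (c : ℝ)
    (χ : DForm (I.prod 𝓘(ℝ, ℝ)) (F × unitIoo) k) (Φ : HForm I F k) :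
    ∫ p, formInner (coneMetric g c) p (χ p) (pull Φ p) ∂(riemVolume (coneMetric g c))
      = ∫ p, (p.2 : ℝ) ^ expo E c k * formInner g p.1 (hor χ p) (Φ p) ∂(baseVol g) := by
  rw [integral_cone]
  simp only [formInner_cone_pull, weight_eq_rpow]

theorem integral_cone_wedge (g : RiemMetric I F) (c : ℝ)
    (χ : DForm (I.prod 𝓘(ℝ, ℝ)) (F × unitIoo) (k + 1)) (Φ : HForm I F k) :
    ∫ p, formInner (coneMetric g c) p (χ p) (wedge Φ p) ∂(riemVolume (coneMetric g c))
      = ∫ p, (p.2 : ℝ) ^ expo E c k * formInner g p.1 (vert χ p) (Φ p) ∂(baseVol g) := by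
  rw [integral_cone]
  simp only [formInner_cone_wedge, weight_eq_rpow]

theorem HForm.SqInt.integrable_formInner {g : RiemMetric I F} {w : ℝ} {Φ Ψ : HForm I F k}
    (hΦ : Φ.SqInt g w) (hΨ : Ψ.SqInt g w) :
    Integrable (fun p : F × unitIoo => (p.2 : ℝ) ^ w * formInner g p.1 (Φ p) (Ψ p))
      (baseVol g) := by
  refine (hΦ.integrable.add hΨ.integrable).mono' ?_ (Filter.Eventually.of_forall fun p => ?_)
  · exact ((continuous_rpow_coe _).measurable.comp measurable_snd |>.mul
      (hΦ.meas.formInner g hΨ.meas)).aestronglyMeasurable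
  · rw [norm_mul, Real.norm_of_nonneg (rpow_nonneg_coe _ _), Pi.add_apply, ← mul_add]
    exact mul_le_mul_of_nonneg_left (abs_formInner_le g _ _ _) (rpow_nonneg_coe _ _)

theorem integral_cone_succ {g : RiemMetric I F} {c : ℝ}
    {χ ξ : DForm (I.prod 𝓘(ℝ, ℝ)) (F × unitIoo) (k + 1)}
    (h : χ ∈ sqIntegrable (coneMetric g c) (k + 1))
    (h' : ξ ∈ sqIntegrable (coneMetric g c) (k + 1)) :
    ∫ p, formInner (coneMetric g c) p (χ p) (ξ p) ∂(riemVolume (coneMetric g c))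
      = ∫ p, (p.2 : ℝ) ^ expo E c (k + 1) * formInner g p.1 (hor χ p) (hor ξ p) ∂(baseVol g)
        + ∫ p, (p.2 : ℝ) ^ expo E c k * formInner g p.1 (vert χ p) (vert ξ p) ∂(baseVol g) := by
  rw [integral_cone]
  simp only [formInner_cone_succ, weight_eq_rpow]
  exact integral_add ((sqInt_hor h).integrable_formInner (sqInt_hor h'))
    ((sqInt_vert h).integrable_formInner (sqInt_vert h'))

/-- Smooth compactly supported families are square integrable for all weights. -/
theorem HForm.IsTest.sqInt [T2Space F] (g : RiemMetric I F) (w : ℝ) {Φ : HForm I F k}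
    (h : Φ.IsTest) : Φ.SqInt g w := by
  refine ⟨h.1.isMeasurable, ?_⟩
  have h1 : Continuous fun p : F × unitIoo => (p.2 : ℝ) ^ w * formInner g p.1 (Φ p) (Φ p) :=
    ((continuous_rpow_coe w).comp continuous_snd).mul (h.1.continuous_formInner g h.1)
  have : IsLocallyFiniteMeasure (baseVol g) := by
    rw [baseVol]
    infer_instance
  refine h1.integrable_of_hasCompactSupport ?_
  obtain ⟨_, K, hK, h2⟩ := h
  refine HasCompactSupport.intro hK fun p hp => ?_
  rw [h2 p hp, formInner_zero_left, mul_zero]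

end SqInt

/-! ### The fundamental lemma of the calculus of variations on the interval -/

section DuBoisReymond

theorem measurableEmbedding_coe : MeasurableEmbedding (Subtype.val : unitIoo → ℝ) :=
  MeasurableEmbedding.subtype_coe measurableSet_Ioo

theorem map_iooVol :
    iooVol.map (Subtype.val : unitIoo → ℝ) = (volume : Measure ℝ).restrict (Set.Ioo 0 1) := by
  rw [iooVol, measurableEmbedding_coe.map_comap, Subtype.range_coe]
  rfl

theorem integrable_iooVol {f : ℝ → ℝ} :
    Integrable (fun r : unitIoo => f r) iooVol ↔ IntegrableOn f (Set.Ioo 0 1) := by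
  have h := (MeasurableEmbedding.subtype_coe (s := Set.Ioo (0 : ℝ) 1)
    measurableSet_Ioo).integrableOn_range_iff_comap (f := f) (μ := volume)
  rw [Subtype.range_coe] at h
  exact h.symm

theorem ae_iooVol {P : ℝ → Prop} :
    (∀ᵐ r ∂iooVol, P (r : unitIoo)) ↔ ∀ᵐ t, t ∈ Set.Ioo (0 : ℝ) 1 → P t := by
  rw [← ae_restrict_iff' measurableSet_Ioo, ← map_iooVol, measurableEmbedding_coe.ae_map_iff]

theorem IsBump.integrable_mul_of_continuous {a : ℝ → ℝ} (ha : IsBump a) {f : unitIoo → ℝ}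
    (hf : Continuous f) : Integrable (fun r : unitIoo => a r * f r) iooVol := by
  have : IsFiniteMeasureOnCompacts iooVol := inferInstance
  refine ((ha.contDiff.continuous.comp continuous_subtype_val).mul hf).integrable_of_hasCompactSupport
    (HasCompactSupport.intro (isCompact_preimage_coe ha.compact ha.subset) fun r hr => ?_)
  have : a r = 0 := image_eq_zero_of_notMem_tsupport hr
  simp [this]

/-- Only integrability against bumps is required, which is what weighted square integrability
provides; local integrability on the open interval is deduced from it. -/
theorem ae_eq_zero_of_integral_bump {f : unitIoo → ℝ} (hm : AEStronglyMeasurable f iooVol)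
    (hi : ∀ a, IsBump a → Integrable (fun r : unitIoo => a r * f r) iooVol)
    (h0 : ∀ a, IsBump a → ∫ r : unitIoo, a r * f r ∂iooVol = 0) : ∀ᵐ r ∂iooVol, f r = 0 := by
  have hf : ∀ r : unitIoo, f r = f (toIoo r) := fun r => by rw [toIoo_coe]
  have key : ∀ᵐ t, t ∈ Set.Ioo (0 : ℝ) 1 → f (toIoo t) = 0 := by
    refine IsOpen.ae_eq_zero_of_integral_contDiff_smul_eq_zero isOpen_Ioo ?_ fun a h1 h2 h3 => ?_
    · have hm' : AEStronglyMeasurable (fun t => f (toIoo t))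
          ((volume : Measure ℝ).restrict (Set.Ioo 0 1)) := by
        rw [← map_iooVol]
        refine measurableEmbedding_coe.aestronglyMeasurable_map_iff.2 ?_
        exact hm.congr (Filter.Eventually.of_forall hf)
      intro t ht
      -- With a(t) = 1 one has |f| ≤ 2 |a f| on the neighbourhood {a > 1/2} of t.
      obtain ⟨a, h1, h2, h3, h4, h5⟩ := exists_contDiff_tsupport_subset (n := ⊤)
        (isOpen_Ioo.mem_nhds ht)
      have ha : IsBump a := ⟨h3, h2, h1⟩
      have h6 := hi a ha
      have h7 : IntegrableOn (fun t => a t * f (toIoo t)) (Set.Ioo 0 1) := by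
        refine integrable_iooVol.1 (h6.congr (Filter.Eventually.of_forall fun r => ?_))
        beta_reduce
        rw [hf r]
      have h8 : {t | 1 / 2 < a t} ∈ 𝓝 t :=
        (isOpen_lt continuous_const h3.continuous).mem_nhds (by rw [Set.mem_ofPred, h5]; norm_num)
      refine ⟨{t | 1 / 2 < a t} ∩ Set.Ioo 0 1, ?_, ?_⟩
      · exact mem_nhdsWithin_of_mem_nhds (Filter.inter_mem h8 (isOpen_Ioo.mem_nhds ht))
      · refine ((h7.mono_set (s := {t | 1 / 2 < a t} ∩ Set.Ioo 0 1)
          Set.inter_subset_right).norm.const_mul 2).mono'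
          (hm'.mono_measure (Measure.restrict_mono Set.inter_subset_right le_rfl)) ?_
        refine (ae_restrict_iff' (((isOpen_lt continuous_const h3.continuous).measurableSet).inter
          measurableSet_Ioo)).2 (Filter.Eventually.of_forall fun u hu => ?_)
        have h9 : (1 : ℝ) / 2 < a u := hu.1
        rw [norm_mul, Real.norm_of_nonneg (show 0 ≤ a u by linarith)]
        nlinarith [norm_nonneg (f (toIoo u))]
    · have ha : IsBump a := ⟨h1, h2, h3⟩
      rw [← setIntegral_eq_integral_of_forall_compl_eq_zero (s := Set.Ioo (0 : ℝ) 1)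
        fun t ht => by rw [ha.apply_eq_zero ht, zero_smul], ← integral_iooVol, ← h0 a ha]
      refine integral_congr_ae (Filter.Eventually.of_forall fun r => ?_)
      beta_reduce
      rw [hf r, smul_eq_mul]
  filter_upwards [ae_iooVol.2 key] with r hr
  rw [hf r, hr]

theorem eq_zero_of_integral_bump {f : unitIoo → ℝ} (hf : Continuous f)
    (h0 : ∀ a, IsBump a → ∫ r : unitIoo, a r * f r ∂iooVol = 0) (r : unitIoo) : f r = 0 := by
  have h1 := ae_eq_zero_of_integral_bump hf.aestronglyMeasurable
    (fun a ha => ha.integrable_mul_of_continuous hf) h0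
  have h2 : (fun t => f (toIoo t)) =ᵐ[(volume : Measure ℝ).restrict (Set.Ioo 0 1)] fun _ => 0 := by
    refine (ae_restrict_iff' measurableSet_Ioo).2 (ae_iooVol.1 ?_)
    filter_upwards [h1] with r hr
    rwa [toIoo_coe]
  have hc : ContinuousOn (fun t => f (toIoo t)) (Set.Ioo 0 1) := by
    refine hf.comp_continuousOn ?_
    have := continuousOn_extChartAt_symm (I := 𝓘(ℝ, ℝ)) (⟨1 / 2, by norm_num⟩ : unitIoo)
    rwa [extChartAt_unitIoo_target] at this
  have h3 := Measure.eqOn_open_of_ae_eq h2 isOpen_Ioo hc continuousOn_const r.2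
  simpa only [toIoo_coe] using h3

end DuBoisReymond

/-! ### Pairings of families with test forms -/

section Tests

/-- Gives a dominating function, constant on a compact subset of X and zero off it, uniform in the
second variable. -/
theorem exists_indicator_bound {X Y : Type*} [TopologicalSpace X] [TopologicalSpace Y]
    {f : X × Y → ℝ} (hf : Continuous f) {K : Set (X × Y)} (hK : IsCompact K)
    (h0 : ∀ p ∉ K, f p = 0) :
    ∃ (S : Set X) (C : ℝ), IsCompact S ∧ ∀ p, f p ≤ S.indicator (fun _ => C) p.1 := by
  obtain ⟨C, hC⟩ := hK.exists_bound_of_continuousOn hf.continuousOn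
  refine ⟨Prod.fst '' K, max C 0, hK.image continuous_fst, fun p => ?_⟩
  by_cases hp : p ∈ K
  · rw [Set.indicator_of_mem (Set.mem_image_of_mem _ hp)]
    exact ((le_abs_self _).trans (hC p hp)).trans (le_max_left _ _)
  · rw [h0 p hp]
    exact Set.indicator_nonneg (fun _ _ => le_max_right _ _) _

variable {E : Type*} [NormedAddCommGroup E] [NormedSpace ℝ E] [FiniteDimensional ℝ E]
  [MeasurableSpace E] [BorelSpace E]
  {H : Type*} [TopologicalSpace H] {I : ModelWithCorners ℝ E H} [I.Boundaryless]
  {F : Type*} [TopologicalSpace F] [ChartedSpace H F] [IsManifold I ∞ F]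
  [MeasurableSpace F] [BorelSpace F] [SecondCountableTopology F] {k : ℕ}

/-- The inner product with a given form, as a linear functional on a fibre. -/
def formInnerL (g : RiemMetric I F) (x : F) (α : TangentSpace I x [⋀^Fin k]→L[ℝ] ℝ) :
    E [⋀^Fin k]→L[ℝ] ℝ →L[ℝ] ℝ :=
  LinearMap.toContinuousLinearMap
    { toFun := fun β => formInner g x α β
      map_add' := fun β β' => formInner_add_right g x α β β'
      map_smul' := fun s β => formInner_smul_right g x s α β }

theorem HForm.IsTest.isBump_formInner [T2Space F] (g : RiemMetric I F) {Φ : HForm I F k}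
    (h : Φ.IsTest) (x : F) (α : TangentSpace I x [⋀^Fin k]→L[ℝ] ℝ) :
    IsBump ((Set.Ioo 0 1).indicator fun t => formInnerL g x α (Φ.curve x t)) := by
  obtain ⟨h1, K, hK, h2⟩ := h
  refine isBump_indicator (K := (fun p : F × unitIoo => (p.2 : ℝ)) '' K) ?_
    (hK.image (by fun_prop)) ?_ fun t ht htK => ?_
  · exact (formInnerL g x α).contDiff.comp_contDiffOn fun t ht =>
      (h1.contDiffAt_radial x ht).contDiffWithinAt
  · rintro _ ⟨p, _, rfl⟩
    exact p.2.2
  · have : Φ (x, toIoo t) = 0 := h2 _ fun hK => htK ⟨_, hK, coe_toIoo ht⟩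
    exact (congrArg (formInnerL g x α) this).trans (map_zero _)

theorem HForm.IsSmooth.deriv_formInner (g : RiemMetric I F) {Φ : HForm I F k} (h : Φ.IsSmooth)
    (x : F) (α : TangentSpace I x [⋀^Fin k]→L[ℝ] ℝ) (r : unitIoo) :
    deriv ((Set.Ioo 0 1).indicator fun t => formInnerL g x α (Φ.curve x t)) r
      = formInner g x α (Φ.dR (x, r)) := by
  have h1 : ((Set.Ioo 0 1).indicator fun t => formInnerL g x α (Φ.curve x t)) =ᶠ[𝓝 (r : ℝ)]
      fun t => formInnerL g x α (Φ.curve x t) := by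
    filter_upwards [isOpen_Ioo.mem_nhds r.2] with t ht
    exact Set.indicator_of_mem ht _
  rw [h1.deriv_eq]
  have h2 := (formInnerL g x α).hasFDerivAt.comp_hasDerivAt (r : ℝ) (h.hasDerivAt x r.2)
  rw [toIoo_coe] at h2
  exact h2.deriv

theorem indicator_formInnerL (g : RiemMetric I F) (Φ : HForm I F k)
    (x : F) (α : TangentSpace I x [⋀^Fin k]→L[ℝ] ℝ) (r : unitIoo) :
    ((Set.Ioo 0 1).indicator fun t => formInnerL g x α (Φ.curve x t)) r
      = formInner g x α (Φ (x, r)) := by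
  rw [Set.indicator_of_mem (show (r : ℝ) ∈ Set.Ioo (0 : ℝ) 1 from r.2), HForm.curve, toIoo_coe]
  rfl

/-- By Fubini: for fixed x the integrand is the derivative of a bump function in r. -/
theorem HForm.IsTest.integral_dR [T2Space F] (g : RiemMetric I F) {Φ : HForm I F k}
    (h : Φ.IsTest) (η : DForm I F k) :
    ∫ p, formInner g p.1 (η p.1) (Φ.dR p) ∂(baseVol g) = 0 := by
  by_cases hi : Integrable (fun p : F × unitIoo => formInner g p.1 (η p.1) (Φ.dR p)) (baseVol g)
  · rw [baseVol, integral_prod _ hi]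
    refine (integral_congr_ae (Filter.Eventually.of_forall fun x => ?_)).trans
      (integral_zero _ _)
    have h1 := (h.isBump_formInner g x (η x)).integral_deriv
    simp only [h.1.deriv_formInner] at h1
    exact h1
  -- Without integrability the integral has the default value 0.
  · exact integral_undef hi

/-- Compact support lies away from the tip, so a test family may be multiplied by r^{-w} to cancel
the weight. -/
theorem HForm.SqInt.integrable_test [T2Space F] {g : RiemMetric I F} {w : ℝ} {Φ Z : HForm I F k}
    (hΦ : Φ.SqInt g w) (hZ : Z.IsTest) :
    Integrable (fun p : F × unitIoo => formInner g p.1 (Φ p) (Z p)) (baseVol g) := by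
  have h1 : ContDiffOn ℝ ∞ (fun t : ℝ => t ^ (-w)) (Set.Ioo 0 1) := fun t ht =>
    (Real.contDiffAt_rpow_const_of_ne ht.1.ne').contDiffWithinAt
  refine (hΦ.integrable_formInner ((hZ.radial_smul h1).sqInt g w)).congr
    (Filter.Eventually.of_forall fun p => ?_)
  beta_reduce
  rw [formInner_smul_right, ← mul_assoc, ← Real.rpow_add p.2.2.1, add_neg_cancel,
    Real.rpow_zero, one_mul]

theorem contDiffOn_rpow_Ioo (w : ℝ) : ContDiffOn ℝ ∞ (fun t : ℝ => t ^ w) (Set.Ioo 0 1) :=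
  fun _ ht => (Real.contDiffAt_rpow_const_of_ne ht.1.ne').contDiffWithinAt

/-- The `L²` inner product of the members of a family of forms with a fixed form. -/
def pairing (g : RiemMetric I F) (Φ : HForm I F k) (η : DForm I F k) (r : unitIoo) : ℝ :=
  ∫ x, formInner g x (Φ (x, r)) (η x) ∂(riemVolume g)

theorem integral_baseVol_eq {g : RiemMetric I F} {Φ Z : HForm I F k}
    (h : Integrable (fun p : F × unitIoo => formInner g p.1 (Φ p) (Z p)) (baseVol g)) :
    ∫ p, formInner g p.1 (Φ p) (Z p) ∂(baseVol g) = ∫ r, pairing g Φ (Z.slice r) r ∂iooVol :=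
  integral_prod_symm _ h

theorem HForm.SqInt.slice_mem {g : RiemMetric I F} {w : ℝ} {Φ : HForm I F k} (h : Φ.SqInt g w) :
    ∀ᵐ r ∂iooVol, Φ.slice r ∈ sqIntegrable g k := by
  filter_upwards [h.integrable.prod_left_ae] with r hr
  refine ⟨h.meas.slice r, (hr.const_mul ((r : ℝ) ^ (-w))).congr
    (Filter.Eventually.of_forall fun x => ?_)⟩
  beta_reduce
  rw [← mul_assoc, ← Real.rpow_add r.2.1, neg_add_cancel, Real.rpow_zero, one_mul]
  rfl

/-- Dominated convergence with the bound |η|² + C·1_S, where S is compact and contains the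
projection to F of the support of Z. -/
theorem HForm.IsTest.continuous_pairing [T2Space F] (g : RiemMetric I F) {η : DForm I F k}
    (hη : η ∈ sqIntegrable g k) {Z : HForm I F k} (hZ : Z.IsTest) :
    Continuous fun r : unitIoo => ∫ x, formInner g x (η x) (Z (x, r)) ∂(riemVolume g) := by
  obtain ⟨K, hK, hK0⟩ := hZ.2
  obtain ⟨S, C, hS, hSC⟩ := exists_indicator_bound (hZ.1.continuous_formInner g hZ.1) hK
    fun p hp => by rw [hK0 p hp, formInner_zero_left]
  refine continuous_of_dominated (bound := fun x => formInner g x (η x) (η x)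
    + S.indicator (fun _ => C) x) (fun r => ?_) (fun r => ?_) ?_ ?_
  · exact (measurable_formInner g hη.1 (hZ.1.isMeasurable.slice r)).aestronglyMeasurable
  · refine Filter.Eventually.of_forall fun x => ?_
    have hb := hSC (x, r)
    rw [Real.norm_eq_abs]
    linarith [abs_formInner_le g x (η x) (Z (x, r))]
  · refine hη.2.add ((integrable_indicator_iff hS.measurableSet).2 ?_)
    exact integrableOn_const hS.measure_lt_top.ne
  · refine Filter.Eventually.of_forall fun x => ?_
    have h1 : Continuous fun r : unitIoo => formInnerL g x (η x) (Z.curve x r) :=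
      (formInnerL g x (η x)).continuous.comp (continuous_iff_continuousAt.2 fun r =>
        ((hZ.1.contDiffAt_radial x r.2).continuousAt).comp continuous_subtype_val.continuousAt)
    refine h1.congr fun r => ?_
    rw [HForm.curve, toIoo_coe]
    rfl

end Tests

/-! ### Products of forms with radial functions -/

section Tests

variable {E : Type*} [NormedAddCommGroup E] [NormedSpace ℝ E] [FiniteDimensional ℝ E]
  {H : Type*} [TopologicalSpace H] {I : ModelWithCorners ℝ E H} [I.Boundaryless]
  {F : Type*} [TopologicalSpace F] [ChartedSpace H F] [IsManifold I ∞ F] {k : ℕ}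

theorem DForm.d_const_smul (b : ℝ) (φ : DForm I F k) (x : F) :
    DForm.d (b • φ) x = b • φ.d x := by
  rw [DForm.d_apply, DForm.d_apply]
  have h1 : (b • φ).inChart x = b • φ.inChart x := rfl
  rw [h1, extDeriv_smul]
  rfl

theorem HForm.dF_zero : HForm.dF (0 : HForm I F k) = 0 :=
  funext fun _ => DForm.d_eq_zero_of_eventually (Filter.Eventually.of_forall fun _ => rfl)

theorem vert_d_pull {Φ : HForm I F k} (h : Φ.IsSmooth) : vert (pull Φ).d = Φ.dR := by
  cases k with
  | zero => rw [vert_d_zero h.pull, hor_pull]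
  | succ k =>
    funext p
    have h1 := vert_d_succ h.pull p
    rw [hor_pull, vert_pull, HForm.dF_zero] at h1
    exact h1.trans (sub_zero _)

theorem hor_d_pull {Φ : HForm I F k} (h : Φ.IsSmooth) : hor (pull Φ).d = Φ.dF := by
  rw [hor_d h.pull, hor_pull]

theorem HForm.dR_smul {b : ℝ → ℝ} (hb : ContDiffOn ℝ ∞ b (Set.Ioo 0 1)) {Φ : HForm I F k}
    (h : Φ.IsSmooth) (p : F × unitIoo) :
    HForm.dR (fun p => b p.2 • Φ p : HForm I F k) p = deriv b p.2 • Φ p + b p.2 • Φ.dR p := by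
  have hb' : HasDerivAt b (deriv b p.2) p.2 :=
    ((hb.contDiffAt (isOpen_Ioo.mem_nhds p.2.2)).differentiableAt (by simp)).hasDerivAt
  let D : E [⋀^Fin k]→L[ℝ] ℝ := Φ.dR (p.1, toIoo p.2)
  have h1 : HasDerivAt (fun t => b t • Φ.curve p.1 t)
      (b p.2 • D + deriv b p.2 • Φ.curve p.1 p.2) (p.2 : ℝ) := hb'.smul (h.hasDerivAt p.1 p.2.2)
  have h2 : (HForm.curve (fun p => b p.2 • Φ p : HForm I F k) p.1) =ᶠ[𝓝 (p.2 : ℝ)]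
      fun t => b t • Φ.curve p.1 t := by
    filter_upwards [isOpen_Ioo.mem_nhds p.2.2] with t ht
    rw [HForm.curve, coe_toIoo ht]
    rfl
  have h3 := h2.deriv_eq.trans h1.deriv
  rw [HForm.curve, add_comm] at h3
  simp only [D] at h3
  rw [toIoo_coe] at h3
  exact h3

theorem DForm.IsSmooth.isSmooth_fst {φ : DForm I F k} (h : φ.IsSmooth) :
    HForm.IsSmooth (fun p => φ p.1 : HForm I F k) := fun x₀ =>
  (h x₀).comp contDiffOn_fst fun _ hy => hy.1

theorem HForm.dR_fst (φ : DForm I F k) (p : F × unitIoo) :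
    HForm.dR (fun p => φ p.1 : HForm I F k) p = 0 :=
  deriv_const (F := E [⋀^Fin k]→L[ℝ] ℝ) (p.2 : ℝ) (φ p.1)

/-- The family `a(r) r ^ (-w) φ`. -/
def scaled (a : ℝ → ℝ) (w : ℝ) (φ : DForm I F k) : HForm I F k :=
  fun p => (a p.2 * (p.2 : ℝ) ^ (-w)) • φ p.1

theorem IsBump.isTest_scaled {a : ℝ → ℝ} (ha : IsBump a) (w : ℝ) {φ : DForm I F k}
    (h : φ.IsTest) : (scaled a w φ).IsTest := ha.isTest_mul (contDiffOn_rpow_Ioo (-w)) h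

theorem IsBump.neg {a : ℝ → ℝ} (ha : IsBump a) : IsBump (-a) := by
  have h : tsupport (-a) = tsupport a := by
    rw [tsupport, tsupport, Function.support_neg]
  exact ⟨ha.contDiff.neg, ha.compact.neg, h ▸ ha.subset⟩

/-- The factor r^{-w} built into `scaled` cancels the weight of the cone measure, leaving the
unweighted pairing with a(r) φ. -/
theorem formInner_scaled (g : RiemMetric I F) (a : ℝ → ℝ) (w : ℝ) (φ : DForm I F k)
    (p : F × unitIoo) (α : TangentSpace I p.1 [⋀^Fin k]→L[ℝ] ℝ) :
    (p.2 : ℝ) ^ w * formInner g p.1 α (scaled a w φ p) = a p.2 * formInner g p.1 α (φ p.1) := by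
  rw [scaled, formInner_smul_right, mul_comm (a p.2), ← mul_assoc, ← mul_assoc,
    ← Real.rpow_add p.2.2.1, add_neg_cancel, Real.rpow_zero, one_mul]

end Tests

/-! ### Test pairs on the cone built from test pairs on F -/

section Pairs

variable {E : Type*} [NormedAddCommGroup E] [NormedSpace ℝ E] [FiniteDimensional ℝ E]
  [MeasurableSpace E] [BorelSpace E]
  {H : Type*} [TopologicalSpace H] {I : ModelWithCorners ℝ E H} [I.Boundaryless]
  {F : Type*} [TopologicalSpace F] [T2Space F] [ChartedSpace H F] [IsManifold I ∞ F]
  [MeasurableSpace F] [BorelSpace F] [SecondCountableTopology F] {k : ℕ}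

theorem HForm.SqInt.integrable_bump {g : RiemMetric I F} {w : ℝ} {Φ : HForm I F k}
    (hΦ : Φ.SqInt g w) {a : ℝ → ℝ} (ha : IsBump a) {ζ : DForm I F k} (hζ : ζ.IsTest) :
    Integrable (fun p : F × unitIoo => a p.2 * formInner g p.1 (Φ p) (ζ p.1)) (baseVol g) := by
  refine (hΦ.integrable_test (ha.isTest_scaled 0 hζ)).congr
    (Filter.Eventually.of_forall fun p => ?_)
  have := formInner_scaled g a 0 ζ p (Φ p)
  rwa [Real.rpow_zero, one_mul] at this

theorem HForm.SqInt.integral_bump {g : RiemMetric I F} {w : ℝ} {Φ : HForm I F k}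
    (hΦ : Φ.SqInt g w) {a : ℝ → ℝ} (ha : IsBump a) {ζ : DForm I F k} (hζ : ζ.IsTest) :
    ∫ p, a p.2 * formInner g p.1 (Φ p) (ζ p.1) ∂(baseVol g)
      = ∫ r, a (r : unitIoo) * pairing g Φ ζ r ∂iooVol := by
  refine (integral_prod_symm _ (hΦ.integrable_bump ha hζ)).trans
    (integral_congr_ae (Filter.Eventually.of_forall fun r => ?_))
  exact integral_const_mul (a r) fun x => formInner g x (Φ (x, r)) (ζ x)

theorem integral_cone_pull_scaled (g : RiemMetric I F) (c : ℝ)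
    (χ : DForm (I.prod 𝓘(ℝ, ℝ)) (F × unitIoo) k) (a : ℝ → ℝ) (φ : DForm I F k) :
    ∫ p, formInner (coneMetric g c) p (χ p) (pull (scaled a (expo E c k) φ) p)
        ∂(riemVolume (coneMetric g c))
      = ∫ p, a p.2 * formInner g p.1 (hor χ p) (φ p.1) ∂(baseVol g) := by
  rw [integral_cone_pull]
  simp only [formInner_scaled]

theorem integral_cone_wedge_scaled (g : RiemMetric I F) (c : ℝ)
    (χ : DForm (I.prod 𝓘(ℝ, ℝ)) (F × unitIoo) (k + 1)) (a : ℝ → ℝ) (φ : DForm I F k) :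
    ∫ p, formInner (coneMetric g c) p (χ p) (wedge (scaled a (expo E c k) φ) p)
        ∂(riemVolume (coneMetric g c))
      = ∫ p, a p.2 * formInner g p.1 (vert χ p) (φ p.1) ∂(baseVol g) := by
  rw [integral_cone_wedge]
  simp only [formInner_scaled]

theorem IsCoPair.pairing_dF {g : RiemMetric I F} {ζ : DForm I F (k + 1)} {θ : DForm I F k}
    (h : IsCoPair g ζ θ) {Φ : HForm I F k} (hΦ : Φ.IsTest) (r : unitIoo) :
    pairing g Φ.dF ζ r = pairing g Φ θ r := h.codiff (Φ.slice r) (hΦ.slice r)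

/-- The defining identity of the codifferential on F is applied on each level r. -/
theorem IsCoPair.integral_dF {g : RiemMetric I F} {ζ : DForm I F (k + 1)} {θ : DForm I F k}
    (h : IsCoPair g ζ θ) {Φ : HForm I F k} (hΦ : Φ.IsTest) (hΦ' : Φ.dF.IsTest) {a : ℝ → ℝ}
    (ha : IsBump a) :
    ∫ p, a p.2 * formInner g p.1 (Φ.dF p) (ζ p.1) ∂(baseVol g)
      = ∫ p, a p.2 * formInner g p.1 (Φ p) (θ p.1) ∂(baseVol g) := by
  rw [(hΦ'.sqInt g 0).integral_bump ha h.left, (hΦ.sqInt g 0).integral_bump ha h.right]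
  simp only [h.pairing_dF hΦ]

/-- Pull-backs of pairs on `F` to the cone. -/
theorem IsCoPair.pull {g : RiemMetric I F} {ζ : DForm I F (k + 1)} {θ : DForm I F k}
    (h : IsCoPair g ζ θ) {a : ℝ → ℝ} (ha : IsBump a) (c : ℝ) :
    IsCoPair (coneMetric g c) (pull (scaled a (expo E c (k + 1)) ζ))
      (pull (scaled a (expo E c k) θ)) := by
  refine ⟨(ha.isTest_scaled _ h.left).pull, (ha.isTest_scaled _ h.right).pull, fun χ hχ => ?_⟩
  have h1 := hχ.d.hor
  rw [hor_d hχ.1] at h1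
  rw [integral_cone_pull_scaled, integral_cone_pull_scaled, hor_d hχ.1,
    h.integral_dF hχ.hor h1 ha]

theorem HForm.IsTest.integral_deriv_mul {g : RiemMetric I F} {Φ : HForm I F k} (hΦ : Φ.IsTest)
    {a : ℝ → ℝ} (ha : IsBump a) {ζ : DForm I F k} (hζ : ζ.IsTest) :
    ∫ p, a p.2 * formInner g p.1 (Φ.dR p) (ζ p.1) ∂(baseVol g)
      = -∫ p, deriv a p.2 * formInner g p.1 (Φ p) (ζ p.1) ∂(baseVol g) := by
  have h1 := (hΦ.radial_smul ha.contDiff.contDiffOn).integral_dR g ζ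
  have h2 : ∀ p : F × unitIoo, formInner g p.1 (ζ p.1)
      (HForm.dR (fun p => a p.2 • Φ p : HForm I F k) p)
      = deriv a p.2 * formInner g p.1 (Φ p) (ζ p.1)
        + a p.2 * formInner g p.1 (Φ.dR p) (ζ p.1) := fun p => by
    rw [HForm.dR_smul ha.contDiff.contDiffOn hΦ.1, formInner_add_right, formInner_smul_right,
      formInner_smul_right, formInner_comm, formInner_comm g _ _ (Φ.dR p)]
  simp only [h2] at h1
  rw [integral_add ((hΦ.sqInt g 0).integrable_bump ha.derivative hζ)
    ((hΦ.dR.sqInt g 0).integrable_bump ha hζ)] at h1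
  linarith

theorem isCoPair_wedge_zero {g : RiemMetric I F} {ζ : DForm I F 0} (h : ζ.IsTest) {a : ℝ → ℝ}
    (ha : IsBump a) (c : ℝ) :
    IsCoPair (coneMetric g c) (wedge (scaled a (expo E c 0) ζ))
      (pull (scaled (-deriv a) (expo E c 0) ζ)) := by
  refine ⟨(ha.isTest_scaled _ h).wedge, (ha.derivative.neg.isTest_scaled _ h).pull, fun χ hχ => ?_⟩
  rw [integral_cone_wedge_scaled, integral_cone_pull_scaled, vert_d_zero hχ.1,
    hχ.hor.integral_deriv_mul ha h, ← integral_neg]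
  simp only [Pi.neg_apply, neg_mul]

/-- Pairing dχ with a dr ∧ ζ sees only ∂_r(hor χ) - d_F(vert χ). Integration by parts in r moves the
derivative onto a, and the codifferential θ of ζ takes care of d_F; the weights are built into
`scaled`. -/
theorem IsCoPair.wedge {g : RiemMetric I F} {ζ : DForm I F (k + 1)} {θ : DForm I F k}
    (h : IsCoPair g ζ θ) {a : ℝ → ℝ} (ha : IsBump a) (c : ℝ) :
    IsCoPair (coneMetric g c) (wedge (scaled a (expo E c (k + 1)) ζ))
      (ConeL2.pull (scaled (-deriv a) (expo E c (k + 1)) ζ)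
        + ConeL2.wedge (scaled (-a) (expo E c k) θ)) := by
  have h1 := (ha.derivative.neg.isTest_scaled (expo E c (k + 1)) h.left).pull
  have h2 := (ha.neg.isTest_scaled (expo E c k) h.right).wedge
  refine ⟨(ha.isTest_scaled _ h.left).wedge, h1.add h2, fun χ hχ => ?_⟩
  have h3 := hχ.d.vert
  -- The formula for the dr-part of dχ expresses this family by two families already known to be
  -- tests.
  have h4 : (vert χ).dF.IsTest := by
    have h5 : (vert χ).dF = (hor χ).dR + (fun p => (-1 : ℝ) • vert χ.d p) := by
      funext p
      rw [Pi.add_apply, vert_d_succ hχ.1]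
      module
    rw [h5]
    exact hχ.hor.dR.add (h3.radial_smul contDiffOn_const)
  have h6 : ∀ p : F × unitIoo, a p.2 * formInner g p.1 (vert χ.d p) (ζ p.1)
      = a p.2 * formInner g p.1 ((hor χ).dR p) (ζ p.1)
        - a p.2 * formInner g p.1 ((vert χ).dF p) (ζ p.1) := fun p => by
    have h7 : vert χ.d p = (hor χ).dR p + (-1 : ℝ) • (vert χ).dF p := by
      rw [vert_d_succ hχ.1]
      module
    rw [h7, formInner_add_left, formInner_smul_left]
    ring
  have h8 : ∀ p : F × unitIoo, formInner (coneMetric g c) p (χ p)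
      ((ConeL2.pull (scaled (-deriv a) (expo E c (k + 1)) ζ)
        + ConeL2.wedge (scaled (-a) (expo E c k) θ)) p)
      = formInner (coneMetric g c) p (χ p) (ConeL2.pull (scaled (-deriv a) (expo E c (k + 1)) ζ) p)
        + formInner (coneMetric g c) p (χ p) (ConeL2.wedge (scaled (-a) (expo E c k) θ) p) :=
    fun p => formInner_add_right _ _ _ _ _
  simp only [h8]
  rw [integral_add (h1.integrable_formInner _ hχ.1) (h2.integrable_formInner _ hχ.1),
    integral_cone_wedge_scaled, integral_cone_pull_scaled, integral_cone_wedge_scaled]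
  simp only [h6]
  rw [integral_sub ((hχ.hor.dR.sqInt g 0).integrable_bump ha h.left)
    ((h4.sqInt g 0).integrable_bump ha h.left), hχ.hor.integral_deriv_mul ha h.left,
    h.integral_dF hχ.vert h4 ha]
  simp only [Pi.neg_apply, neg_mul, integral_neg]
  ring

variable {g : RiemMetric I F} {c : ℝ}

/-- The weak form of d_F(hor η) = hor χ. -/
theorem integral_pairing_hor_of_mem_graph {η : SqIntForm (coneMetric g c) k}
    {χ : SqIntForm (coneMetric g c) (k + 1)}
    (h : (L2Form.mk η, L2Form.mk χ) ∈ dMaxGraph (coneMetric g c) k)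
    {ζ : DForm I F (k + 1)} {θ : DForm I F k} (hp : IsCoPair g ζ θ) {a : ℝ → ℝ} (ha : IsBump a) :
    ∫ r, a (r : unitIoo) * pairing g (hor η.1) θ r ∂iooVol
      = ∫ r, a (r : unitIoo) * pairing g (hor χ.1) ζ r ∂iooVol := by
  have h1 := mk_mem_dMaxGraph.1 h _ _ (hp.pull ha c)
  rwa [integral_cone_pull_scaled, integral_cone_pull_scaled,
    (sqInt_hor η.2).integral_bump ha hp.right, (sqInt_hor χ.2).integral_bump ha hp.left] at h1

theorem integral_pairing_hor_of_mem_ker {χ : SqIntForm (coneMetric g c) k}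
    (h : L2Form.mk χ ∈ dMaxKer (coneMetric g c) k)
    {ζ : DForm I F (k + 1)} {θ : DForm I F k} (hp : IsCoPair g ζ θ) {a : ℝ → ℝ} (ha : IsBump a) :
    ∫ r, a (r : unitIoo) * pairing g (hor χ.1) θ r ∂iooVol = 0 := by
  have h1 := mk_mem_dMaxKer.1 h _ _ (hp.pull ha c)
  rwa [integral_cone_pull_scaled, (sqInt_hor χ.2).integral_bump ha hp.right] at h1

theorem integral_pairing_deriv_zero {χ : SqIntForm (coneMetric g c) 0}
    (h : L2Form.mk χ ∈ dMaxKer (coneMetric g c) 0) {ζ : DForm I F 0} (hζ : ζ.IsTest) {a : ℝ → ℝ}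
    (ha : IsBump a) :
    ∫ r, deriv a (r : unitIoo) * pairing g (hor χ.1) ζ r ∂iooVol = 0 := by
  have h1 := mk_mem_dMaxKer.1 h _ _ (isCoPair_wedge_zero hζ ha c)
  rw [integral_cone_pull_scaled, (sqInt_hor χ.2).integral_bump ha.derivative.neg hζ] at h1
  simpa only [Pi.neg_apply, neg_mul, integral_neg, neg_eq_zero] using h1

/-- The weak form of ∂_r(hor χ) = d_F(vert χ), the radial half of closedness. -/
theorem integral_pairing_deriv_succ {χ : SqIntForm (coneMetric g c) (k + 1)}
    (h : L2Form.mk χ ∈ dMaxKer (coneMetric g c) (k + 1))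
    {ζ : DForm I F (k + 1)} {θ : DForm I F k} (hp : IsCoPair g ζ θ) {a : ℝ → ℝ} (ha : IsBump a) :
    ∫ r, deriv a (r : unitIoo) * pairing g (hor χ.1) ζ r ∂iooVol
      + ∫ r, a (r : unitIoo) * pairing g (vert χ.1) θ r ∂iooVol = 0 := by
  have h1 := mk_mem_dMaxKer.1 h _ _ (hp.wedge ha c)
  have h8 : ∀ p : F × unitIoo, formInner (coneMetric g c) p (χ.1 p)
      ((ConeL2.pull (scaled (-deriv a) (expo E c (k + 1)) ζ)
        + ConeL2.wedge (scaled (-a) (expo E c k) θ)) p)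
      = formInner (coneMetric g c) p (χ.1 p)
          (ConeL2.pull (scaled (-deriv a) (expo E c (k + 1)) ζ) p)
        + formInner (coneMetric g c) p (χ.1 p) (ConeL2.wedge (scaled (-a) (expo E c k) θ) p) :=
    fun p => formInner_add_right _ _ _ _ _
  have h9 : ∀ {ξ : DForm (I.prod 𝓘(ℝ, ℝ)) (F × unitIoo) (k + 1)} (hξ : ξ.IsTest),
      Integrable (fun p => formInner (coneMetric g c) p (χ.1 p) (ξ p))
        (riemVolume (coneMetric g c)) := fun hξ =>
    integrable_formInner _ χ.2.1 hξ.1.isMeasurable χ.2.2 (hξ.mem_sqIntegrable _).2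
  simp only [h8] at h1
  rw [integral_add (h9 (ha.derivative.neg.isTest_scaled _ hp.left).pull)
    (h9 (ha.neg.isTest_scaled _ hp.right).wedge), integral_cone_pull_scaled,
    integral_cone_wedge_scaled, (sqInt_hor χ.2).integral_bump ha.derivative.neg hp.left,
    (sqInt_vert χ.2).integral_bump ha.neg hp.right] at h1
  simp only [Pi.neg_apply, neg_mul, integral_neg] at h1
  linarith

end Pairs

/-! ### Slicing test pairs on the cone; a criterion for primitives -/

section Slices

variable {E : Type*} [NormedAddCommGroup E] [NormedSpace ℝ E] [FiniteDimensional ℝ E]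
  [MeasurableSpace E] [BorelSpace E]
  {H : Type*} [TopologicalSpace H] {I : ModelWithCorners ℝ E H} [I.Boundaryless]
  {F : Type*} [TopologicalSpace F] [T2Space F] [ChartedSpace H F] [IsManifold I ∞ F]
  [MeasurableSpace F] [BorelSpace F] [SecondCountableTopology F] {k : ℕ}
  {g : RiemMetric I F} {c : ℝ}

/-- The family `r ^ w Φ`. -/
def reweight (w : ℝ) (Φ : HForm I F k) : HForm I F k := fun p => (p.2 : ℝ) ^ w • Φ p

theorem HForm.IsTest.reweight {Φ : HForm I F k} (h : Φ.IsTest) (w : ℝ) : (reweight w Φ).IsTest :=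
  h.radial_smul (contDiffOn_rpow_Ioo w)

theorem IsBump.isTest_smul {a : ℝ → ℝ} (ha : IsBump a) {φ : DForm I F k} (h : φ.IsTest) :
    HForm.IsTest (fun p => a p.2 • φ p.1 : HForm I F k) := by
  have := ha.isTest_mul (b := fun _ => 1) contDiffOn_const h
  simpa only [mul_one] using this

theorem HForm.dF_smul (a : ℝ → ℝ) (φ : DForm I F k) (p : F × unitIoo) :
    HForm.dF (fun p => a p.2 • φ p.1 : HForm I F k) p = a p.2 • φ.d p.1 :=
  DForm.d_const_smul (a p.2) φ p.1

theorem IsBump.dR_smul {a : ℝ → ℝ} (ha : IsBump a) {φ : DForm I F k} (h : φ.IsSmooth)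
    (p : F × unitIoo) :
    HForm.dR (fun p => a p.2 • φ p.1 : HForm I F k) p = deriv a p.2 • φ p.1 := by
  have h1 := HForm.dR_smul ha.contDiff.contDiffOn h.isSmooth_fst p
  rw [HForm.dR_fst] at h1
  rw [h1, smul_zero, add_zero]

theorem pairing_comm (g : RiemMetric I F) (Φ : HForm I F k) (η : DForm I F k) (r : unitIoo) :
    pairing g Φ η r = ∫ x, formInner g x (η x) (Φ (x, r)) ∂(riemVolume g) := by
  simp only [pairing, formInner_comm g _ (η _)]

theorem HForm.IsTest.continuous_pairing' {η : DForm I F k}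
    (hη : η ∈ sqIntegrable g k) {Z : HForm I F k} (hZ : Z.IsTest) : Continuous (pairing g Z η) := by
  simpa only [← pairing_comm] using hZ.continuous_pairing g hη

/-- The slices of a pair on the cone: multiples of the parts of a cone form and of its
codifferential form pairs on `F`. -/
theorem IsCoPair.slice {ζ : DForm (I.prod 𝓘(ℝ, ℝ)) (F × unitIoo) (k + 1)}
    {θ : DForm (I.prod 𝓘(ℝ, ℝ)) (F × unitIoo) k} (h : IsCoPair (coneMetric g c) ζ θ)
    (r : unitIoo) : IsCoPair g ((reweight (expo E c (k + 1)) (hor ζ)).slice r)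
      ((reweight (expo E c k) (hor θ) + (reweight (expo E c k) (vert ζ)).dR).slice r) := by
  set Z₁ := reweight (expo E c (k + 1)) (hor ζ)
  set Z₀ := reweight (expo E c k) (vert ζ)
  set B := reweight (expo E c k) (hor θ)
  have hZ₁ : Z₁.IsTest := h.left.hor.reweight _
  have hZ₀ : Z₀.IsTest := h.left.vert.reweight _
  have hB : B.IsTest := h.right.hor.reweight _
  have hA : (B + Z₀.dR).IsTest := hB.add hZ₀.dR
  refine ⟨hZ₁.slice r, hA.slice r, fun χ hχ => ?_⟩
  -- Testing the cone identity on products a(r) χ(x) gives an identity integrated against every bump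
  -- a. Both sides are continuous in r, so it holds at every level and not merely at almost every
  -- one.
  have key := eq_zero_of_integral_bump (f := fun r => pairing g Z₁ χ.d r -
    pairing g (B + Z₀.dR) χ r) ((hZ₁.continuous_pairing' (hχ.d.mem_sqIntegrable g)).sub
      (hA.continuous_pairing' (hχ.mem_sqIntegrable g))) (fun a ha => ?_) r
  · rw [pairing_comm, pairing_comm, sub_eq_zero] at key
    exact key
  · have hX := ha.isTest_smul hχ
    set X : HForm I F k := fun p => a p.2 • χ p.1 with hX'
    have h1 := h.codiff (ConeL2.pull X) hX.pull
    simp only [formInner_comm (coneMetric g c) _ (ConeL2.pull X _)] at h1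
    rw [integral_cone_pull, integral_cone_succ (hX.pull.d.mem_sqIntegrable _)
      (h.left.mem_sqIntegrable _), hor_d_pull hX.1, vert_d_pull hX.1] at h1
    have e1 : ∀ p : F × unitIoo, (p.2 : ℝ) ^ expo E c (k + 1) *
        formInner g p.1 (X.dF p) (hor ζ p) = a p.2 * formInner g p.1 (Z₁ p) (χ.d p.1) := fun p => by
      rw [hX', HForm.dF_smul, formInner_smul_left, formInner_comm,
        show Z₁ p = (p.2 : ℝ) ^ expo E c (k + 1) • hor ζ p from rfl, formInner_smul_left]
      ring
    have e2 : ∀ p : F × unitIoo, (p.2 : ℝ) ^ expo E c k *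
        formInner g p.1 (X.dR p) (vert ζ p) = deriv a p.2 * formInner g p.1 (Z₀ p) (χ p.1) :=
      fun p => by
        rw [hX', ha.dR_smul hχ.1, formInner_smul_left, formInner_comm,
          show Z₀ p = (p.2 : ℝ) ^ expo E c k • vert ζ p from rfl, formInner_smul_left]
        ring
    have e3 : ∀ p : F × unitIoo, (p.2 : ℝ) ^ expo E c k *
        formInner g p.1 (hor θ p) (X p) = a p.2 * formInner g p.1 (B p) (χ p.1) := fun p => by
      rw [hX', formInner_smul_right,
        show B p = (p.2 : ℝ) ^ expo E c k • hor θ p from rfl, formInner_smul_left]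
      ring
    have e4 : ∀ p : F × unitIoo, a p.2 * formInner g p.1 ((B + Z₀.dR) p) (χ p.1)
        = a p.2 * formInner g p.1 (B p) (χ p.1) + a p.2 * formInner g p.1 (Z₀.dR p) (χ p.1) :=
      fun p => by rw [Pi.add_apply, formInner_add_left, mul_add]
    simp only [e1, e2, e3] at h1
    simp only [mul_sub]
    rw [integral_sub (ha.integrable_mul_of_continuous
        (hZ₁.continuous_pairing' (hχ.d.mem_sqIntegrable g)))
      (ha.integrable_mul_of_continuous (hA.continuous_pairing' (hχ.mem_sqIntegrable g))),
      ← (hZ₁.sqInt g 0).integral_bump ha hχ.d, ← (hA.sqInt g 0).integral_bump ha hχ]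
    simp only [e4]
    rw [integral_add ((hB.sqInt g 0).integrable_bump ha hχ)
      ((hZ₀.dR.sqInt g 0).integrable_bump ha hχ), hZ₀.integral_deriv_mul ha hχ]
    linarith

theorem formInner_reweight (g : RiemMetric I F) (w : ℝ) (Φ Z : HForm I F k) (p : F × unitIoo) :
    (p.2 : ℝ) ^ w * formInner g p.1 (Φ p) (Z p) = formInner g p.1 (Φ p) (reweight w Z p) := by
  rw [reweight, formInner_smul_right]

/-- A criterion for a horizontal form to lie in the domain of `d_max` of the cone. -/
theorem mem_dMaxGraph_cone {Φ : HForm I F k} {υ : SqIntForm (coneMetric g c) k}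
    (hυ : υ.1 = pull Φ) {η : SqIntForm (coneMetric g c) (k + 1)}
    (h1 : ∀ ζ θ, IsCoPair g ζ θ → ∀ᵐ r ∂iooVol, pairing g Φ θ r = pairing g (hor η.1) ζ r)
    (h2 : ∀ Z : HForm I F k, Z.IsTest → ∫ p, formInner g p.1 (Φ p) (Z.dR p) ∂(baseVol g)
      = -∫ p, formInner g p.1 (vert η.1 p) (Z p) ∂(baseVol g)) :
    (L2Form.mk υ, L2Form.mk η) ∈ dMaxGraph (coneMetric g c) k := by
  refine mk_mem_dMaxGraph.2 fun ζ θ h => ?_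
  have hΦ : Φ.SqInt g (expo E c k) := by
    have := sqInt_hor υ.2
    rwa [hυ, hor_pull] at this
  have hη := sqInt_hor η.2
  have hη' := sqInt_vert η.2
  set Z₁ := reweight (expo E c (k + 1)) (hor ζ) with hZ₁'
  set Z₀ := reweight (expo E c k) (vert ζ) with hZ₀'
  set B := reweight (expo E c k) (hor θ) with hB'
  have hZ₁ : Z₁.IsTest := h.left.hor.reweight _
  have hZ₀ : Z₀.IsTest := h.left.vert.reweight _
  have hB : B.IsTest := h.right.hor.reweight _
  have hA : (B + Z₀.dR).IsTest := hB.add hZ₀.dR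
  have e1 : ∫ p, formInner (coneMetric g c) p (υ.1 p) (θ p) ∂(riemVolume (coneMetric g c))
      = ∫ p, formInner g p.1 (Φ p) (B p) ∂(baseVol g) := by
    simp only [hυ, formInner_comm (coneMetric g c) _ (pull Φ _)]
    rw [integral_cone_pull]
    refine integral_congr_ae (Filter.Eventually.of_forall fun p => ?_)
    beta_reduce
    rw [formInner_comm, formInner_reweight]
  have e2 : ∫ p, formInner (coneMetric g c) p (η.1 p) (ζ p) ∂(riemVolume (coneMetric g c))
      = ∫ p, formInner g p.1 (hor η.1 p) (Z₁ p) ∂(baseVol g)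
        + ∫ p, formInner g p.1 (vert η.1 p) (Z₀ p) ∂(baseVol g) := by
    rw [integral_cone_succ η.2 (h.left.mem_sqIntegrable _)]
    simp only [formInner_reweight]
    rfl
  have e3 : ∫ p, formInner g p.1 (Φ p) ((B + Z₀.dR) p) ∂(baseVol g)
      = ∫ p, formInner g p.1 (hor η.1 p) (Z₁ p) ∂(baseVol g) := by
    rw [integral_baseVol_eq (hΦ.integrable_test hA), integral_baseVol_eq (hη.integrable_test hZ₁)]
    refine integral_congr_ae ?_
    -- The hypothesis holds off a null set that depends on the pair, while the pair needed at level
    -- r is the slice at r. The null sets for slices at a countable dense set of levels q are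
    -- combined, and continuity in q then permits q = r.
    obtain ⟨D, hD, hD'⟩ := TopologicalSpace.exists_countable_dense unitIoo
    have h3 : ∀ᵐ r ∂iooVol, ∀ q ∈ D, pairing g Φ ((B + Z₀.dR).slice q) r
        = pairing g (hor η.1) (Z₁.slice q) r :=
      (ae_ball_iff hD).2 fun q _ => h1 _ _ (h.slice q)
    filter_upwards [h3, hΦ.slice_mem, hη.slice_mem] with r hr hr1 hr2
    have h4 := Continuous.ext_on hD' (hA.continuous_pairing g hr1) (hZ₁.continuous_pairing g hr2)
      fun q hq => hr q hq
    exact congrFun h4 r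
  have e4 : ∫ p, formInner g p.1 (Φ p) ((B + Z₀.dR) p) ∂(baseVol g)
      = ∫ p, formInner g p.1 (Φ p) (B p) ∂(baseVol g)
        + ∫ p, formInner g p.1 (Φ p) (Z₀.dR p) ∂(baseVol g) := by
    rw [← integral_add (hΦ.integrable_test hB) (hΦ.integrable_test hZ₀.dR)]
    exact integral_congr_ae (Filter.Eventually.of_forall fun p => formInner_add_right _ _ _ _ _)
  rw [e1, e2, ← e3, e4, h2 Z₀ hZ₀]
  ring

end Slices

/-! ### Multipliers and Hilbert–Schmidt kernels for power weights -/

/-- Multipliers which are square integrable with respect to the weight `s ^ (-w)`. -/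
structure IsMultiplier (w : ℝ) (m : unitIoo → ℝ) : Prop where
  meas : Measurable m
  integrable : Integrable (fun s : unitIoo => m s ^ 2 * (s : ℝ) ^ (-w)) iooVol

/-- Hilbert–Schmidt kernels for the weight `r ^ w`. -/
structure IsHSKernel (w : ℝ) (κ : unitIoo → unitIoo → ℝ) : Prop where
  meas : Measurable (Function.uncurry κ)
  integrable : Integrable (fun q : unitIoo × unitIoo =>
    (q.1 : ℝ) ^ w * (κ q.1 q.2 ^ 2 * (q.2 : ℝ) ^ (-w))) (iooVol.prod iooVol)

theorem IsHSKernel.isMultiplier {w : ℝ} {κ : unitIoo → unitIoo → ℝ} (h : IsHSKernel w κ) :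
    ∀ᵐ r ∂iooVol, IsMultiplier w (κ r) := by
  filter_upwards [h.integrable.prod_right_ae] with r hr
  refine ⟨h.meas.of_uncurry_left, (hr.const_mul ((r : ℝ) ^ (-w))).congr
    (Filter.Eventually.of_forall fun s => ?_)⟩
  beta_reduce
  rw [← mul_assoc, ← Real.rpow_add r.2.1, neg_add_cancel, Real.rpow_zero, one_mul]

theorem rpow_mul_rpow_neg (r : unitIoo) (w : ℝ) : (r : ℝ) ^ w * (r : ℝ) ^ (-w) = 1 := by
  rw [← Real.rpow_add r.2.1, add_neg_cancel, Real.rpow_zero]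

theorem measurable_rpow_coe (w : ℝ) : Measurable fun r : unitIoo => (r : ℝ) ^ w :=
  (continuous_rpow_coe w).measurable

/-- The weighted arithmetic-geometric inequality. -/
theorem abs_mul_le_weighted (r : unitIoo) (w m q : ℝ) :
    |m * q| ≤ m ^ 2 * (r : ℝ) ^ (-w) + (r : ℝ) ^ w * q ^ 2 := by
  have h1 := rpow_mul_rpow_neg r w
  have h2 : 0 < (r : ℝ) ^ w := Real.rpow_pos_of_pos r.2.1 w
  have h3 : 0 < (r : ℝ) ^ (-w) := Real.rpow_pos_of_pos r.2.1 (-w)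
  have h4 : (m * (r : ℝ) ^ (-w)) ^ 2 * (r : ℝ) ^ w = m ^ 2 * (r : ℝ) ^ (-w) := by
    rw [mul_pow, sq ((r : ℝ) ^ (-w)), mul_assoc, mul_assoc, mul_comm _ ((r : ℝ) ^ w), h1, mul_one]
  have h5 : m * q = m * (r : ℝ) ^ (-w) * q * (r : ℝ) ^ w := by
    rw [mul_right_comm m, mul_assoc (m * q), mul_comm _ ((r : ℝ) ^ w), h1, mul_one]
  rw [← h4, h5, abs_mul, abs_of_pos h2]
  have h6 : |m * (r : ℝ) ^ (-w) * q| ≤ (m * (r : ℝ) ^ (-w)) ^ 2 + q ^ 2 := by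
    rw [abs_le]
    constructor <;> nlinarith [sq_nonneg (m * (r : ℝ) ^ (-w) + q),
      sq_nonneg (m * (r : ℝ) ^ (-w) - q), sq_nonneg (m * (r : ℝ) ^ (-w)), sq_nonneg q]
  nlinarith

theorem IsMultiplier.integrable_mul {w : ℝ} {m Q : unitIoo → ℝ} (hm : IsMultiplier w m)
    (hQ : AEStronglyMeasurable Q iooVol)
    (hQ' : Integrable (fun s : unitIoo => (s : ℝ) ^ w * Q s ^ 2) iooVol) :
    Integrable (fun s => m s * Q s) iooVol :=
  (hm.integrable.add hQ').mono' (hm.meas.aestronglyMeasurable.mul hQ)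
    (Filter.Eventually.of_forall fun s => abs_mul_le_weighted s w (m s) (Q s))

/-- Cauchy–Schwarz in the form suited to N = |∫ m Φ|²: the optimal choice is t = 1/A, and for A = 0
a large t forces N ≤ 0. -/
theorem le_mul_of_forall_quadratic {N A B : ℝ} (hA : 0 ≤ A) (hB : 0 ≤ B)
    (h : ∀ t : ℝ, 2 * t * N ≤ t ^ 2 * A * N + B) : N ≤ A * B := by
  rcases hA.eq_or_lt with rfl | hA
  · by_contra hN
    rw [zero_mul, not_le] at hN
    have h1 := h ((B + 1) / (2 * N))
    have h2 : 2 * ((B + 1) / (2 * N)) * N = B + 1 := by field_simp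
    rw [h2, mul_zero, zero_mul] at h1
    linarith
  · have h1 := h A⁻¹
    have h2 : A⁻¹ ^ 2 * A * N = A⁻¹ * N := by field_simp
    rw [h2] at h1
    have h3 : A⁻¹ * N ≤ B := by linarith
    calc N = A * (A⁻¹ * N) := by field_simp
      _ ≤ A * B := mul_le_mul_of_nonneg_left h3 hA.le

/-! ### Integrability by components -/

section Components

variable {E : Type*} [NormedAddCommGroup E] [NormedSpace ℝ E] [FiniteDimensional ℝ E] {k : ℕ}

theorem integrable_of_components {X ι : Type*} [MeasurableSpace X] {μ : Measure X} [Fintype ι]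
    (b : Module.Basis ι ℝ E) {f : X → E [⋀^Fin k]→L[ℝ] ℝ}
    (h : ∀ p : Fin k → ι, Integrable (fun x => f x fun j => b (p j)) μ) : Integrable f μ := by
  obtain ⟨g, hg⟩ := LinearMap.exists_leftInverse_of_injective (altCoord k b)
    (LinearMap.ker_eq_bot.2 (altCoord_injective k _))
  have h1 : f = fun x => LinearMap.toContinuousLinearMap g (altCoord k b (f x)) := by
    funext x
    exact (LinearMap.congr_fun hg (f x)).symm
  rw [h1]
  exact (LinearMap.toContinuousLinearMap g).integrable_comp (Integrable.of_eval h)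

end Components

/-! ### Radial integrals of families of forms -/

section RadialIntegral

variable {E : Type*} [NormedAddCommGroup E] [NormedSpace ℝ E] [FiniteDimensional ℝ E]
  {H : Type*} [TopologicalSpace H] {I : ModelWithCorners ℝ E H} [I.Boundaryless]
  {F : Type*} [TopologicalSpace F] [ChartedSpace H F] [IsManifold I ∞ F]
  [MeasurableSpace F] [BorelSpace F] [SecondCountableTopology F] {k : ℕ}
  {g : RiemMetric I F} {w : ℝ}

/-- The values of a family of forms at a point of `F`. -/
def HForm.fibre (Φ : HForm I F k) (x : F) (s : unitIoo) : E [⋀^Fin k]→L[ℝ] ℝ := Φ (x, s)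

/-- The radial integral `∫ m(s) Φ(·, s) ds`. -/
def radInt (m : unitIoo → ℝ) (Φ : HForm I F k) : DForm I F k :=
  fun x => (∫ s, m s • Φ.fibre x s ∂iooVol : E [⋀^Fin k]→L[ℝ] ℝ)

/-- The family of forms `∫ κ(r, s) Φ(·, s) ds`. -/
def kerInt (κ : unitIoo → unitIoo → ℝ) (Φ : HForm I F k) : HForm I F k :=
  fun p => radInt (κ p.2) Φ p.1

theorem HForm.IsMeasurable.fibre {Φ : HForm I F k} (h : Φ.IsMeasurable) (x : F) (v : Fin k → E) :
    Measurable fun s => Φ.fibre x s v := by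
  have h1 : Measurable fun s : unitIoo =>
      (⟨(x, s), mem_chart_source_cone.2 (mem_chart_source H x)⟩ :
        (chartAt (ModelProd H ℝ) (x, toIoo (1 / 2))).source) :=
    (measurable_const.prodMk measurable_id).subtype_mk
  refine measurable_of_forall_eq (fun s => ?_) ((h (x, toIoo (1 / 2)) v).comp h1)
  exact (congrArg (fun L : E →L[ℝ] E => Φ.fibre x s fun j => L (v j)) (chartVec_self (I := I) x)).symm

theorem HForm.IsMeasurable.kerInt {Φ : HForm I F k} (h : Φ.IsMeasurable)
    {κ : unitIoo → unitIoo → ℝ} (hκ : Measurable (Function.uncurry κ)) :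
    (kerInt κ Φ).IsMeasurable := fun p₀ v => by
  set S := (chartAt (ModelProd H ℝ) p₀).source
  let G : S → unitIoo → E [⋀^Fin k]→L[ℝ] ℝ := fun p s => κ (p : F × unitIoo).2 s •
    (Φ.fibre (p : F × unitIoo).1 s).compContinuousLinearMap
      (chartVec I p₀.1 (p : F × unitIoo).1 : E →L[ℝ] E)
  have hG : StronglyMeasurable (Function.uncurry G) := by
    refine stronglyMeasurable_of_components fun u => ?_
    have h1 : Measurable fun q : S × unitIoo =>
        (⟨((q.1 : F × unitIoo).1, q.2), mem_chart_source_cone.2 (mem_chart_source_cone.1 q.1.2)⟩ :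
          S) :=
      ((measurable_fst.comp (measurable_subtype_coe.comp measurable_fst)).prodMk
        measurable_snd).subtype_mk
    have h2 : Measurable fun q : S × unitIoo => κ (q.1 : F × unitIoo).2 q.2 :=
      hκ.comp ((measurable_snd.comp (measurable_subtype_coe.comp measurable_fst)).prodMk
        measurable_snd)
    exact h2.mul ((h p₀ u).comp h1)
  have h3 : StronglyMeasurable fun p => ∫ s, G p s ∂iooVol := hG.integral_prod_right
  have h4 : Measurable fun p => (∫ s, G p s ∂iooVol) v :=
    ((continuous_eval_const v).comp_stronglyMeasurable h3).measurable
  refine measurable_of_forall_eq (fun p => ?_) h4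
  let e : E ≃L[ℝ] E := chartVecEquiv (I := I) (mem_chart_source_cone.1 p.2)
  -- A change of frame acts on covectors by a linear automorphism, and such a map commutes with the
  -- Bochner integral without any integrability assumption.
  have h5 := ContinuousLinearEquiv.integral_comp_comm (μ := iooVol) (altCongr (k := k) e)
    fun s => κ (p : F × unitIoo).2 s • Φ.fibre (p : F × unitIoo).1 s
  have h6 : ∀ s, altCongr (k := k) e (κ (p : F × unitIoo).2 s • Φ.fibre (p : F × unitIoo).1 s)
      = G p s := by
    intro s
    ext u
    have h7 : ∀ j, e (u j) = (chartVec I p₀.1 (p : F × unitIoo).1 : E →L[ℝ] E) (u j) := fun j =>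
      chartVecEquiv_apply (I := I) (mem_chart_source_cone.1 p.2) (u j)
    rw [altCongr_apply]
    simp only [h7]
    rfl
  simp only [h6] at h5
  rw [h5, altCongr_apply]
  have h8 : ∀ j, e (v j) = (chartVec I p₀.1 (p : F × unitIoo).1 : E →L[ℝ] E) (v j) := fun j =>
    chartVecEquiv_apply (I := I) (mem_chart_source_cone.1 p.2) (v j)
  simp only [h8]
  rfl

theorem HForm.IsMeasurable.radInt {Φ : HForm I F k} (h : Φ.IsMeasurable) {m : unitIoo → ℝ}
    (hm : Measurable m) : (radInt m Φ).IsMeasurable := by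
  have h1 : Measurable (Function.uncurry fun _ : unitIoo => m) := hm.comp measurable_snd
  exact (h.kerInt h1).slice (toIoo (1 / 2))

/-- In an orthonormal frame at x each component is controlled by the norm of Φ, and the weighted
arithmetic–geometric inequality bounds its product with m. -/
theorem integrable_smul_fibre {Φ : HForm I F k} (hΦ : Φ.IsMeasurable) {m : unitIoo → ℝ}
    (hm : IsMultiplier w m) {x : F} (hx : Integrable (fun s : unitIoo =>
      (s : ℝ) ^ w * formInner g x (Φ (x, s)) (Φ (x, s))) iooVol) :
    Integrable (fun s => m s • Φ.fibre x s) iooVol := by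
  obtain ⟨b, _, hb⟩ := exists_formInner_eq_sum g x
  refine integrable_of_components (E := E) b fun p => ?_
  refine hm.integrable_mul (Q := fun s => Φ.fibre x s fun j => b (p j))
    (hΦ.fibre x _).aestronglyMeasurable ?_
  refine (hx.const_mul (k.factorial : ℝ)).mono'
    ((measurable_rpow_coe w).mul ((hΦ.fibre x _).pow_const 2)).aestronglyMeasurable
    (Filter.Eventually.of_forall fun s => ?_)
  rw [Real.norm_of_nonneg (mul_nonneg (rpow_nonneg_coe s w) (sq_nonneg _)), hb,
    mul_left_comm, ← mul_assoc (k.factorial : ℝ), mul_inv_cancel₀ (by positivity), one_mul]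
  refine mul_le_mul_of_nonneg_left ?_ (rpow_nonneg_coe s w)
  rw [sq]
  exact Finset.single_le_sum (f := fun p => Φ (x, s) (fun a => b (p a)) * Φ (x, s) fun a => b (p a))
    (fun q _ => mul_self_nonneg _) (Finset.mem_univ p)

theorem formInner_radInt {Φ : HForm I F k} (hΦ : Φ.IsMeasurable) {m : unitIoo → ℝ}
    (hm : IsMultiplier w m) {x : F} (hx : Integrable (fun s : unitIoo =>
      (s : ℝ) ^ w * formInner g x (Φ (x, s)) (Φ (x, s))) iooVol)
    (α : TangentSpace I x [⋀^Fin k]→L[ℝ] ℝ) :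
    formInner g x α (radInt m Φ x) = ∫ s, m s * formInner g x α (Φ (x, s)) ∂iooVol := by
  have h := (formInnerL g x α).integral_comp_comm (integrable_smul_fibre hΦ hm hx)
  refine h.symm.trans (integral_congr_ae (Filter.Eventually.of_forall fun s => ?_))
  exact formInner_smul_right g x (m s) α (Φ (x, s))

theorem integrable_mul_formInner {Φ : HForm I F k} (hΦ : Φ.IsMeasurable) {m : unitIoo → ℝ}
    (hm : IsMultiplier w m) {x : F} (hx : Integrable (fun s : unitIoo =>
      (s : ℝ) ^ w * formInner g x (Φ (x, s)) (Φ (x, s))) iooVol)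
    (α : TangentSpace I x [⋀^Fin k]→L[ℝ] ℝ) :
    Integrable (fun s => m s * formInner g x α (Φ (x, s))) iooVol :=
  ((formInnerL g x α).integrable_comp (integrable_smul_fibre hΦ hm hx)).congr
    (Filter.Eventually.of_forall fun s => formInner_smul_right g x (m s) α (Φ (x, s)))

/-- The weighted Cauchy–Schwarz inequality |∫ m Φ|² ≤ (∫ m² s^{-w})(∫ s^w |Φ|²) in the fibre over x,
which underlies all the operator bounds. -/
theorem formInner_radInt_self_le {Φ : HForm I F k} (hΦ : Φ.IsMeasurable) {m : unitIoo → ℝ}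
    (hm : IsMultiplier w m) {x : F} (hx : Integrable (fun s : unitIoo =>
      (s : ℝ) ^ w * formInner g x (Φ (x, s)) (Φ (x, s))) iooVol) :
    formInner g x (radInt m Φ x) (radInt m Φ x) ≤
      (∫ s : unitIoo, m s ^ 2 * (s : ℝ) ^ (-w) ∂iooVol) *
        ∫ s : unitIoo, (s : ℝ) ^ w * formInner g x (Φ (x, s)) (Φ (x, s)) ∂iooVol := by
  set β := radInt m Φ x
  refine le_mul_of_forall_quadratic
    (integral_nonneg fun s => mul_nonneg (sq_nonneg _) (rpow_nonneg_coe _ _))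
    (integral_nonneg fun s => mul_nonneg (rpow_nonneg_coe _ _) (formInner_self_nonneg _ _ _))
    fun t => ?_
  have h1 := formInner_radInt (g := g) hΦ hm hx β
  have h2 : 2 * t * ∫ s, m s * formInner g x β (Φ (x, s)) ∂iooVol ≤
      t ^ 2 * (∫ s : unitIoo, m s ^ 2 * (s : ℝ) ^ (-w) ∂iooVol) * formInner g x β β
        + ∫ s : unitIoo, (s : ℝ) ^ w * formInner g x (Φ (x, s)) (Φ (x, s)) ∂iooVol := by
    rw [← integral_const_mul, ← integral_const_mul, ← integral_mul_const, ← integral_add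
      ((hm.integrable.const_mul _).mul_const _) hx]
    refine integral_mono ((integrable_mul_formInner hΦ hm hx β).const_mul _)
      (((hm.integrable.const_mul _).mul_const _).add hx) fun s => ?_
    -- Multiplied by s^w, the nonnegativity of |Φ(x,s) - t m s^{-w} β|² gives the pointwise
    -- quadratic inequality in t to be integrated.
    have h3 := formInner_self_nonneg g x ((-(t * m s * (s : ℝ) ^ (-w))) • β + Φ (x, s))
    rw [formInner_add_add, formInner_smul_left, formInner_smul_left, formInner_smul_right] at h3
    have h4 := mul_nonneg (rpow_nonneg_coe s w) h3
    have h5 := rpow_mul_rpow_neg s w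
    have h6 : (s : ℝ) ^ w * (-(t * m s * (s : ℝ) ^ (-w)) *
        (-(t * m s * (s : ℝ) ^ (-w)) * formInner g x β β) +
        2 * (-(t * m s * (s : ℝ) ^ (-w)) * formInner g x β (Φ (x, s))) +
        formInner g x (Φ (x, s)) (Φ (x, s)))
        = (t ^ 2 * (m s ^ 2 * (s : ℝ) ^ (-w)) * formInner g x β β
          - 2 * t * (m s * formInner g x β (Φ (x, s)))) * ((s : ℝ) ^ w * (s : ℝ) ^ (-w))
          + (s : ℝ) ^ w * formInner g x (Φ (x, s)) (Φ (x, s)) := by ring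
    rw [h6, h5, mul_one] at h4
    linarith
  rwa [← h1] at h2

end RadialIntegral

/-! ### Averages and integral operators on square integrable families -/

section Operators

variable {E : Type*} [NormedAddCommGroup E] [NormedSpace ℝ E] [FiniteDimensional ℝ E]
  [MeasurableSpace E] [BorelSpace E]
  {H : Type*} [TopologicalSpace H] {I : ModelWithCorners ℝ E H} [I.Boundaryless]
  {F : Type*} [TopologicalSpace F] [ChartedSpace H F] [IsManifold I ∞ F]
  [MeasurableSpace F] [BorelSpace F] [SecondCountableTopology F] {k : ℕ}
  {g : RiemMetric I F} {w : ℝ} {Φ : HForm I F k} {m : unitIoo → ℝ}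

theorem HForm.SqInt.ae_fibre (h : Φ.SqInt g w) : ∀ᵐ x ∂(riemVolume g),
    Integrable (fun s : unitIoo => (s : ℝ) ^ w * formInner g x (Φ (x, s)) (Φ (x, s))) iooVol :=
  h.integrable.prod_right_ae

theorem HForm.SqInt.radInt_mem (h : Φ.SqInt g w) (hm : IsMultiplier w m) :
    radInt m Φ ∈ sqIntegrable g k := by
  have hmeas := h.meas.radInt hm.meas
  refine ⟨hmeas, ?_⟩
  refine (h.integrable.integral_prod_left.const_mul
    (∫ s : unitIoo, m s ^ 2 * (s : ℝ) ^ (-w) ∂iooVol)).mono'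
    (measurable_formInner g hmeas hmeas).aestronglyMeasurable ?_
  filter_upwards [h.ae_fibre] with x hx
  rw [Real.norm_of_nonneg (formInner_self_nonneg _ _ _)]
  exact formInner_radInt_self_le h.meas hm hx

theorem HForm.SqInt.integral_radInt_le (h : Φ.SqInt g w) (hm : IsMultiplier w m) :
    ∫ x, formInner g x (radInt m Φ x) (radInt m Φ x) ∂(riemVolume g) ≤
      (∫ s : unitIoo, m s ^ 2 * (s : ℝ) ^ (-w) ∂iooVol) *
        ∫ p, (p.2 : ℝ) ^ w * formInner g p.1 (Φ p) (Φ p) ∂(baseVol g) := by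
  rw [baseVol, integral_prod _ h.integrable, ← integral_const_mul]
  refine integral_mono_ae (h.radInt_mem hm).2 (h.integrable.integral_prod_left.const_mul _) ?_
  filter_upwards [h.ae_fibre] with x hx
  exact formInner_radInt_self_le h.meas hm hx

theorem HForm.SqInt.integrable_mul (h : Φ.SqInt g w) (hm : IsMultiplier w m) {η : DForm I F k}
    (hη : η ∈ sqIntegrable g k) :
    Integrable (fun p : F × unitIoo => m p.2 * formInner g p.1 (Φ p) (η p.1)) (baseVol g) := by
  have h1 : Integrable (fun p : F × unitIoo => formInner g p.1 (η p.1) (η p.1) *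
      (m p.2 ^ 2 * (p.2 : ℝ) ^ (-w))) (baseVol g) := hη.2.mul_prod hm.integrable
  refine (h.integrable.add h1).mono' ((hm.meas.comp measurable_snd).mul
    (h.meas.formInner g hη.1.const)).aestronglyMeasurable
    (Filter.Eventually.of_forall fun p => ?_)
  have h2 := mul_le_mul_of_nonneg_left
    (abs_formInner_le g p.1 (Φ p) ((m p.2 * (p.2 : ℝ) ^ (-w)) • η p.1)) (rpow_nonneg_coe p.2 w)
  rw [formInner_smul_right, formInner_smul_right, formInner_smul_left,
    ← abs_of_nonneg (rpow_nonneg_coe p.2 w), ← abs_mul, abs_of_nonneg (rpow_nonneg_coe p.2 w)] at h2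
  have h3 := rpow_mul_rpow_neg p.2 w
  have h4 : (p.2 : ℝ) ^ w * (m p.2 * (p.2 : ℝ) ^ (-w) * formInner g p.1 (Φ p) (η p.1))
      = m p.2 * formInner g p.1 (Φ p) (η p.1) * ((p.2 : ℝ) ^ w * (p.2 : ℝ) ^ (-w)) := by ring
  have h5 : (p.2 : ℝ) ^ w * (formInner g p.1 (Φ p) (Φ p) + m p.2 * (p.2 : ℝ) ^ (-w) *
      (m p.2 * (p.2 : ℝ) ^ (-w) * formInner g p.1 (η p.1) (η p.1)))
      = (p.2 : ℝ) ^ w * formInner g p.1 (Φ p) (Φ p) + formInner g p.1 (η p.1) (η p.1) *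
        (m p.2 ^ 2 * (p.2 : ℝ) ^ (-w)) * ((p.2 : ℝ) ^ w * (p.2 : ℝ) ^ (-w)) := by ring
  rw [h4, h5, h3, mul_one, mul_one] at h2
  exact h2

/-- Fubini: averaging in r commutes with pairing along F, so weak identities on the cone can be
averaged to weak identities on F. -/
theorem HForm.SqInt.pairing_radInt (h : Φ.SqInt g w) (hm : IsMultiplier w m) {η : DForm I F k}
    (hη : η ∈ sqIntegrable g k) :
    ∫ x, formInner g x (radInt m Φ x) (η x) ∂(riemVolume g) = ∫ s, m s * pairing g Φ η s ∂iooVol := by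
  have h1 := h.integrable_mul hm hη
  have h2 : ∫ p, m p.2 * formInner g p.1 (Φ p) (η p.1) ∂(baseVol g)
      = ∫ s, m s * pairing g Φ η s ∂iooVol :=
    (integral_prod_symm _ h1).trans (integral_congr_ae (Filter.Eventually.of_forall fun s =>
      integral_const_mul (m s) fun x => formInner g x (Φ (x, s)) (η x)))
  rw [← h2, baseVol, integral_prod _ h1]
  refine integral_congr_ae ?_
  filter_upwards [h.ae_fibre] with x hx
  rw [formInner_comm, formInner_radInt h.meas hm hx]
  simp only [formInner_comm g x (η x)]

theorem measurable_pairing (g : RiemMetric I F) (hΦ : Φ.IsMeasurable) {η : DForm I F k}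
    (hη : η.IsMeasurable) : Measurable (pairing g Φ η) := by
  have h1 : StronglyMeasurable fun p : F × unitIoo => formInner g p.1 (Φ p) (η p.1) :=
    (hΦ.formInner g hη.const).stronglyMeasurable
  exact h1.integral_prod_left'.measurable

theorem sq_integral_formInner_le (g : RiemMetric I F) {φ η : DForm I F k}
    (hφ : φ ∈ sqIntegrable g k) (hη : η ∈ sqIntegrable g k) :
    (∫ x, formInner g x (φ x) (η x) ∂(riemVolume g)) ^ 2 ≤
      (∫ x, formInner g x (φ x) (φ x) ∂(riemVolume g)) *
        ∫ x, formInner g x (η x) (η x) ∂(riemVolume g) := by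
  have h := real_inner_mul_inner_self_le (L2Form.mk (g := g) ⟨φ, hφ⟩) (L2Form.mk ⟨η, hη⟩)
  rw [← sq] at h
  exact h

theorem HForm.SqInt.integrable_sq_pairing (h : Φ.SqInt g w) {η : DForm I F k}
    (hη : η ∈ sqIntegrable g k) :
    Integrable (fun s : unitIoo => (s : ℝ) ^ w * pairing g Φ η s ^ 2) iooVol := by
  refine (h.integrable.integral_prod_right.mul_const
    (∫ x, formInner g x (η x) (η x) ∂(riemVolume g))).mono'
    ((measurable_rpow_coe w).mul ((measurable_pairing g h.meas hη.1).pow_const 2)).aestronglyMeasurable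
    ?_
  filter_upwards [h.slice_mem] with s hs
  rw [Real.norm_of_nonneg (mul_nonneg (rpow_nonneg_coe s w) (sq_nonneg _)), integral_const_mul,
    mul_assoc]
  exact mul_le_mul_of_nonneg_left (sq_integral_formInner_le g hs hη) (rpow_nonneg_coe s w)

/-- The fibrewise Cauchy–Schwarz estimate for m = κ(r, ·), multiplied by r^w and integrated over r
and x, separates into the Hilbert–Schmidt norm of κ and the norm of Φ. -/
theorem HForm.SqInt.kerInt (h : Φ.SqInt g w) {κ : unitIoo → unitIoo → ℝ} (hκ : IsHSKernel w κ) :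
    (kerInt κ Φ).SqInt g w := by
  have hmeas := h.meas.kerInt hκ.meas
  refine ⟨hmeas, ?_⟩
  have h1 : Integrable (fun p : F × unitIoo =>
      (∫ s : unitIoo, (s : ℝ) ^ w * formInner g p.1 (Φ (p.1, s)) (Φ (p.1, s)) ∂iooVol) *
      ∫ s : unitIoo, (p.2 : ℝ) ^ w * (κ p.2 s ^ 2 * (s : ℝ) ^ (-w)) ∂iooVol) (baseVol g) :=
    h.integrable.integral_prod_left.mul_prod hκ.integrable.integral_prod_left
  refine h1.mono' (((measurable_rpow_coe w).comp measurable_snd).mul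
    (hmeas.formInner g hmeas)).aestronglyMeasurable ?_
  have h2 : ∀ᵐ p ∂(baseVol g), Integrable (fun s : unitIoo =>
      (s : ℝ) ^ w * formInner g (p : F × unitIoo).1 (Φ (p.1, s)) (Φ (p.1, s))) iooVol :=
    Measure.quasiMeasurePreserving_fst.ae h.ae_fibre
  have h3 : ∀ᵐ p ∂(baseVol g), IsMultiplier w (κ (p : F × unitIoo).2) :=
    Measure.quasiMeasurePreserving_snd.ae hκ.isMultiplier
  filter_upwards [h2, h3] with p hp hp'
  rw [Real.norm_of_nonneg (mul_nonneg (rpow_nonneg_coe _ w) (formInner_self_nonneg _ _ _)),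
    integral_const_mul, mul_left_comm]
  refine mul_le_mul_of_nonneg_left ?_ (rpow_nonneg_coe _ w)
  rw [mul_comm]
  exact formInner_radInt_self_le h.meas hp' hp

theorem HForm.SqInt.pairing_kerInt (h : Φ.SqInt g w) {κ : unitIoo → unitIoo → ℝ}
    (hκ : IsHSKernel w κ) {η : DForm I F k} (hη : η ∈ sqIntegrable g k) :
    ∀ᵐ r ∂iooVol, pairing g (ConeL2.kerInt κ Φ) η r = ∫ s, κ r s * pairing g Φ η s ∂iooVol := by
  filter_upwards [hκ.isMultiplier] with r hr
  exact h.pairing_radInt hr hη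

theorem measurable_formInner_fibre {Φ Ψ : HForm I F k} (g : RiemMetric I F) (x : F)
    (hΦ : Φ.IsMeasurable) (hΨ : Ψ.IsMeasurable) :
    Measurable fun q : unitIoo × unitIoo => formInner g x (Φ (x, q.2)) (Ψ (x, q.1)) := by
  obtain ⟨b, _, hb⟩ := exists_formInner_eq_sum g x
  simp only [hb]
  refine Measurable.const_mul (Finset.measurable_fun_sum _ fun p _ => ?_) _
  exact ((hΦ.fibre x fun a => b (p a)).comp measurable_snd).mul
    ((hΨ.fibre x fun a => b (p a)).comp measurable_fst)

/-- Kernels which invert the radial derivative. -/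
def IsPrimitiveKernel (κ : unitIoo → unitIoo → ℝ) : Prop :=
  ∀ a, IsBump a → ∀ s, ∫ r, κ r s * deriv a (r : unitIoo) ∂iooVol = -a s

/-- The weak form of ∂_r ∫ κ(r,s) Φ(s) ds = Φ(r). After Fubini the inner integral over r is the
defining property of a primitive kernel, applied to the bump function r ↦ ⟨Φ(x,s), Z(x,r)⟩. -/
theorem HForm.SqInt.integral_kerInt_dR [T2Space F] (h : Φ.SqInt g w)
    {κ : unitIoo → unitIoo → ℝ} (hκ : IsHSKernel w κ) (hκ' : IsPrimitiveKernel κ) {Z : HForm I F k}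
    (hZ : Z.IsTest) :
    ∫ p, formInner g p.1 (ConeL2.kerInt κ Φ p) (Z.dR p) ∂(baseVol g)
      = -∫ p, formInner g p.1 (Φ p) (Z p) ∂(baseVol g) := by
  rw [baseVol, integral_prod _ ((h.kerInt hκ).integrable_test hZ.dR),
    integral_prod _ (h.integrable_test hZ), ← integral_neg]
  refine integral_congr_ae ?_
  -- The opposite weight on the test family is what permits the bound |κ⟨Φ, ∂_r Z⟩| ≤ r^w κ² s^{-w}
  -- + (r^{-w} |∂_r Z|²)(s^w |Φ|²) used for Fubini.
  filter_upwards [h.ae_fibre, (hZ.dR.sqInt g (-w)).ae_fibre] with x hx hx'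
  have h1 : ∫ r, formInner g x (ConeL2.kerInt κ Φ (x, r)) (Z.dR (x, r)) ∂iooVol
      = ∫ r, ∫ s, κ r s * formInner g x (Φ (x, s)) (Z.dR (x, r)) ∂iooVol ∂iooVol := by
    refine integral_congr_ae ?_
    filter_upwards [hκ.isMultiplier] with r hr
    rw [formInner_comm]
    refine (formInner_radInt h.meas hr hx _).trans ?_
    simp only [formInner_comm g x (Z.dR (x, r))]
  have h2 : Integrable (Function.uncurry fun r s : unitIoo =>
      κ r s * formInner g x (Φ (x, s)) (Z.dR (x, r))) (iooVol.prod iooVol) := by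
    have h3 : Integrable (fun q : unitIoo × unitIoo =>
        ((q.1 : ℝ) ^ (-w) * formInner g x (Z.dR (x, q.1)) (Z.dR (x, q.1))) *
        ((q.2 : ℝ) ^ w * formInner g x (Φ (x, q.2)) (Φ (x, q.2)))) (iooVol.prod iooVol) :=
      hx'.mul_prod hx
    refine (hκ.integrable.add h3).mono' (hκ.meas.mul
      (measurable_formInner_fibre g x h.meas hZ.dR.1.isMeasurable)).aestronglyMeasurable
      (Filter.Eventually.of_forall fun q => ?_)
    have h4 := abs_mul_le_weighted q.2 w (κ q.1 q.2)
      ((q.1 : ℝ) ^ (-w) * formInner g x (Φ (x, q.2)) (Z.dR (x, q.1)))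
    have h5 := mul_le_mul_of_nonneg_left h4 (rpow_nonneg_coe q.1 w)
    rw [← abs_of_nonneg (rpow_nonneg_coe q.1 w), ← abs_mul,
      abs_of_nonneg (rpow_nonneg_coe q.1 w)] at h5
    have h6 := rpow_mul_rpow_neg q.1 w
    have h7 : (q.1 : ℝ) ^ w * (κ q.1 q.2 *
        ((q.1 : ℝ) ^ (-w) * formInner g x (Φ (x, q.2)) (Z.dR (x, q.1))))
        = κ q.1 q.2 * formInner g x (Φ (x, q.2)) (Z.dR (x, q.1)) *
          ((q.1 : ℝ) ^ w * (q.1 : ℝ) ^ (-w)) := by ring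
    have h8 : (q.1 : ℝ) ^ w * (κ q.1 q.2 ^ 2 * (q.2 : ℝ) ^ (-w) + (q.2 : ℝ) ^ w *
        ((q.1 : ℝ) ^ (-w) * formInner g x (Φ (x, q.2)) (Z.dR (x, q.1))) ^ 2)
        = (q.1 : ℝ) ^ w * (κ q.1 q.2 ^ 2 * (q.2 : ℝ) ^ (-w)) +
          (q.1 : ℝ) ^ (-w) * (q.2 : ℝ) ^ w * formInner g x (Φ (x, q.2)) (Z.dR (x, q.1)) ^ 2 *
          ((q.1 : ℝ) ^ w * (q.1 : ℝ) ^ (-w)) := by ring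
    rw [h7, h8, h6, mul_one, mul_one] at h5
    refine h5.trans (add_le_add_right ?_ _)
    have h9 := mul_le_mul_of_nonneg_left (formInner_sq_le g x (Φ (x, q.2)) (Z.dR (x, q.1)))
      (mul_nonneg (rpow_nonneg_coe q.1 (-w)) (rpow_nonneg_coe q.2 w))
    refine h9.trans (le_of_eq ?_)
    ring
  have h10 : ∀ s, ∫ r, κ r s * formInner g x (Φ (x, s)) (Z.dR (x, r)) ∂iooVol
      = -formInner g x (Φ (x, s)) (Z (x, s)) := fun s => by
    have := hκ' _ (hZ.isBump_formInner g x (Φ (x, s))) s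
    simp only [hZ.1.deriv_formInner, indicator_formInnerL] at this
    exact this
  rw [h1, integral_integral_swap h2]
  simp only [h10, integral_neg]

end Operators

/-! ### Cutoff functions near the tip -/

section Cutoffs

/-- A smooth cutoff function, equal to `1` near `0` and to `0` for `t ≥ 2 / (3 l)`. -/
def cut (l t : ℝ) : ℝ := Real.smoothTransition (2 - 3 * l * t)

theorem cut_nonneg (l t : ℝ) : 0 ≤ cut l t := Real.smoothTransition.nonneg _

theorem cut_le_one (l t : ℝ) : cut l t ≤ 1 := Real.smoothTransition.le_one _

theorem cut_eq_one {l t : ℝ} (h : 3 * l * t ≤ 1) : cut l t = 1 :=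
  Real.smoothTransition.one_of_one_le (by linarith)

theorem cut_eq_zero {l t : ℝ} (h : 2 ≤ 3 * l * t) : cut l t = 0 :=
  Real.smoothTransition.zero_of_nonpos (by linarith)

theorem contDiff_cut (l : ℝ) : ContDiff ℝ ∞ (cut l) :=
  Real.smoothTransition.contDiff.comp (contDiff_const.sub (contDiff_const.mul contDiff_id))

theorem hasDerivAt_cut (l t : ℝ) : HasDerivAt (cut l) (deriv (cut l) t) t :=
  ((contDiff_cut l).differentiable (by simp) t).hasDerivAt

theorem deriv_cut_of_lt {l t : ℝ} (h : 3 * l * t < 1) : deriv (cut l) t = 0 := by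
  have h1 : cut l =ᶠ[𝓝 t] fun _ => 1 := by
    have : ContinuousAt (fun t => 3 * l * t) t := by fun_prop
    filter_upwards [this.eventually_lt_const h] with u hu using cut_eq_one hu.le
  rw [h1.deriv_eq, deriv_const]

theorem deriv_cut_of_gt {l t : ℝ} (h : 2 < 3 * l * t) : deriv (cut l) t = 0 := by
  have h1 : cut l =ᶠ[𝓝 t] fun _ => 0 := by
    have : ContinuousAt (fun t => 3 * l * t) t := by fun_prop
    filter_upwards [this.eventually_const_lt h] with u hu using cut_eq_zero hu.le
  rw [h1.deriv_eq, deriv_const]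

/-- All `cut l` are rescalings of one function, so the chain rule gives the factor l with a uniform
constant. -/
theorem exists_deriv_cut_le : ∃ C, ∀ l t : ℝ, |deriv (cut l) t| ≤ C * |l| := by
  have h0 : ContDiff ℝ ∞ Real.smoothTransition := Real.smoothTransition.contDiff
  have h1 : HasCompactSupport (deriv Real.smoothTransition) := by
    refine HasCompactSupport.intro (isCompact_Icc (a := (0 : ℝ)) (b := 1)) fun x hx => ?_
    rcases lt_or_ge x 0 with h | h
    · have : Real.smoothTransition =ᶠ[𝓝 x] fun _ => 0 := by
        filter_upwards [gt_mem_nhds h] with u hu using Real.smoothTransition.zero_of_nonpos hu.le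
      rw [this.deriv_eq, deriv_const]
    · have h' : 1 < x := by
        by_contra h'
        exact hx ⟨h, not_lt.1 h'⟩
      have : Real.smoothTransition =ᶠ[𝓝 x] fun _ => 1 := by
        filter_upwards [lt_mem_nhds h'] with u hu using Real.smoothTransition.one_of_one_le hu.le
      rw [this.deriv_eq, deriv_const]
  obtain ⟨C, hC⟩ := h1.exists_bound_of_continuous (contDiff_infty_iff_deriv.1 h0).2.continuous
  refine ⟨3 * C, fun l t => ?_⟩
  have h2 : HasDerivAt (cut l) (deriv Real.smoothTransition (2 - 3 * l * t) * -(3 * l)) t := by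
    have h3 : HasDerivAt (fun t => 2 - 3 * l * t) (-(3 * l)) t := by
      simpa using ((hasDerivAt_id t).const_mul (3 * l)).const_sub 2
    exact ((h0.differentiable (by simp) _).hasDerivAt).comp t h3
  rw [h2.deriv, abs_mul, abs_neg, abs_mul, abs_of_pos (zero_lt_three' ℝ)]
  have := mul_le_mul_of_nonneg_right (hC (2 - 3 * l * t)) (mul_nonneg zero_le_three (abs_nonneg l))
  rw [Real.norm_eq_abs] at this
  linarith

theorem isBump_of_Icc {a : ℝ → ℝ} (h : ContDiff ℝ ∞ a) {α β : ℝ} (hα : 0 < α) (hβ : β < 1)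
    (h0 : ∀ t ∉ Set.Icc α β, a t = 0) : IsBump a :=
  ⟨h, HasCompactSupport.intro isCompact_Icc h0,
    (closure_minimal (Function.support_subset_iff'.2 h0) isClosed_Icc).trans
      (Set.Icc_subset_Ioo hα hβ)⟩

theorem IsBump.exists_Icc {a : ℝ → ℝ} (ha : IsBump a) :
    ∃ α β : ℝ, 0 < α ∧ α < β ∧ β < 1 ∧ ∀ t ∉ Set.Icc α β, a t = 0 := by
  rcases (tsupport a).eq_empty_or_nonempty with h | h
  · exact ⟨1 / 3, 2 / 3, by norm_num, by norm_num, by norm_num, fun t _ =>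
      image_eq_zero_of_notMem_tsupport (h ▸ Set.notMem_empty t)⟩
  · have hc : IsCompact (tsupport a) := ha.compact
    obtain ⟨α, h1, h2⟩ := hc.exists_isLeast h
    obtain ⟨β, h3, h4⟩ := hc.exists_isGreatest h
    have h5 := ha.subset h1
    have h6 := ha.subset h3
    have h7 : α ≤ β := h2 h3
    refine ⟨α, (β + 1) / 2, h5.1, by linarith [h6.2], by linarith [h6.2], fun t ht =>
      image_eq_zero_of_notMem_tsupport fun hs => ht ⟨h2 hs, (h4 hs).trans (by linarith [h6.2])⟩⟩

theorem isBump_deriv_cut {l : ℝ} (hl : 1 ≤ l) : IsBump (deriv (cut l)) := by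
  have hl0 : 0 < 3 * l := by linarith
  refine isBump_of_Icc (contDiff_infty_iff_deriv.1 (contDiff_cut l)).2 (α := 1 / (3 * l))
    (β := 2 / (3 * l)) (by positivity) ?_ fun t ht => ?_
  · rw [div_lt_one hl0]; linarith
  · by_contra h
    refine ht ⟨?_, ?_⟩
    · rw [div_le_iff₀ hl0]
      by_contra h'
      exact h (deriv_cut_of_lt (by linarith))
    · rw [le_div_iff₀ hl0]
      by_contra h'
      exact h (deriv_cut_of_gt (by linarith))

theorem isBump_cut_sub {l : ℝ} (hl : 1 ≤ l) : IsBump (cut 1 - cut l) := by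
  have hl0 : 0 < 3 * l := by linarith
  refine isBump_of_Icc ((contDiff_cut 1).sub (contDiff_cut l)) (α := 1 / (3 * l))
    (β := 2 / 3) (by positivity) (by norm_num) fun t ht => ?_
  rw [Pi.sub_apply]
  rcases lt_or_ge t (1 / (3 * l)) with h | h
  · rw [lt_div_iff₀ hl0] at h
    rw [cut_eq_one (l := l) (by linarith), cut_eq_one, sub_self]
    rcases le_or_gt t 0 with h0 | h0 <;> nlinarith
  · have h1 : 2 / 3 < t := by
      by_contra h'
      exact ht ⟨h, not_lt.1 h'⟩
    rw [cut_eq_zero (l := l) (by nlinarith), cut_eq_zero (by nlinarith), sub_self]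

theorem integral_lt_mul {h : ℝ → ℝ} (s : unitIoo) :
    ∫ r, (if s < r then 1 else 0) * h (r : unitIoo) ∂iooVol = ∫ t in (s : ℝ)..1, h t := by
  have h0 : ∀ r : unitIoo, (if s < r then 1 else 0) * h r
      = (Set.Ioi (s : ℝ)).indicator h r := by
    intro r
    by_cases h' : s < r
    · rw [if_pos h', Set.indicator_of_mem (show (r : ℝ) ∈ Set.Ioi (s : ℝ) from h'), one_mul]
    · rw [if_neg h', Set.indicator_of_notMem (show (r : ℝ) ∉ Set.Ioi (s : ℝ) from h'), zero_mul]
  simp only [h0]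
  rw [integral_iooVol, setIntegral_indicator measurableSet_Ioi,
    intervalIntegral.integral_of_le s.2.2.le, integral_Ioc_eq_integral_Ioo]
  congr 2
  ext t
  simp only [Set.mem_inter_iff, Set.mem_Ioo, Set.mem_Ioi]
  exact ⟨fun h => ⟨h.2, h.1.2⟩, fun h => ⟨⟨s.2.1.trans h.1, h.2⟩, h.1⟩⟩

theorem integral_deriv_cut {l : ℝ} (hl : 1 ≤ l) :
    ∫ r, deriv (cut l) (r : unitIoo) ∂iooVol = -1 := by
  rw [integral_iooVol, ← integral_Ioc_eq_integral_Ioo,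
    ← intervalIntegral.integral_of_le zero_le_one,
    intervalIntegral.integral_eq_sub_of_hasDerivAt (fun t _ => hasDerivAt_cut l t)
      ((isBump_deriv_cut hl).contDiff.continuous.intervalIntegrable 0 1),
    cut_eq_zero (by linarith), cut_eq_one (by simp)]
  simp

/-- The antiderivative of a bump function, corrected near `0` in order to be a bump function. -/
theorem IsBump.exists_primitive {a : ℝ → ℝ} (ha : IsBump a) {l : ℝ} (hl : 1 ≤ l) :
    ∃ b : ℝ → ℝ, IsBump b ∧
      (∀ t, deriv b t = (∫ r, a (r : unitIoo) ∂iooVol) * deriv (cut l) t + a t) ∧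
      ∀ s : unitIoo, ∫ r, a (r : unitIoo) * ((if s < r then 1 else 0) - cut l s) ∂iooVol = -b s := by
  obtain ⟨α, β, h1, h2, h3, h4⟩ := ha.exists_Icc
  have hl0 : 0 < 3 * l := by linarith
  have hac := ha.contDiff.continuous
  have hint : ∀ x y, IntervalIntegrable a volume x y := fun x y => hac.intervalIntegrable x y
  set C := ∫ r, a (r : unitIoo) ∂iooVol with hC
  have hC' : C = ∫ t in (0 : ℝ)..1, a t := by
    rw [hC, integral_iooVol, ← integral_Ioc_eq_integral_Ioo,
      intervalIntegral.integral_of_le zero_le_one]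
  let A : ℝ → ℝ := fun t => ∫ x in (0 : ℝ)..t, a x
  have hA : ∀ t, HasDerivAt A (a t) t := fun t =>
    intervalIntegral.integral_hasDerivAt_right (hint 0 t)
      (hac.stronglyMeasurableAtFilter _ _) hac.continuousAt
  have hAd : deriv A = a := funext fun t => (hA t).deriv
  have hAs : ContDiff ℝ ∞ A :=
    contDiff_infty_iff_deriv.2 ⟨fun t => (hA t).differentiableAt, hAd ▸ ha.contDiff⟩
  have hA0 : ∀ t < α, A t = 0 := fun t ht => by
    refine (intervalIntegral.integral_congr (g := fun _ => 0) fun x hx => h4 x fun h => ?_).trans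
      (by simp)
    have := hx.2
    rcases le_total 0 t with h' | h'
    · rw [max_eq_right h'] at this
      linarith [h.1]
    · rw [max_eq_left h'] at this
      linarith [h.1]
  have hA1 : ∀ t, β < t → A t = C := fun t ht => by
    have h5 : ∫ x in t..(1 : ℝ), a x = 0 := by
      refine (intervalIntegral.integral_congr (g := fun _ => 0) fun x hx => h4 x fun h => ?_).trans
        (by simp)
      have := hx.1
      rcases le_total t 1 with h' | h'
      · rw [min_eq_left h'] at this
        linarith [h.2]
      · rw [min_eq_right h'] at this
        linarith [h.2]
    rw [hC', ← intervalIntegral.integral_add_adjacent_intervals (hint 0 t) (hint t 1), h5, add_zero]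
  -- The antiderivative A vanishes to the left of the support of a and equals C to the right of it.
  -- Adding C (cut l - 1), which is 0 near t = 0 and -C near t = 1, makes it vanish near both ends.
  refine ⟨fun t => C * cut l t - C + A t, ?_, fun t => ?_, fun s => ?_⟩
  · refine isBump_of_Icc (((contDiff_const.mul (contDiff_cut l)).sub contDiff_const).add hAs)
      (α := min α (1 / (3 * l))) (β := max β (2 / (3 * l))) (lt_min h1 (by positivity))
      (max_lt h3 (by rw [div_lt_one hl0]; linarith)) fun t ht => ?_
    rcases lt_or_ge t (min α (1 / (3 * l))) with h | h
    · rw [lt_min_iff, lt_div_iff₀ hl0] at h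
      rw [hA0 t h.1, cut_eq_one (by linarith)]
      ring
    · have h' : max β (2 / (3 * l)) < t := by
        by_contra h'
        exact ht ⟨h, not_lt.1 h'⟩
      rw [max_lt_iff, div_lt_iff₀ hl0] at h'
      rw [hA1 t h'.1, cut_eq_zero (by linarith)]
      ring
  · exact ((((hasDerivAt_cut l t).const_mul C).sub_const C).add (hA t)).deriv
  · have h5 : ∀ r : unitIoo, a r * ((if s < r then 1 else 0) - cut l s)
        = (if s < r then 1 else 0) * a r - cut l s * a r := fun r => by ring
    have h6 : Integrable (fun r : unitIoo => a r) iooVol := by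
      simpa using ha.integrable_mul_of_continuous (continuous_const (y := (1 : ℝ)))
    have h7 : Measurable fun r : unitIoo => if s < r then (1 : ℝ) else 0 :=
      Measurable.ite measurableSet_Ioi measurable_const measurable_const
    simp only [h5]
    rw [integral_sub _ (h6.const_mul _), integral_lt_mul, integral_const_mul, ← hC, hC']
    · have h8 := intervalIntegral.integral_add_adjacent_intervals (hint 0 s) (hint s 1)
      show _ = -(_ * _ - _ + ∫ x in (0 : ℝ)..s, a x)
      rw [← h8]
      ring
    · refine h6.norm.mono' (h7.mul (hac.measurable.comp measurable_subtype_coe)).aestronglyMeasurable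
        (Filter.Eventually.of_forall fun r => ?_)
      rw [norm_mul]
      refine (mul_le_mul_of_nonneg_right ?_ (norm_nonneg _)).trans (one_mul _).le
      split_ifs <;> simp

end Cutoffs

/-! ### The two primitive kernels and their Hilbert–Schmidt bounds -/

section Kernels

theorem integrable_rpow_coe {w : ℝ} (hw : -1 < w) :
    Integrable (fun r : unitIoo => (r : ℝ) ^ w) iooVol :=
  (integrable_iooVol (f := fun r => r ^ w)).2
    ((intervalIntegral.integrableOn_Ioo_rpow_iff zero_lt_one).2 hw)

/-- The weight s^{-w} can be unbounded only at s = 0; for s ≥ δ it is at most 1 + δ^{-w}. -/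
theorem isMultiplier_of_bound (w : ℝ) {m : unitIoo → ℝ} (hm : Measurable m) {C δ : ℝ} (hδ : 0 < δ)
    (hC : ∀ s, |m s| ≤ C) (h0 : ∀ s : unitIoo, (s : ℝ) < δ → m s = 0) : IsMultiplier w m := by
  refine ⟨hm, (integrable_const (C ^ 2 * (1 + δ ^ (-w)))).mono'
    ((hm.pow_const 2).mul (measurable_rpow_coe (-w))).aestronglyMeasurable
    (Filter.Eventually.of_forall fun s => ?_)⟩
  have hs := rpow_nonneg_coe s (-w)
  have hd := Real.rpow_nonneg hδ.le (-w)
  rw [Real.norm_of_nonneg (mul_nonneg (sq_nonneg _) hs)]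
  rcases lt_or_ge (s : ℝ) δ with h | h
  · rw [h0 s h]
    have := sq_nonneg C
    simp only [ne_eq, OfNat.ofNat_ne_zero, not_false_eq_true, zero_pow, zero_mul]
    positivity
  · refine mul_le_mul (sq_le_sq.2 ((hC s).trans (le_abs_self C))) ?_ hs (sq_nonneg C)
    rcases le_total 0 (-w) with h' | h'
    · have := Real.rpow_le_one s.2.1.le s.2.2.le h'
      linarith
    · have := Real.rpow_le_rpow_of_nonpos hδ h h'
      linarith

theorem IsBump.isMultiplier {a : ℝ → ℝ} (ha : IsBump a) (w : ℝ) :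
    IsMultiplier w fun s : unitIoo => a s := by
  obtain ⟨α, β, h1, -, -, h4⟩ := ha.exists_Icc
  obtain ⟨C, hC⟩ := ha.compact.exists_bound_of_continuous ha.contDiff.continuous
  exact isMultiplier_of_bound w (ha.contDiff.continuous.measurable.comp measurable_subtype_coe) h1
    (fun s => hC s) fun s hs => h4 s fun h => not_lt.2 h.1 hs

/-- The kernel of the primitive from `0`. -/
def zeroKer (r s : unitIoo) : ℝ := if s < r then 1 else 0

/-- The kernel of the primitive which is averaged over the starting points by means of `cut l`. -/
def cutKer (l : ℝ) (r s : unitIoo) : ℝ := (if s < r then 1 else 0) - cut l s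

theorem measurable_zeroKer : Measurable (Function.uncurry zeroKer) :=
  Measurable.ite (measurableSet_lt measurable_snd measurable_fst) measurable_const measurable_const

theorem measurable_cutKer (l : ℝ) : Measurable (Function.uncurry (cutKer l)) :=
  measurable_zeroKer.sub ((contDiff_cut l).continuous.measurable.comp
    (measurable_subtype_coe.comp measurable_snd))

theorem isPrimitiveKernel_zeroKer : IsPrimitiveKernel zeroKer := fun _ ha s =>
  ha.integral_deriv_mul_lt s

theorem isPrimitiveKernel_cutKer (l : ℝ) : IsPrimitiveKernel (cutKer l) := fun a ha s => by
  have h6 : Integrable (fun r : unitIoo => deriv a r) iooVol := by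
    simpa using ha.derivative.integrable_mul_of_continuous (continuous_const (y := (1 : ℝ)))
  have h7 : Measurable fun r : unitIoo => if s < r then (1 : ℝ) else 0 :=
    Measurable.ite measurableSet_Ioi measurable_const measurable_const
  simp only [cutKer, sub_mul]
  rw [integral_sub _ (h6.const_mul _), ha.integral_deriv_mul_lt, integral_const_mul,
    ha.integral_deriv, mul_zero, sub_zero]
  refine h6.norm.mono' (h7.mul (ha.derivative.contDiff.continuous.measurable.comp
    measurable_subtype_coe)).aestronglyMeasurable (Filter.Eventually.of_forall fun r => ?_)
  rw [norm_mul]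
  refine (mul_le_mul_of_nonneg_right ?_ (norm_nonneg _)).trans (one_mul _).le
  split_ifs <;> simp

theorem abs_zeroKer_le (r s : unitIoo) : |zeroKer r s| ≤ 1 := by
  rw [zeroKer]
  split_ifs <;> simp

theorem abs_cutKer_le (l : ℝ) (r s : unitIoo) : |cutKer l r s| ≤ 1 := by
  have h1 := cut_nonneg l s
  have h2 := cut_le_one l s
  rw [cutKer, abs_le]
  split_ifs <;> constructor <;> linarith

/-- For starting points all larger than s, both s < r and the averaging count s fully and cancel.
This confines the kernel to r ≤ s near the tip. -/
theorem cutKer_eq_zero {l : ℝ} {r s : unitIoo} (h1 : 3 * l * s ≤ 1) (h2 : s < r) :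
    cutKer l r s = 0 := by
  rw [cutKer, if_pos h2, cut_eq_one h1, sub_self]

theorem isHSKernel_of_bound {w : ℝ} {κ : unitIoo → unitIoo → ℝ}
    (hm : Measurable (Function.uncurry κ)) (h1 : ∀ r s, |κ r s| ≤ 1) {B : unitIoo × unitIoo → ℝ}
    (hB : Integrable B (iooVol.prod iooVol)) (hB0 : ∀ q, 0 ≤ B q)
    (hB1 : ∀ r s : unitIoo, κ r s ≠ 0 → (r : ℝ) ^ w * (s : ℝ) ^ (-w) ≤ B (r, s)) :
    IsHSKernel w κ := by
  refine ⟨hm, hB.mono' (((measurable_rpow_coe w).comp measurable_fst).mul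
    ((hm.pow_const 2).mul ((measurable_rpow_coe (-w)).comp measurable_snd))).aestronglyMeasurable
    (Filter.Eventually.of_forall fun q => ?_)⟩
  have h3 := rpow_nonneg_coe q.1 w
  have h4 := rpow_nonneg_coe q.2 (-w)
  rw [Real.norm_of_nonneg (mul_nonneg h3 (mul_nonneg (sq_nonneg _) h4))]
  by_cases h : κ q.1 q.2 = 0
  · rw [h]
    simpa using hB0 q
  · refine le_trans ?_ (hB1 q.1 q.2 h)
    have h5 : κ q.1 q.2 ^ 2 ≤ 1 := by
      rw [sq_le_one_iff_abs_le_one]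
      exact h1 _ _
    exact mul_le_mul_of_nonneg_left (mul_le_of_le_one_left h4 h5) h3

theorem rpow_mul_rpow_neg_eq_div (r s : unitIoo) (w : ℝ) :
    (r : ℝ) ^ w * (s : ℝ) ^ (-w) = ((r : ℝ) / s) ^ w := by
  rw [Real.rpow_neg s.2.1.le, Real.div_rpow r.2.1.le s.2.1.le, div_eq_mul_inv]

/-- Where the kernel is nonzero one has r ≤ 3s: otherwise 3s < r < 1, so `cutKer_eq_zero` applies.
For w ≥ 0 this bounds (r/s)^w by 3^w; for -1 < w ≤ 0 one uses s^{-w} ≤ 1 and integrability of r^w.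
-/
theorem isHSKernel_cutKer_one {w : ℝ} (hw : -1 < w) : IsHSKernel w (cutKer 1) := by
  refine isHSKernel_of_bound (measurable_cutKer 1) (abs_cutKer_le 1)
    (B := fun q => (3 : ℝ) ^ w + (q.1 : ℝ) ^ w)
    ((integrable_const _).add ((integrable_rpow_coe hw).comp_fst iooVol))
    (fun q => add_nonneg (by positivity) (rpow_nonneg_coe _ _)) fun r s h => ?_
  have hr := rpow_nonneg_coe r w
  have h3 : 0 ≤ (3 : ℝ) ^ w := by positivity
  rcases le_total 0 w with h' | h'
  · have h4 : (r : ℝ) / s ≤ 3 := by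
      rw [div_le_iff₀ s.2.1]
      by_contra h5
      refine h (cutKer_eq_zero ?_ ?_)
      · linarith [r.2.2]
      · have : (s : ℝ) < r := by linarith [s.2.1]
        exact this
    rw [rpow_mul_rpow_neg_eq_div]
    have := Real.rpow_le_rpow (div_nonneg r.2.1.le s.2.1.le) h4 h'
    linarith
  · have h4 := mul_le_of_le_one_right hr (Real.rpow_le_one s.2.1.le s.2.2.le (neg_nonneg.2 h'))
    linarith

/-- The kernel lives on s < r. For w ≤ 0 this gives (r/s)^w ≤ 1; for 0 ≤ w < 1 one uses r^w ≤ 1 and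
integrability of s^{-w}. -/
theorem isHSKernel_zeroKer {w : ℝ} (hw : w < 1) : IsHSKernel w zeroKer := by
  refine isHSKernel_of_bound measurable_zeroKer abs_zeroKer_le
    (B := fun q => 1 + (q.2 : ℝ) ^ (-w))
    ((integrable_const _).add ((integrable_rpow_coe (by linarith)).comp_snd iooVol))
    (fun q => add_nonneg (by positivity) (rpow_nonneg_coe _ _)) fun r s h => ?_
  have hs := rpow_nonneg_coe s (-w)
  rcases le_total 0 w with h' | h'
  · have h4 := mul_le_of_le_one_left hs (Real.rpow_le_one r.2.1.le r.2.2.le h')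
    linarith
  · have h5 : s < r := by
      by_contra h5
      exact h (if_neg h5)
    have h4 : 1 ≤ (r : ℝ) / s := by
      rw [one_le_div s.2.1]
      exact le_of_lt h5
    rw [rpow_mul_rpow_neg_eq_div]
    have := Real.rpow_le_one_of_one_le_of_nonpos h4 h'
    linarith

end Kernels

/-! ### Recovering a function from its weak derivative -/

section Scalar

/-- A function with a weak derivative is recovered from the latter by integration. -/
theorem ae_eq_integral_of_weak_deriv {v w : ℝ} {P Q : unitIoo → ℝ} (hP : Measurable P)
    (hP' : Integrable (fun s : unitIoo => (s : ℝ) ^ v * P s ^ 2) iooVol)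
    (hQ : Measurable Q) (hQ' : Integrable (fun s : unitIoo => (s : ℝ) ^ w * Q s ^ 2) iooVol)
    (h : ∀ a, IsBump a → ∫ s : unitIoo, deriv a s * P s ∂iooVol
      + ∫ s : unitIoo, a s * Q s ∂iooVol = 0) {l : ℝ} (hl : 1 ≤ l) :
    ∀ᵐ r ∂iooVol, P r = ∫ s, cutKer l r s * Q s ∂iooVol
      - ∫ s : unitIoo, deriv (cut l) s * P s ∂iooVol := by
  have hPb : ∀ a, IsBump a → Integrable (fun s : unitIoo => a s * P s) iooVol := fun a ha =>
    (ha.isMultiplier v).integrable_mul hP.aestronglyMeasurable hP'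
  set D := ∫ s : unitIoo, deriv (cut l) s * P s ∂iooVol with hD
  have hi1 : ∀ a, IsBump a → Integrable (fun s : unitIoo => a s) iooVol := fun a ha => by
    simpa using ha.integrable_mul_of_continuous (continuous_const (y := (1 : ℝ)))
  have hKQ : Measurable fun q : unitIoo × unitIoo => cutKer l q.1 q.2 * Q q.2 :=
    (measurable_cutKer l).mul (hQ.comp measurable_snd)
  have hF : ∀ a, IsBump a → Integrable (fun q : unitIoo × unitIoo =>
      a q.1 * (cutKer l q.1 q.2 * Q q.2)) (iooVol.prod iooVol) := by
    intro a ha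
    obtain ⟨α, β, h1, -, -, h4⟩ := ha.exists_Icc
    have hδ : 0 < min α (1 / (3 * l)) := lt_min h1 (by positivity)
    -- On the support of a one has r ≥ α, so `cutKer l r s` vanishes for s < min α (1/(3l)). Thus m,
    -- which avoids the tip, dominates the kernel, and Fubini applies for any weight.
    let m : unitIoo → ℝ := fun s => if (s : ℝ) < min α (1 / (3 * l)) then 0 else 1
    have hm : Measurable m := Measurable.ite
      (measurableSet_lt measurable_subtype_coe measurable_const) measurable_const measurable_const
    have hm' : IsMultiplier w m := isMultiplier_of_bound w hm hδ (C := 1)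
      (fun s => by simp only [m]; split_ifs <;> simp) fun s hs => if_pos hs
    refine ((hi1 a ha).norm.mul_prod
      (hm'.integrable_mul hQ.aestronglyMeasurable hQ').norm).mono'
      (((ha.contDiff.continuous.measurable.comp measurable_subtype_coe).comp measurable_fst).mul
        hKQ).aestronglyMeasurable (Filter.Eventually.of_forall fun q => ?_)
    rw [norm_mul]
    by_cases h5 : a q.1 = 0
    · rw [h5, norm_zero, zero_mul, zero_mul]
    refine mul_le_mul_of_nonneg_left ?_ (norm_nonneg _)
    rw [norm_mul, norm_mul]
    refine mul_le_mul_of_nonneg_right ?_ (norm_nonneg _)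
    have h6 := abs_cutKer_le l q.1 q.2
    have h7 : α ≤ q.1 := by
      by_contra h7
      exact h5 (h4 _ fun h8 => h7 h8.1)
    by_cases h8 : (q.2 : ℝ) < min α (1 / (3 * l))
    · rw [lt_min_iff, lt_div_iff₀ (by linarith)] at h8
      rw [cutKer_eq_zero (by linarith) (show (q.2 : ℝ) < q.1 by linarith)]
      simp
    · have h9 : m q.2 = 1 := if_neg h8
      rw [h9, norm_one]
      exact h6
  have hK : ∀ a, IsBump a → Integrable (fun r : unitIoo =>
      a r * ∫ s, cutKer l r s * Q s ∂iooVol) iooVol := fun a ha =>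
    (hF a ha).integral_prod_left.congr (Filter.Eventually.of_forall fun r =>
      integral_const_mul (a r) fun s => cutKer l r s * Q s)
  have hmeas : Measurable fun r => ∫ s, cutKer l r s * Q s ∂iooVol :=
    (hKQ.stronglyMeasurable.integral_prod_right (ν := iooVol)).measurable
  have key := ae_eq_zero_of_integral_bump
    (f := fun r => P r - (∫ s, cutKer l r s * Q s ∂iooVol) + D)
    ((hP.sub hmeas).add_const D).aestronglyMeasurable (fun a ha => ?_) fun a ha => ?_
  · filter_upwards [key] with r hr
    linarith
  · exact (((hPb a ha).sub (hK a ha)).add ((hi1 a ha).mul_const D)).congr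
      (Filter.Eventually.of_forall fun r => by simp only [Pi.add_apply, Pi.sub_apply]; ring)
  -- The weak equation is tested with the corrected antiderivative b of a: its derivative produces a
  -- and the average D, while b itself is minus the integral of a against the kernel.
  · obtain ⟨b, hb, hb1, hb2⟩ := ha.exists_primitive hl
    have e1 : ∫ r : unitIoo, a r * (P r - (∫ s, cutKer l r s * Q s ∂iooVol) + D) ∂iooVol
        = ∫ r : unitIoo, a r * P r ∂iooVol
          - ∫ r : unitIoo, a r * ∫ s, cutKer l r s * Q s ∂iooVol ∂iooVol
          + (∫ r : unitIoo, a r ∂iooVol) * D := by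
      have h5 : Integrable (fun r : unitIoo => a r * P r
          - a r * ∫ s, cutKer l r s * Q s ∂iooVol) iooVol := (hPb a ha).sub (hK a ha)
      rw [← integral_mul_const, ← integral_sub (hPb a ha) (hK a ha),
        ← integral_add h5 ((hi1 a ha).mul_const D)]
      exact integral_congr_ae (Filter.Eventually.of_forall fun r => by ring)
    have e2 : ∫ r : unitIoo, a r * ∫ s, cutKer l r s * Q s ∂iooVol ∂iooVol
        = -∫ s : unitIoo, b s * Q s ∂iooVol := by
      have h5 : ∀ r : unitIoo, a r * ∫ s, cutKer l r s * Q s ∂iooVol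
          = ∫ s, a r * (cutKer l r s * Q s) ∂iooVol := fun r => (integral_const_mul _ _).symm
      simp only [h5]
      rw [integral_integral_swap (hF a ha), ← integral_neg]
      refine integral_congr_ae (Filter.Eventually.of_forall fun s => ?_)
      have h6 : ∀ r : unitIoo, a r * (cutKer l r s * Q s) = a r * cutKer l r s * Q s :=
        fun r => (mul_assoc _ _ _).symm
      simp only [h6]
      rw [integral_mul_const, ← neg_mul]
      exact congrArg (· * Q s) (hb2 s)
    have e3 : ∫ s : unitIoo, deriv b s * P s ∂iooVol
        = (∫ r : unitIoo, a r ∂iooVol) * D + ∫ r : unitIoo, a r * P r ∂iooVol := by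
      have h5 : ∀ s : unitIoo, deriv b s * P s
          = (∫ r : unitIoo, a r ∂iooVol) * (deriv (cut l) s * P s) + a s * P s := fun s => by
        rw [hb1]; ring
      simp only [h5]
      rw [integral_add ((hPb _ (isBump_deriv_cut hl)).const_mul _) (hPb a ha), integral_const_mul]
    have e4 := h b hb
    rw [e1, e2]
    rw [e3] at e4
    linarith

end Scalar

/-! ### Bump functions concentrating at the tip -/

/-- The bump functions `-∂ₜ (cut l)`, of integral `1` and concentrated near `0` for large `l`. -/
def cutBump (l : ℝ) : ℝ → ℝ := -deriv (cut l)

theorem isBump_cutBump {l : ℝ} (hl : 1 ≤ l) : IsBump (cutBump l) := (isBump_deriv_cut hl).neg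

theorem integral_cutBump {l : ℝ} (hl : 1 ≤ l) : ∫ r, cutBump l (r : unitIoo) ∂iooVol = 1 := by
  simp only [cutBump, Pi.neg_apply]
  rw [integral_neg, integral_deriv_cut hl, neg_neg]

theorem cutBump_eq_zero {l t : ℝ} (hl : 1 ≤ l) (h : 1 / l < t) : cutBump l t = 0 := by
  have hl0 : 0 < l := by linarith
  rw [div_lt_iff₀ hl0] at h
  rw [cutBump, Pi.neg_apply, deriv_cut_of_gt (by linarith), neg_zero]

/-- The bump is at most C l and lives on s ≤ 1/l, where s^{-v} ≤ s ≤ 1/l because v ≤ -1. Hence the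
integral is at most (C l)² · (1/l) · (1/l) = C². -/
theorem exists_integral_cutBump_sq_le {v : ℝ} (hv : v ≤ -1) :
    ∃ C, ∀ l : ℝ, 1 ≤ l → ∫ s : unitIoo, cutBump l s ^ 2 * (s : ℝ) ^ (-v) ∂iooVol ≤ C := by
  obtain ⟨C, hC⟩ := exists_deriv_cut_le
  refine ⟨C ^ 2, fun l hl => ?_⟩
  have hl0 : 0 < l := by linarith
  have hl1 : 1 / l ≤ 1 := by rw [div_le_one hl0]; exact hl
  have hC' : ∀ t, |cutBump l t| ≤ C * l := fun t => by
    rw [cutBump, Pi.neg_apply, abs_neg]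
    exact (hC l t).trans_eq (by rw [abs_of_pos hl0])
  have h1 : ∀ s : unitIoo, cutBump l s ^ 2 * (s : ℝ) ^ (-v)
      ≤ (Set.Iic (1 / l)).indicator (fun _ => C ^ 2 * l) (s : ℝ) := fun s => by
    rcases lt_or_ge (1 / l) (s : ℝ) with h | h
    · rw [cutBump_eq_zero hl h, Set.indicator_of_notMem (by simpa using h)]
      simp
    · rw [Set.indicator_of_mem (by simpa using h)]
      have h2 : (s : ℝ) ^ (-v) ≤ 1 / l := by
        refine le_trans ?_ h
        have := Real.rpow_le_rpow_of_exponent_ge s.2.1 s.2.2.le (show (1 : ℝ) ≤ -v by linarith)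
        rwa [Real.rpow_one] at this
      have h3 : cutBump l s ^ 2 ≤ (C * l) ^ 2 := sq_le_sq.2 ((hC' s).trans (le_abs_self _))
      calc _ ≤ (C * l) ^ 2 * (1 / l) := mul_le_mul h3 h2 (rpow_nonneg_coe s _) (sq_nonneg _)
        _ = C ^ 2 * l := by field_simp
  have hm : Measurable fun s : unitIoo =>
      (Set.Iic (1 / l)).indicator (fun _ => C ^ 2 * l) (s : ℝ) :=
    (measurable_const.indicator measurableSet_Iic).comp measurable_subtype_coe
  have hi : Integrable (fun s : unitIoo =>
      (Set.Iic (1 / l)).indicator (fun _ => C ^ 2 * l) (s : ℝ)) iooVol := by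
    refine (integrable_const (C ^ 2 * l)).mono' hm.aestronglyMeasurable
      (Filter.Eventually.of_forall fun s => ?_)
    refine (norm_indicator_le_norm_self _ _).trans ?_
    rw [Real.norm_of_nonneg (by positivity)]
  refine (integral_mono ((isBump_cutBump hl).isMultiplier v).integrable hi h1).trans ?_
  rw [integral_iooVol, setIntegral_indicator measurableSet_Iic, setIntegral_const, smul_eq_mul]
  have h2 : (volume : Measure ℝ).real (Set.Ioo 0 1 ∩ Set.Iic (1 / l)) ≤ 1 / l := by
    have h3 : Set.Ioo 0 1 ∩ Set.Iic (1 / l) ⊆ Set.Icc 0 (1 / l) := fun t ht => ⟨ht.1.1.le, ht.2⟩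
    refine (measureReal_mono h3 (by simp)).trans ?_
    rw [Real.volume_real_Icc_of_le (by positivity), sub_zero]
  calc _ ≤ 1 / l * (C ^ 2 * l) := mul_le_mul_of_nonneg_right h2 (by positivity)
    _ = C ^ 2 := by field_simp

/-! ### Averages near the tip tend to zero -/

section Convergence

variable {E : Type*} [NormedAddCommGroup E] [NormedSpace ℝ E] [FiniteDimensional ℝ E]
  [MeasurableSpace E] [BorelSpace E]
  {H : Type*} [TopologicalSpace H] {I : ModelWithCorners ℝ E H} [I.Boundaryless]
  {F : Type*} [TopologicalSpace F] [ChartedSpace H F] [IsManifold I ∞ F]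
  [MeasurableSpace F] [BorelSpace F] [SecondCountableTopology F] {k : ℕ}
  {g : RiemMetric I F} {v w : ℝ} {Φ : HForm I F k}

/-- The restriction of a family of forms to the levels `s ≤ ε`. -/
def HForm.below (ε : ℝ) (Φ : HForm I F k) : HForm I F k :=
  fun p => (Set.Iic ε).indicator (fun _ => (1 : ℝ)) p.2 • Φ p

theorem formInner_below (g : RiemMetric I F) (ε : ℝ) (Φ : HForm I F k) (p : F × unitIoo) :
    (p.2 : ℝ) ^ v * formInner g p.1 (Φ.below ε p) (Φ.below ε p)
      = (Set.Iic ε).indicator (fun _ => (1 : ℝ)) p.2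
        * ((p.2 : ℝ) ^ v * formInner g p.1 (Φ p) (Φ p)) := by
  have h : (Set.Iic ε).indicator (fun _ => (1 : ℝ)) (p.2 : ℝ)
      * (Set.Iic ε).indicator (fun _ => (1 : ℝ)) p.2
      = (Set.Iic ε).indicator (fun _ => (1 : ℝ)) p.2 := by
    by_cases h : (p.2 : ℝ) ∈ Set.Iic ε
    · rw [Set.indicator_of_mem h, mul_one]
    · rw [Set.indicator_of_notMem h, mul_zero]
  have h1 : formInner g p.1 (Φ.below ε p) (Φ.below ε p)
      = (Set.Iic ε).indicator (fun _ => (1 : ℝ)) (p.2 : ℝ)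
        * ((Set.Iic ε).indicator (fun _ => (1 : ℝ)) (p.2 : ℝ) * formInner g p.1 (Φ p) (Φ p)) := by
    rw [HForm.below, formInner_smul_left, formInner_smul_right]
  rw [h1, ← mul_assoc ((Set.Iic ε).indicator _ _), h]
  ring

theorem norm_indicator_mul_le (ε t x : ℝ) :
    ‖(Set.Iic ε).indicator (fun _ => (1 : ℝ)) t * x‖ ≤ ‖x‖ := by
  rw [norm_mul]
  refine mul_le_of_le_one_left (norm_nonneg _) ((norm_indicator_le_norm_self _ _).trans ?_)
  simp

theorem measurable_indicator_Iic (ε : ℝ) : Measurable fun p : F × unitIoo =>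
    (Set.Iic ε).indicator (fun _ => (1 : ℝ)) (p.2 : ℝ) :=
  (measurable_const.indicator measurableSet_Iic).comp (measurable_subtype_coe.comp measurable_snd)

theorem HForm.SqInt.below (h : Φ.SqInt g v) (ε : ℝ) : (Φ.below ε).SqInt g v := by
  have hm : (Φ.below ε).IsMeasurable := HForm.IsMeasurable.smul (measurable_indicator_Iic ε) h.meas
  refine ⟨hm, ?_⟩
  simp only [formInner_below]
  exact h.integrable.norm.mono' ((measurable_indicator_Iic ε).aestronglyMeasurable.mul
    h.integrable.aestronglyMeasurable)
    (Filter.Eventually.of_forall fun p => norm_indicator_mul_le _ _ _)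

theorem tendsto_integral_below (h : Φ.SqInt g v) :
    Filter.Tendsto (fun n : ℕ => ∫ p, (p.2 : ℝ) ^ v *
      formInner g p.1 (Φ.below (1 / ((n : ℝ) + 1)) p) (Φ.below (1 / ((n : ℝ) + 1)) p) ∂(baseVol g))
      Filter.atTop (𝓝 0) := by
  simp only [formInner_below]
  rw [← integral_zero (F × unitIoo) ℝ (μ := baseVol g)]
  refine tendsto_integral_of_dominated_convergence _
    (fun n => (measurable_indicator_Iic _).aestronglyMeasurable.mul
      h.integrable.aestronglyMeasurable) h.integrable.norm
    (fun n => Filter.Eventually.of_forall fun p => norm_indicator_mul_le _ _ _)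
    (Filter.Eventually.of_forall fun p => ?_)
  refine tendsto_const_nhds.congr' ?_
  filter_upwards [tendsto_one_div_add_atTop_nhds_zero_nat.eventually_lt_const p.2.2.1] with n hn
  rw [Set.indicator_of_notMem (by simpa using hn), zero_mul]

theorem radInt_cutBump_below {l : ℝ} (hl : 1 ≤ l) (Φ : HForm I F k) :
    radInt (fun s => cutBump l s) (Φ.below (1 / l)) = radInt (fun s => cutBump l s) Φ := by
  funext x
  refine integral_congr_ae (G := E [⋀^Fin k]→L[ℝ] ℝ) (Filter.Eventually.of_forall fun s => ?_)
  by_cases h : (s : ℝ) ∈ Set.Iic (1 / l)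
  · have h1 : (Φ.below (1 / l)).fibre x s = Φ.fibre x s := by
      have : (Set.Iic (1 / l)).indicator (fun _ => (1 : ℝ)) (s : ℝ) • Φ.fibre x s = Φ.fibre x s := by
        rw [Set.indicator_of_mem h, one_smul]
      exact this
    exact congrArg (cutBump l s • ·) h1
  · have h1 : cutBump l s = 0 := cutBump_eq_zero hl (by simpa using h)
    beta_reduce
    rw [h1, zero_smul, zero_smul]

/-- The averages see only the levels s ≤ 1/l, where the weighted norm of Φ tends to 0 by dominated
convergence, while the multiplier norms stay bounded. A bound rather than decay of the latter
suffices, so the borderline v = -1 is included. -/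
theorem HForm.SqInt.tendsto_radInt_cutBump (h : Φ.SqInt g v) (hv : v ≤ -1) :
    Filter.Tendsto (fun n : ℕ => ∫ x, formInner g x
      (radInt (fun s => cutBump ((n : ℝ) + 1) s) Φ x) (radInt (fun s => cutBump ((n : ℝ) + 1) s) Φ x)
        ∂(riemVolume g)) Filter.atTop (𝓝 0) := by
  obtain ⟨C, hC⟩ := exists_integral_cutBump_sq_le hv
  have h1 := (tendsto_integral_below h).const_mul C
  rw [mul_zero] at h1
  refine squeeze_zero (fun n => integral_nonneg fun x => formInner_self_nonneg _ _ _)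
    (fun n => ?_) h1
  have hn : (1 : ℝ) ≤ (n : ℝ) + 1 := by simp
  have h2 := (h.below (1 / ((n : ℝ) + 1))).integral_radInt_le
    ((isBump_cutBump hn).isMultiplier v)
  rw [radInt_cutBump_below hn] at h2
  refine h2.trans (mul_le_mul_of_nonneg_right (hC _ hn) (integral_nonneg fun p =>
    mul_nonneg (rpow_nonneg_coe _ _) (formInner_self_nonneg _ _ _)))

end Convergence

/-! ### The pull-back as a bounded operator -/

section Pullback

variable {E : Type*} [NormedAddCommGroup E] [NormedSpace ℝ E] [FiniteDimensional ℝ E]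
  [MeasurableSpace E] [BorelSpace E]
  {H : Type*} [TopologicalSpace H] {I : ModelWithCorners ℝ E H} [I.Boundaryless]
  {F : Type*} [TopologicalSpace F] [ChartedSpace H F] [IsManifold I ∞ F]
  [MeasurableSpace F] [BorelSpace F] [SecondCountableTopology F] {k : ℕ}
  {g : RiemMetric I F} {c w : ℝ}

/-- The constant family of forms. -/
def HForm.const (φ : DForm I F k) : HForm I F k := fun p => φ p.1

theorem sqInt_const {φ : DForm I F k} (hφ : φ ∈ sqIntegrable g k) (hw : -1 < w) :
    (HForm.const φ).SqInt g w := by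
  refine ⟨hφ.1.const, ?_⟩
  have := hφ.2.mul_prod (integrable_rpow_coe hw)
  exact this.congr (Filter.Eventually.of_forall fun p => mul_comm _ _)

theorem integral_const_form (φ : DForm I F k) :
    ∫ p, (p.2 : ℝ) ^ w * formInner g p.1 (HForm.const φ p) (HForm.const φ p) ∂(baseVol g)
      = (∫ r : unitIoo, (r : ℝ) ^ w ∂iooVol) * ∫ x, formInner g x (φ x) (φ x) ∂(riemVolume g) := by
  rw [mul_comm, baseVol, ← integral_prod_mul]
  exact integral_congr_ae (Filter.Eventually.of_forall fun p => mul_comm _ _)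

theorem integral_rpow_coe_pos (hw : -1 < w) : 0 < ∫ r : unitIoo, (r : ℝ) ^ w ∂iooVol := by
  rw [integral_iooVol (fun r => r ^ w), ← integral_Ioc_eq_integral_Ioo,
    ← intervalIntegral.integral_of_le zero_le_one, integral_rpow (Or.inl hw),
    Real.one_rpow, Real.zero_rpow (by linarith), sub_zero]
  exact one_div_pos.2 (by linarith)

theorem conePullback_mem {φ : DForm I F k} (hφ : φ ∈ sqIntegrable g k) (hw : -1 < expo E c k) :
    conePullback φ ∈ sqIntegrable (coneMetric g c) k := by
  rw [conePullback_eq]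
  exact pull_mem_sqIntegrable (sqInt_const hφ hw)

theorem hor_conePullback (φ : DForm I F k) : hor (conePullback φ) = HForm.const φ := by
  rw [conePullback_eq, hor_pull]
  rfl

theorem vert_conePullback (φ : DForm I F (k + 1)) : vert (conePullback φ) = 0 := by
  rw [conePullback_eq, vert_pull]

/-- The pull-back of square integrable forms. -/
def conePull (g : RiemMetric I F) (hw : -1 < expo E c k) :
    SqIntForm g k →ₗ[ℝ] SqIntForm (coneMetric g c) k where
  toFun φ := ⟨conePullback φ.1, conePullback_mem φ.2 hw⟩
  map_add' _ _ := rfl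
  map_smul' _ _ := rfl

/-- Constancy in r factors the norm, so the pull-back is a positive multiple of an isometry; this
gives both its continuity and its injectivity. -/
theorem norm_mk_conePull_sq (hw : -1 < expo E c k) (φ : SqIntForm g k) :
    ‖L2Form.mk (conePull g hw φ)‖ ^ 2
      = (∫ r : unitIoo, (r : ℝ) ^ expo E c k ∂iooVol) * ‖L2Form.mk φ‖ ^ 2 := by
  rw [L2Form.norm_mk_sq, L2Form.norm_mk_sq, ← integral_const_form]
  have h := integral_cone_pull g c (conePullback φ.1) (HForm.const φ.1)
  rw [hor_conePullback] at h
  refine Eq.trans ?_ h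
  show ∫ p, formInner (coneMetric g c) p (conePullback φ.1 p) (conePullback φ.1 p)
    ∂(riemVolume (coneMetric g c)) = _
  rw [conePullback_eq]
  rfl

/-- The pull-back as an operator between the Hilbert spaces of square integrable forms. -/
def l2Pull (g : RiemMetric I F) (hw : -1 < expo E c k) :
    L2Form g k →L[ℝ] L2Form (coneMetric g c) k :=
  SeparationQuotient.liftCLM
    ((SeparationQuotient.mkCLM ℝ (SqIntForm (coneMetric g c) k)).comp
      ((conePull g hw).mkContinuous √(∫ r : unitIoo, (r : ℝ) ^ expo E c k ∂iooVol) fun φ => by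
        have h := norm_mk_conePull_sq hw φ
        have h1 : ‖L2Form.mk (conePull g hw φ)‖ = ‖conePull g hw φ‖ := SeparationQuotient.norm_mk _
        have h2 : ‖L2Form.mk φ‖ = ‖φ‖ := SeparationQuotient.norm_mk _
        rw [h1, h2] at h
        have h0 := (integral_rpow_coe_pos hw).le
        refine le_of_sq_le_sq ?_ (by positivity)
        rw [h, mul_pow, Real.sq_sqrt h0]))
    fun x y h => (SeparationQuotient.mk_eq_mk.2 (h.map (ContinuousLinearMap.continuous _)))

theorem l2Pull_mk (hw : -1 < expo E c k) (φ : SqIntForm g k) :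
    l2Pull g hw (L2Form.mk φ) = L2Form.mk (conePull g hw φ) := rfl

theorem l2Pull_injective (hw : -1 < expo E c k) : Function.Injective (l2Pull g hw) := by
  rw [injective_iff_map_eq_zero]
  intro y hy
  obtain ⟨φ, rfl⟩ := L2Form.mk_surjective y
  rw [l2Pull_mk] at hy
  have h := norm_mk_conePull_sq hw φ
  rw [hy, norm_zero, zero_pow two_ne_zero, eq_comm, mul_eq_zero] at h
  rcases h with h | h
  · exact absurd h (integral_rpow_coe_pos hw).ne'
  · exact norm_eq_zero.1 (pow_eq_zero_iff two_ne_zero |>.1 h)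

end Pullback

/-! ### Test functions separate square integrable functions -/

section ZeroForms

variable {E : Type*} [NormedAddCommGroup E] [NormedSpace ℝ E] [FiniteDimensional ℝ E]
  {H : Type*} [TopologicalSpace H] {I : ModelWithCorners ℝ E H}
  {M : Type*} [TopologicalSpace M] [ChartedSpace H M] [IsManifold I ∞ M]

/-- Functions as forms of degree `0`. -/
def ofFun (h : M → ℝ) : DForm I M 0 := fun x =>
  ContinuousAlternatingMap.constOfIsEmpty ℝ (TangentSpace I x) (Fin 0) (h x)

theorem isTest_ofFun {h : M → ℝ} (hs : ContMDiff I 𝓘(ℝ, ℝ) ∞ h) (hc : HasCompactSupport h) :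
    (ofFun h : DForm I M 0).IsTest := by
  refine ⟨fun x₀ => ?_, tsupport h, hc, fun x hx => ?_⟩
  · have h1 : ContDiffOn ℝ ∞ (h ∘ (extChartAt I x₀).symm) (extChartAt I x₀).target := by
      rw [← contMDiffOn_iff_contDiffOn]
      exact hs.comp_contMDiffOn (contMDiffOn_extChartAt_symm x₀)
    have h2 : (ofFun h : DForm I M 0).inChart x₀ = fun y =>
        (h ∘ (extChartAt I x₀).symm) y •
          ContinuousAlternatingMap.constOfIsEmpty ℝ E (Fin 0) (1 : ℝ) := by
      funext y
      ext v
      exact (mul_one (h ((extChartAt I x₀).symm y))).symm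
    rw [h2]
    exact h1.smul contDiffOn_const
  · ext v
    simp [ofFun, image_eq_zero_of_notMem_tsupport hx]

theorem covInner_fin_zero {V ι : Type*} [AddCommGroup V] [Module ℝ V] [TopologicalSpace V]
    [Fintype ι] [DecidableEq ι] (B : V →L[ℝ] V →L[ℝ] ℝ) (b : ι → V) (α β : V [⋀^Fin 0]→L[ℝ] ℝ) :
    covInner B b α β = α 0 * β 0 := by
  have e : ∀ p : Fin 0 → ι, (fun a => b (p a)) = 0 := fun p => Subsingleton.elim _ _
  simp [covInner, e]

theorem formInner_ofFun (g : RiemMetric I M) (x : M) (α : TangentSpace I x [⋀^Fin 0]→L[ℝ] ℝ)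
    (h : M → ℝ) : formInner g x α (ofFun h x) = h x * α 0 := by
  rw [formInner, covInner_fin_zero, mul_comm]
  rfl

theorem formInner_zero_form (g : RiemMetric I M) (x : M)
    (α : TangentSpace I x [⋀^Fin 0]→L[ℝ] ℝ) : formInner g x α α = α 0 ^ 2 := by
  rw [formInner, covInner_fin_zero, sq]

/-- Serves degree 0, where there are no primitives and equality in L² itself has to be proved. A
square integrable function is locally integrable, and smooth compactly supported functions detect it
almost everywhere. -/
theorem mk_eq_zero_of_integral_test [MeasurableSpace E] [BorelSpace E] [I.Boundaryless]
    [MeasurableSpace M] [BorelSpace M] [T2Space M] [SecondCountableTopology M]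
    {g : RiemMetric I M} {φ : SqIntForm g 0} (h : ∀ ζ : DForm I M 0, ζ.IsTest →
      ∫ x, formInner g x (φ.1 x) (ζ x) ∂(riemVolume g) = 0) : L2Form.mk φ = 0 := by
  have := I.locallyCompactSpace
  have := ChartedSpace.locallyCompactSpace H M
  let u : M → ℝ := fun x => φ.1 x 0
  have hu2 : ∀ x, formInner g x (φ.1 x) (φ.1 x) = u x ^ 2 := fun x => formInner_zero_form g x _
  have hum : Measurable u := by
    let ζ : DForm I M 0 := fun x => ContinuousAlternatingMap.constOfIsEmpty ℝ _ (Fin 0) (1 : ℝ)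
    have hζ : ζ.IsMeasurable := fun x₀ v => measurable_const
    refine measurable_of_forall_eq (fun x => ?_) (measurable_formInner g φ.2.1 hζ)
    exact ((formInner_ofFun g x (φ.1 x) (fun _ => 1)).trans (one_mul _)).symm
  have hi := φ.2.2
  simp only [hu2] at hi
  have hloc : LocallyIntegrable u (riemVolume g) := by
    rw [locallyIntegrable_iff]
    intro K hK
    refine ((integrableOn_const (C := (1 : ℝ)) hK.measure_lt_top.ne).add hi.integrableOn).mono'
      hum.aestronglyMeasurable (Filter.Eventually.of_forall fun x => ?_)
    rw [Real.norm_eq_abs, abs_le, Pi.add_apply]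
    constructor <;> nlinarith [sq_nonneg (u x + 1), sq_nonneg (u x - 1)]
  have key := ae_eq_zero_of_integral_contMDiff_smul_eq_zero I hloc fun b hb hb' => by
    refine Eq.trans ?_ (h (ofFun b) (isTest_ofFun hb hb'))
    exact integral_congr_ae (Filter.Eventually.of_forall fun x => (formInner_ofFun g x _ b).symm)
  rw [← norm_eq_zero, ← sq_eq_zero_iff, L2Form.norm_mk_sq]
  simp only [hu2]
  refine (integral_congr_ae (g := fun _ => (0 : ℝ)) ?_).trans (integral_zero _ _)
  filter_upwards [key] with x hx
  rw [hx, zero_pow two_ne_zero]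

end ZeroForms

/-! ### Pull-back, averages and the range of d_max -/

section Cohomology

variable {E : Type*} [NormedAddCommGroup E] [NormedSpace ℝ E] [FiniteDimensional ℝ E]
  [MeasurableSpace E] [BorelSpace E]
  {H : Type*} [TopologicalSpace H] {I : ModelWithCorners ℝ E H} [I.Boundaryless]
  {F : Type*} [TopologicalSpace F] [T2Space F] [ChartedSpace H F] [IsManifold I ∞ F]
  [MeasurableSpace F] [BorelSpace F] [SecondCountableTopology F] {k : ℕ}
  {g : RiemMetric I F} {c w : ℝ}

theorem expo_succ (c : ℝ) (k : ℕ) : expo E c (k + 1) = expo E c k - 2 * c := by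
  rw [expo, expo]
  push_cast
  ring

theorem hor_sub (χ χ' : DForm (I.prod 𝓘(ℝ, ℝ)) (F × unitIoo) k) : hor (χ - χ') = hor χ - hor χ' :=
  rfl

theorem vert_sub (χ χ' : DForm (I.prod 𝓘(ℝ, ℝ)) (F × unitIoo) (k + 1)) :
    vert (χ - χ') = vert χ - vert χ' := rfl

theorem pairing_add {Φ Ψ : HForm I F k} {r : unitIoo} (hΦ : Φ.slice r ∈ sqIntegrable g k)
    (hΨ : Ψ.slice r ∈ sqIntegrable g k) {ζ : DForm I F k} (hζ : ζ ∈ sqIntegrable g k) :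
    pairing g (Φ + Ψ) ζ r = pairing g Φ ζ r + pairing g Ψ ζ r :=
  inner_add_left (𝕜 := ℝ) (E := SqIntForm g k) ⟨Φ.slice r, hΦ⟩ ⟨Ψ.slice r, hΨ⟩ ⟨ζ, hζ⟩

theorem pairing_sub {Φ Ψ : HForm I F k} {r : unitIoo} (hΦ : Φ.slice r ∈ sqIntegrable g k)
    (hΨ : Ψ.slice r ∈ sqIntegrable g k) {ζ : DForm I F k} (hζ : ζ ∈ sqIntegrable g k) :
    pairing g (Φ - Ψ) ζ r = pairing g Φ ζ r - pairing g Ψ ζ r :=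
  inner_sub_left (𝕜 := ℝ) (E := SqIntForm g k) ⟨Φ.slice r, hΦ⟩ ⟨Ψ.slice r, hΨ⟩ ⟨ζ, hζ⟩

/-- The average of a family of forms with respect to `cutBump l`. -/
def HForm.avg (l : ℝ) (Φ : HForm I F k) : DForm I F k := radInt (fun s : unitIoo => cutBump l s) Φ

theorem HForm.SqInt.avg_mem {Φ : HForm I F k} (h : Φ.SqInt g w) {l : ℝ} (hl : 1 ≤ l) :
    Φ.avg l ∈ sqIntegrable g k := h.radInt_mem ((isBump_cutBump hl).isMultiplier w)

theorem HForm.SqInt.integral_avg {Φ : HForm I F k} (h : Φ.SqInt g w) {l : ℝ} (hl : 1 ≤ l)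
    {ζ : DForm I F k} (hζ : ζ ∈ sqIntegrable g k) :
    ∫ x, formInner g x (Φ.avg l x) (ζ x) ∂(riemVolume g)
      = ∫ s : unitIoo, cutBump l s * pairing g Φ ζ s ∂iooVol :=
  h.pairing_radInt ((isBump_cutBump hl).isMultiplier w) hζ

/-- The form ψ is described by its two parts rather than as a pull-back, so that ψ = 0 is allowed
even when pull-backs of degree k+1 fail to be square integrable. The statement on kernels needs
this. -/
theorem mem_dMaxGraph_conePull (hw : -1 < expo E c k) {η : SqIntForm g k}
    {φ : SqIntForm g (k + 1)} (h : (L2Form.mk η, L2Form.mk φ) ∈ dMaxGraph g k)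
    {ψ : SqIntForm (coneMetric g c) (k + 1)} (h1 : hor ψ.1 = HForm.const φ.1) (h2 : vert ψ.1 = 0) :
    (L2Form.mk (conePull g hw η), L2Form.mk ψ) ∈ dMaxGraph (coneMetric g c) k := by
  refine mem_dMaxGraph_cone (Φ := HForm.const η.1) (conePullback_eq _)
    (fun ζ θ hp => Filter.Eventually.of_forall fun r => ?_) fun Z hZ => ?_
  · rw [h1]
    exact mk_mem_dMaxGraph.1 h ζ θ hp
  · rw [h2]
    refine (hZ.integral_dR g η.1).trans ?_
    have h3 : ∀ p : F × unitIoo, formInner g p.1 ((0 : HForm I F k) p) (Z p) = 0 :=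
      fun p => formInner_zero_left g p.1 _
    simp only [h3, integral_zero, neg_zero]

theorem l2Pull_mem_ker (hw : -1 < expo E c k) {y : L2Form g k} (hy : y ∈ dMaxKer g k) :
    l2Pull g hw y ∈ dMaxKer (coneMetric g c) k := by
  obtain ⟨φ, rfl⟩ := L2Form.mk_surjective y
  exact mem_dMaxGraph_conePull hw (φ := 0) (ψ := 0) hy rfl rfl

/-- The exponent in degree k exceeds the one in degree k+1 by 2c > 0, so a primitive can be pulled
back as well. -/
theorem l2Pull_mem_range (hc : 0 < c) (hw : -1 < expo E c (k + 1)) {y : L2Form g (k + 1)}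
    (hy : y ∈ dMaxRange g k) : l2Pull g hw y ∈ dMaxRange (coneMetric g c) k := by
  obtain ⟨⟨a, b⟩, hab, rfl⟩ := hy
  obtain ⟨η, rfl⟩ := L2Form.mk_surjective a
  obtain ⟨φ, rfl⟩ := L2Form.mk_surjective b
  have hw' : -1 < expo E c k := by
    rw [expo_succ] at hw
    linarith
  exact ⟨_, mem_dMaxGraph_conePull hw' hab (ψ := conePull g hw φ) (hor_conePullback _)
    (vert_conePullback _), rfl⟩

/-- Averaging the horizontal part of a primitive against a bump of integral 1 gives a primitive on
F, since the average of a constant family is its value. -/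
theorem mk_mem_dMaxRange_of_conePull (hw : -1 < expo E c (k + 1))
    {η : SqIntForm (coneMetric g c) k} {φ : SqIntForm g (k + 1)}
    (h : (L2Form.mk η, L2Form.mk (conePull g hw φ)) ∈ dMaxGraph (coneMetric g c) k) :
    L2Form.mk φ ∈ dMaxRange g k := by
  have hη := sqInt_hor η.2
  refine ⟨(L2Form.mk ⟨(hor η.1).avg 1, hη.avg_mem le_rfl⟩, L2Form.mk φ), ?_, rfl⟩
  refine mk_mem_dMaxGraph.2 fun ζ θ hp => ?_
  have h1 := integral_pairing_hor_of_mem_graph h hp (isBump_cutBump le_rfl)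
  refine (hη.integral_avg le_rfl (hp.right.mem_sqIntegrable g)).trans (h1.trans ?_)
  have h2 : hor (conePull g hw φ).1 = HForm.const φ.1 := hor_conePullback φ.1
  rw [h2]
  refine (integral_mul_const (L := ℝ) (∫ x, formInner g x (φ.1 x) (ζ x) ∂(riemVolume g)) _).trans ?_
  rw [integral_cutBump le_rfl]
  exact one_mul _

theorem mem_dMaxRange_of_l2Pull (hw : -1 < expo E c (k + 1)) {y : L2Form g (k + 1)}
    (hy : l2Pull g hw y ∈ dMaxRange (coneMetric g c) k) : y ∈ dMaxRange g k := by
  obtain ⟨φ, rfl⟩ := L2Form.mk_surjective y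
  obtain ⟨⟨a, b⟩, hab, hb⟩ := hy
  obtain ⟨η, rfl⟩ := L2Form.mk_surjective a
  have hb' : b = L2Form.mk (conePull g hw φ) := hb
  rw [hb'] at hab
  exact mk_mem_dMaxRange_of_conePull hw hab

/-! ### Closed forms of positive degree on the cone -/

section Closed

variable {χ : SqIntForm (coneMetric g c) (k + 1)}

/-- The horizontal part of a closed form is weakly closed along F, and averaging preserves this. -/
theorem mk_avg_mem_ker {χ : SqIntForm (coneMetric g c) k}
    (hχ : L2Form.mk χ ∈ dMaxKer (coneMetric g c) k) {l : ℝ} (hl : 1 ≤ l) :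
    L2Form.mk (g := g) ⟨(hor χ.1).avg l, (sqInt_hor χ.2).avg_mem hl⟩ ∈ dMaxKer g k :=
  mk_mem_dMaxKer.2 fun _ _ hp => ((sqInt_hor χ.2).integral_avg hl
    (hp.right.mem_sqIntegrable g)).trans
      (integral_pairing_hor_of_mem_ker hχ hp (isBump_cutBump hl))

/-- The homotopy formula hor χ = d_F ∫ κ vert χ + average, in weak form: the scalar reconstruction
lemma is applied to r ↦ ⟨hor χ, ζ⟩, whose weak derivative is ⟨vert χ, θ⟩. -/
theorem ae_pairing_hor_eq (hχ : L2Form.mk χ ∈ dMaxKer (coneMetric g c) (k + 1))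
    {ζ : DForm I F (k + 1)} {θ : DForm I F k} (hp : IsCoPair g ζ θ) {l : ℝ} (hl : 1 ≤ l) :
    ∀ᵐ r ∂iooVol, pairing g (hor χ.1) ζ r = ∫ s, cutKer l r s * pairing g (vert χ.1) θ s ∂iooVol
      + ∫ x, formInner g x ((hor χ.1).avg l x) (ζ x) ∂(riemVolume g) := by
  have hζ := hp.left.mem_sqIntegrable g
  have hθ := hp.right.mem_sqIntegrable g
  have hh := sqInt_hor χ.2
  have hv := sqInt_vert χ.2
  have key := ae_eq_integral_of_weak_deriv (measurable_pairing g hh.meas hζ.1)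
    (hh.integrable_sq_pairing hζ) (measurable_pairing g hv.meas hθ.1)
    (hv.integrable_sq_pairing hθ) (fun a ha => integral_pairing_deriv_succ hχ hp ha) hl
  filter_upwards [key] with r hr
  rw [hr, hh.integral_avg hl hζ, sub_eq_add_neg, ← integral_neg]
  simp only [cutBump, Pi.neg_apply, neg_mul]

/-- Surjectivity: the radial primitive Kβ of the vertical part is square integrable because the
exponent in degree k also exceeds -1. By the homotopy formula its derivative is χ minus the
pull-back of the average of hor χ. -/
theorem exists_avg_sub_mem_range (hc : 0 < c) (hw : -1 < expo E c (k + 1))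
    (hχ : L2Form.mk χ ∈ dMaxKer (coneMetric g c) (k + 1)) :
    ∃ y ∈ dMaxKer g (k + 1), L2Form.mk χ - l2Pull g hw y ∈ dMaxRange (coneMetric g c) k := by
  have hw' : -1 < expo E c k := by
    rw [expo_succ] at hw
    linarith
  have hh := sqInt_hor χ.2
  have hv := sqInt_vert χ.2
  have hκ := isHSKernel_cutKer_one hw'
  have hu := hv.kerInt hκ
  let φ : SqIntForm g (k + 1) := ⟨(hor χ.1).avg 1, hh.avg_mem le_rfl⟩
  refine ⟨L2Form.mk φ, mk_avg_mem_ker hχ le_rfl,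
    (L2Form.mk ⟨_, pull_mem_sqIntegrable hu⟩, L2Form.mk (χ - conePull g hw φ)), ?_, rfl⟩
  refine mem_dMaxGraph_cone rfl (fun ζ θ hp => ?_) fun Z hZ => ?_
  · have hζ := hp.left.mem_sqIntegrable g
    filter_upwards [ae_pairing_hor_eq hχ hp le_rfl, hv.pairing_kerInt hκ
      (hp.right.mem_sqIntegrable g), hh.slice_mem] with r h1 h2 h3
    have h4 : hor (χ - conePull g hw φ).1 = hor χ.1 - HForm.const φ.1 :=
      (hor_sub χ.1 (conePullback φ.1)).trans (congrArg (hor χ.1 - ·) (hor_conePullback φ.1))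
    rw [h2, h4, pairing_sub h3 (show (HForm.const φ.1).slice r ∈ _ from φ.2) hζ, h1]
    exact (add_sub_cancel_right _ _).symm
  · rw [hv.integral_kerInt_dR hκ (isPrimitiveKernel_cutKer 1) hZ]
    have h4 : vert (χ - conePull g hw φ).1 = vert χ.1 :=
      (vert_sub χ.1 (conePullback φ.1)).trans
        ((congrArg (vert χ.1 - ·) (vert_conePullback φ.1)).trans (sub_zero _))
    rw [h4]

/-- Cauchy–Schwarz reduces the claim to the L² convergence of the averages. -/
theorem tendsto_integral_avg (hv : expo E c (k + 1) ≤ -1) {ζ : DForm I F (k + 1)}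
    (hζ : ζ ∈ sqIntegrable g (k + 1)) :
    Filter.Tendsto (fun n : ℕ => ∫ x, formInner g x ((hor χ.1).avg ((n : ℝ) + 1) x) (ζ x)
      ∂(riemVolume g)) Filter.atTop (𝓝 0) := by
  have hh := sqInt_hor χ.2
  have h1 := (hh.tendsto_radInt_cutBump hv).mul_const
    (∫ x, formInner g x (ζ x) (ζ x) ∂(riemVolume g))
  rw [zero_mul] at h1
  have h2 : Filter.Tendsto (fun n : ℕ => (∫ x, formInner g x ((hor χ.1).avg ((n : ℝ) + 1) x) (ζ x)
      ∂(riemVolume g)) ^ 2) Filter.atTop (𝓝 0) :=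
    squeeze_zero (fun n => sq_nonneg _)
      (fun n => sq_integral_formInner_le g (hh.avg_mem (by simp)) hζ) h1
  have h3 := h2.sqrt
  rw [Real.sqrt_zero] at h3
  refine squeeze_zero_norm (fun n => ?_) h3
  rw [Real.norm_eq_abs, Real.sqrt_sq_eq_abs]

/-- For an exponent below 1 in degree k, the vertical part is integrable up to the tip and its
primitive from 0 is square integrable. Letting l tend to infinity in the homotopy formula removes
the average and replaces the kernel by `zeroKer`. -/
theorem mem_range_of_expo_lt_one (hv : expo E c (k + 1) ≤ -1) (hw : expo E c k < 1)
    (hχ : L2Form.mk χ ∈ dMaxKer (coneMetric g c) (k + 1)) :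
    L2Form.mk χ ∈ dMaxRange (coneMetric g c) k := by
  have hvert := sqInt_vert χ.2
  have hκ := isHSKernel_zeroKer hw
  have hu := hvert.kerInt hκ
  refine ⟨(L2Form.mk ⟨_, pull_mem_sqIntegrable hu⟩, L2Form.mk χ), ?_, rfl⟩
  refine mem_dMaxGraph_cone rfl (fun ζ θ hp => ?_) fun Z hZ =>
    hvert.integral_kerInt_dR hκ isPrimitiveKernel_zeroKer hZ
  have hθ := hp.right.mem_sqIntegrable g
  have h1 : ∀ᵐ r ∂iooVol, ∀ n : ℕ, pairing g (hor χ.1) ζ r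
      = ∫ s, cutKer ((n : ℝ) + 1) r s * pairing g (vert χ.1) θ s ∂iooVol
        + ∫ x, formInner g x ((hor χ.1).avg ((n : ℝ) + 1) x) (ζ x) ∂(riemVolume g) :=
    ae_all_iff.2 fun n => ae_pairing_hor_eq hχ hp (by simp)
  -- Since s^{-w} is integrable for w < 1, the constant 1 is a multiplier; this supplies the
  -- dominating function below.
  have hQ : Integrable (pairing g (vert χ.1) θ) iooVol := by
    have hm : IsMultiplier (expo E c k) fun _ => 1 :=
      ⟨measurable_const, by simpa using integrable_rpow_coe (w := -expo E c k) (by linarith)⟩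
    simpa using hm.integrable_mul (measurable_pairing g hvert.meas hθ.1).aestronglyMeasurable
      (hvert.integrable_sq_pairing hθ)
  filter_upwards [h1, hvert.pairing_kerInt hκ hθ] with r h1 h2
  rw [h2]
  -- For each s > 0 the function `cut l` vanishes at s once l is large, so the kernels converge
  -- pointwise to `zeroKer`.
  have h3 : Filter.Tendsto (fun n : ℕ =>
      ∫ s, cutKer ((n : ℝ) + 1) r s * pairing g (vert χ.1) θ s ∂iooVol) Filter.atTop
      (𝓝 (∫ s, zeroKer r s * pairing g (vert χ.1) θ s ∂iooVol)) := by
    refine tendsto_integral_of_dominated_convergence _ (fun n =>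
      (((measurable_cutKer _).of_uncurry_left (x := r)).mul
        (measurable_pairing g hvert.meas hθ.1)).aestronglyMeasurable) hQ.norm
      (fun n => Filter.Eventually.of_forall fun s => ?_) (Filter.Eventually.of_forall fun s => ?_)
    · rw [norm_mul]
      exact mul_le_of_le_one_left (norm_nonneg _) (abs_cutKer_le _ _ _)
    · refine tendsto_const_nhds.congr' ?_
      filter_upwards [tendsto_one_div_add_atTop_nhds_zero_nat.eventually_lt_const s.2.1] with n hn
      rw [div_lt_iff₀ (by positivity)] at hn
      rw [cutKer, cut_eq_zero (by linarith), sub_zero]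
      rfl
  have h4 := h3.add (tendsto_integral_avg (χ := χ) hv (hp.left.mem_sqIntegrable g))
  rw [add_zero] at h4
  exact tendsto_nhds_unique h4 (tendsto_const_nhds.congr h1)

/-- The difference of two averaging bumps is minus the derivative of the bump cut 1 - cut l. By ∂_r
α = d_F β, the difference of the averages of α is d_F of ∫ (cut 1 - cut l) β. -/
theorem mk_avg_sub_mem_range (hχ : L2Form.mk χ ∈ dMaxKer (coneMetric g c) (k + 1)) {l : ℝ}
    (hl : 1 ≤ l) : L2Form.mk (g := g) ⟨(hor χ.1).avg 1, (sqInt_hor χ.2).avg_mem le_rfl⟩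
      - L2Form.mk (g := g) ⟨(hor χ.1).avg l, (sqInt_hor χ.2).avg_mem hl⟩ ∈ dMaxRange g k := by
  have hh := sqInt_hor χ.2
  have hv := sqInt_vert χ.2
  have hb := isBump_cut_sub hl
  refine ⟨(L2Form.mk ⟨_, hv.radInt_mem (hb.isMultiplier _)⟩, L2Form.mk
    ((⟨(hor χ.1).avg 1, hh.avg_mem le_rfl⟩ : SqIntForm g (k + 1))
      - (⟨(hor χ.1).avg l, hh.avg_mem hl⟩ : SqIntForm g (k + 1)))), ?_, rfl⟩
  refine mk_mem_dMaxGraph.2 fun ζ θ hp => ?_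
  have hζ := hp.left.mem_sqIntegrable g
  refine (hv.pairing_radInt (hb.isMultiplier _) (hp.right.mem_sqIntegrable g)).trans ?_
  have h1 := integral_pairing_deriv_succ hχ hp hb
  refine Eq.trans ?_ (inner_sub_left (𝕜 := ℝ) (E := SqIntForm g (k + 1))
    ⟨(hor χ.1).avg 1, hh.avg_mem le_rfl⟩ ⟨(hor χ.1).avg l, hh.avg_mem hl⟩ ⟨ζ, hζ⟩).symm
  refine Eq.trans ?_ (congrArg₂ (· - ·) (hh.integral_avg le_rfl hζ) (hh.integral_avg hl hζ)).symm
  have hi : ∀ l : ℝ, 1 ≤ l → Integrable (fun s : unitIoo => cutBump l s *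
      pairing g (hor χ.1) ζ s) iooVol := fun l hl =>
    ((isBump_cutBump hl).isMultiplier _).integrable_mul
      (measurable_pairing g hh.meas hζ.1).aestronglyMeasurable (hh.integrable_sq_pairing hζ)
  rw [← integral_sub (hi 1 le_rfl) (hi l hl), eq_comm, ← sub_eq_zero, sub_eq_add_neg, ← neg_eq_zero,
    neg_add, neg_neg, ← h1, ← integral_neg]
  congr 1
  refine integral_congr_ae (Filter.Eventually.of_forall fun s => ?_)
  have h2 : deriv (cut 1 - cut l) s = deriv (cut 1) s - deriv (cut l) s :=
    ((hasDerivAt_cut 1 s).sub (hasDerivAt_cut l s)).deriv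
  simp only [h2, cutBump, Pi.neg_apply]
  ring

/-- The average at l = 1 is the limit of its differences with the averages at l → ∞, all of which
lie in the range. -/
theorem mk_avg_mem_range_of_isClosed (hv : expo E c (k + 1) ≤ -1)
    (hcl : IsClosed (dMaxRange g k : Set (L2Form g (k + 1))))
    (hχ : L2Form.mk χ ∈ dMaxKer (coneMetric g c) (k + 1)) :
    L2Form.mk (g := g) ⟨(hor χ.1).avg 1, (sqInt_hor χ.2).avg_mem le_rfl⟩ ∈ dMaxRange g k := by
  have hh := sqInt_hor χ.2
  have hn : ∀ n : ℕ, (1 : ℝ) ≤ (n : ℝ) + 1 := fun n => by simp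
  have h1 : Filter.Tendsto (fun n : ℕ => L2Form.mk (g := g)
      ⟨(hor χ.1).avg ((n : ℝ) + 1), hh.avg_mem (hn n)⟩) Filter.atTop (𝓝 0) := by
    rw [tendsto_zero_iff_norm_tendsto_zero]
    have h2 := (hh.tendsto_radInt_cutBump hv).sqrt
    rw [Real.sqrt_zero] at h2
    refine h2.congr fun n => ?_
    exact (congrArg Real.sqrt (L2Form.norm_mk_sq g
      ⟨(hor χ.1).avg ((n : ℝ) + 1), hh.avg_mem (hn n)⟩).symm).trans (Real.sqrt_sq (norm_nonneg _))
  have h3 := h1.const_sub (L2Form.mk (g := g) ⟨(hor χ.1).avg 1, hh.avg_mem le_rfl⟩)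
  rw [sub_zero] at h3
  exact hcl.mem_of_tendsto h3 (Filter.Eventually.of_forall fun n => mk_avg_sub_mem_range hχ (hn n))

/-- The homotopy formula leaves the pull-back of the average, which closed range makes the
derivative of some τ. Here π^*τ is square integrable although pull-backs of degree k+1 need not be,
since only the exponent in degree k has to exceed -1. -/
theorem mem_range_of_isClosed (hv : expo E c (k + 1) ≤ -1) (hw : -1 < expo E c k)
    (hcl : IsClosed (dMaxRange g k : Set (L2Form g (k + 1))))
    (hχ : L2Form.mk χ ∈ dMaxKer (coneMetric g c) (k + 1)) :
    L2Form.mk χ ∈ dMaxRange (coneMetric g c) k := by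
  have hh := sqInt_hor χ.2
  have hvert := sqInt_vert χ.2
  obtain ⟨⟨a, b⟩, hab, hb⟩ := mk_avg_mem_range_of_isClosed hv hcl hχ
  obtain ⟨τ, rfl⟩ := L2Form.mk_surjective a
  obtain rfl : b = L2Form.mk (g := g) ⟨(hor χ.1).avg 1, hh.avg_mem le_rfl⟩ := hb
  have hκ := isHSKernel_cutKer_one hw
  have hu := hvert.kerInt hκ
  have hτ := sqInt_const τ.2 hw
  let υ : SqIntForm (coneMetric g c) k := ⟨_, pull_mem_sqIntegrable hu⟩
  refine ⟨(L2Form.mk (υ + conePull g hw τ), L2Form.mk χ), ?_, rfl⟩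
  refine mem_dMaxGraph_cone (Φ := kerInt (cutKer 1) (vert χ.1) + HForm.const τ.1) ?_
    (fun ζ θ hp => ?_) fun Z hZ => ?_
  · exact congrArg (pull (kerInt (cutKer 1) (vert χ.1)) + ·) (conePullback_eq τ.1)
  · have hθ := hp.right.mem_sqIntegrable g
    filter_upwards [ae_pairing_hor_eq hχ hp le_rfl, hvert.pairing_kerInt hκ hθ,
      hu.slice_mem] with r h1 h2 h3
    rw [pairing_add h3 (show (HForm.const τ.1).slice r ∈ _ from τ.2) hθ, h1, h2]
    exact congrArg (_ + ·) (mk_mem_dMaxGraph.1 hab ζ θ hp)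
  · have h1 := hvert.integral_kerInt_dR hκ (isPrimitiveKernel_cutKer 1) hZ
    have h2 := hZ.integral_dR g τ.1
    have h3 : ∀ p : F × unitIoo, formInner g p.1
        ((kerInt (cutKer 1) (vert χ.1) + HForm.const τ.1) p) (Z.dR p)
        = formInner g p.1 (kerInt (cutKer 1) (vert χ.1) p) (Z.dR p)
          + formInner g p.1 (HForm.const τ.1 p) (Z.dR p) := fun p => formInner_add_left g p.1 _ _ _
    simp only [h3]
    rw [integral_add (hu.integrable_test hZ.dR) (hτ.integrable_test hZ.dR), h1]
    exact (congrArg (_ + ·) h2).trans (add_zero _)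

end Closed

/-! ### Closed functions on the cone -/

section DegreeZero

/-- A function with vanishing weak radial derivative equals its radial average. The identity is
known after pairing with each test function on F; a dense set of slices passes to test functions on
the cone, which separate L². -/
theorem l2Pull_avg (hw : -1 < expo E c 0) {χ : SqIntForm (coneMetric g c) 0}
    (hχ : L2Form.mk χ ∈ dMaxKer (coneMetric g c) 0) :
    L2Form.mk χ = l2Pull g hw
      (L2Form.mk (g := g) ⟨(hor χ.1).avg 1, (sqInt_hor χ.2).avg_mem le_rfl⟩) := by
  have hh := sqInt_hor χ.2
  let φ : SqIntForm g 0 := ⟨(hor χ.1).avg 1, hh.avg_mem le_rfl⟩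
  have h4 : hor (χ - conePull g hw φ).1 = hor χ.1 - HForm.const φ.1 :=
    (hor_sub χ.1 (conePullback φ.1)).trans (congrArg (hor χ.1 - ·) (hor_conePullback φ.1))
  have hΦ : (hor χ.1 - HForm.const φ.1).SqInt g (expo E c 0) :=
    h4 ▸ sqInt_hor (χ - conePull g hw φ).2
  have h1 : ∀ ζ : DForm I F 0, ζ.IsTest →
      ∀ᵐ r ∂iooVol, pairing g (hor χ.1 - HForm.const φ.1) ζ r = 0 := fun ζ hζ => by
    have hζ' := hζ.mem_sqIntegrable g
    -- The weak derivative is 0, so the kernel term disappears and only the average remains; the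
    -- weight given to the zero function is immaterial.
    have key := ae_eq_integral_of_weak_deriv (Q := fun _ => 0) (w := 0)
      (measurable_pairing g hh.meas hζ'.1) (hh.integrable_sq_pairing hζ') measurable_const
      (by simp) (fun a ha => by
        simpa using integral_pairing_deriv_zero hχ hζ ha) (le_refl (1 : ℝ))
    filter_upwards [key, hh.slice_mem] with r hr h3
    rw [pairing_sub h3 (show (HForm.const φ.1).slice r ∈ _ from φ.2) hζ', hr]
    have h5 : pairing g (HForm.const φ.1) ζ r = _ := hh.integral_avg le_rfl hζ'
    rw [h5]
    simp only [mul_zero, integral_zero, zero_sub, cutBump, Pi.neg_apply, neg_mul]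
    rw [integral_neg, sub_neg_eq_add, neg_add_cancel]
  have h2 : ∀ Z : HForm I F 0, Z.IsTest →
      ∫ p, formInner g p.1 ((hor χ.1 - HForm.const φ.1) p) (Z p) ∂(baseVol g) = 0 := fun Z hZ => by
    rw [integral_baseVol_eq (hΦ.integrable_test hZ)]
    obtain ⟨D, hD, hD'⟩ := TopologicalSpace.exists_countable_dense unitIoo
    have h5 : ∀ᵐ r ∂iooVol, ∀ q ∈ D, pairing g (hor χ.1 - HForm.const φ.1) (Z.slice q) r = 0 :=
      (ae_ball_iff hD).2 fun q _ => h1 _ (hZ.slice q)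
    refine (integral_congr_ae (g := fun _ => (0 : ℝ)) ?_).trans (integral_zero _ _)
    filter_upwards [h5, hΦ.slice_mem] with r h6 h7
    have h8 := hZ.continuous_pairing g h7
    have h9 := Continuous.ext_on hD' h8 (continuous_const (y := (0 : ℝ))) fun q hq => h6 q hq
    exact congrFun h9 r
  refine sub_eq_zero.1 (mk_eq_zero_of_integral_test (φ := χ - conePull g hw φ) fun Y hY => ?_)
  rw [integral_cone]
  have h5 : ∀ p : F × unitIoo, (p.2 : ℝ) ^ (c * Module.finrank ℝ E) *
      formInner (coneMetric g c) p ((χ - conePull g hw φ).1 p) (Y p)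
      = formInner g p.1 ((hor χ.1 - HForm.const φ.1) p) (reweight (expo E c 0) (hor Y) p) := by
    intro p
    rw [← formInner_reweight, ← h4]
    exact formInner_cone_zero g c p _ _ _
  simp only [h5]
  exact h2 _ (hY.hor.reweight _)

end DegreeZero

end Cohomology

/-! ### The induced map in cohomology -/

section Theorem

variable {E : Type*} [NormedAddCommGroup E] [NormedSpace ℝ E] [FiniteDimensional ℝ E]
  [MeasurableSpace E] [BorelSpace E]
  {H : Type*} [TopologicalSpace H] {I : ModelWithCorners ℝ E H} [I.Boundaryless]
  {F : Type*} [TopologicalSpace F] [T2Space F] [ChartedSpace H F] [IsManifold I ∞ F]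
  [MeasurableSpace F] [BorelSpace F] [SecondCountableTopology F] {k : ℕ}
  {g : RiemMetric I F} {c : ℝ}

/-- One direction makes the induced map well defined, the other makes it injective. In degree 0,
where coboundaries vanish, injectivity of the pull-back itself is used. -/
theorem l2Pull_mem_coboundaries (hc : 0 < c) (hw : -1 < expo E c k) {y : L2Form g k} :
    l2Pull g hw y ∈ l2Coboundaries (coneMetric g c) k ↔ y ∈ l2Coboundaries g k := by
  cases k with
  | zero => exact ⟨fun h => l2Pull_injective hw (h.trans (map_zero _).symm),
      fun h => (congrArg (l2Pull g hw) h).trans (map_zero _)⟩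
  | succ k => exact ⟨mem_dMaxRange_of_l2Pull hw, l2Pull_mem_range hc hw⟩

theorem exists_sub_l2Pull_mem_coboundaries (hc : 0 < c) (hw : -1 < expo E c k)
    {z : L2Form (coneMetric g c) k} (hz : z ∈ dMaxKer (coneMetric g c) k) :
    ∃ y ∈ dMaxKer g k, z - l2Pull g hw y ∈ l2Coboundaries (coneMetric g c) k := by
  obtain ⟨χ, rfl⟩ := L2Form.mk_surjective z
  cases k with
  | zero => exact ⟨_, mk_avg_mem_ker hz le_rfl, sub_eq_zero.2 (l2Pull_avg hw hz)⟩
  | succ k => exact exists_avg_sub_mem_range hc hw hz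

/-- The map induced by the pull-back on the kernels of `d_max`. -/
def kerPull (g : RiemMetric I F) (hw : -1 < expo E c k) :
    dMaxKer g k →ₗ[ℝ] dMaxKer (coneMetric g c) k :=
  (l2Pull g hw).toLinearMap.restrict fun _ hy => l2Pull_mem_ker hw hy

/-- The map induced by the pull-back in cohomology. -/
def cohomologyPull (g : RiemMetric I F) (hc : 0 < c) (hw : -1 < expo E c k) :
    L2Cohomology g k →ₗ[ℝ] L2Cohomology (coneMetric g c) k :=
  Submodule.mapQ _ _ (kerPull g hw) fun _ hy => (l2Pull_mem_coboundaries hc hw).2 hy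

theorem cohomologyPull_bijective (hc : 0 < c) (hw : -1 < expo E c k) :
    Function.Bijective (cohomologyPull g hc hw) := by
  constructor
  · rw [injective_iff_map_eq_zero]
    intro y hy
    obtain ⟨y, rfl⟩ := Submodule.Quotient.mk_surjective _ y
    have h1 : kerPull g hw y ∈ (l2Coboundaries (coneMetric g c) k).comap
        (dMaxKer (coneMetric g c) k).subtype := (Submodule.Quotient.mk_eq_zero _).1 hy
    exact (Submodule.Quotient.mk_eq_zero _).2 ((l2Pull_mem_coboundaries hc hw).1 h1)
  · intro z
    obtain ⟨z, rfl⟩ := Submodule.Quotient.mk_surjective _ z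
    obtain ⟨y, hy, h⟩ := exists_sub_l2Pull_mem_coboundaries hc hw z.2
    refine ⟨Submodule.Quotient.mk ⟨y, hy⟩, Eq.symm ?_⟩
    exact (Submodule.Quotient.eq ((l2Coboundaries (coneMetric g c) k).comap
      (dMaxKer (coneMetric g c) k).subtype)).2 h

theorem subsingleton_cohomology
    (h : ∀ χ : SqIntForm (coneMetric g c) (k + 1),
      L2Form.mk χ ∈ dMaxKer (coneMetric g c) (k + 1) →
        L2Form.mk χ ∈ dMaxRange (coneMetric g c) k) :
    Subsingleton (L2Cohomology (coneMetric g c) (k + 1)) := by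
  refine subsingleton_of_forall_eq 0 fun q => ?_
  obtain ⟨⟨z, hz⟩, rfl⟩ := Submodule.Quotient.mk_surjective _ q
  obtain ⟨χ, rfl⟩ := L2Form.mk_surjective z
  exact (Submodule.Quotient.mk_eq_zero _).2 (h χ hz)

end Theorem

end ConeL2

end

/-! ### The theorem -/

open ConeL2

theorem mainTheorem4 {f : ℕ} {F : Type*} [TopologicalSpace F] [T2Space F]
    [SecondCountableTopology F] [ChartedSpace (EuclideanSpace ℝ (Fin f)) F] [IsManifold (𝓡 f) ∞ F]
    [MeasurableSpace F] [BorelSpace F] (g : RiemMetric (𝓡 f) F) (c : ℝ) (hc : 0 < c)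
    (h : c < 1 ∨ (1 ≤ c ∧ Even f) ∨
      (1 ≤ c ∧ Odd f ∧ IsClosed (dMaxRange g ((f - 1) / 2) : Set (L2Form g ((f - 1) / 2 + 1)))))
    (i : ℕ) :
    ((i : ℝ) < (f : ℝ) / 2 + 1 / (2 * c) →
      ∃ e : L2Cohomology g i ≃ₗ[ℝ] L2Cohomology (coneMetric g c) i,
        ∀ (φ : SqIntForm g i) (hφ : L2Form.mk φ ∈ dMaxKer g i),
          ∃ (hπ : conePullback φ.1 ∈ sqIntegrable (coneMetric g c) i)
            (hπ' : L2Form.mk (g := coneMetric g c) ⟨conePullback φ.1, hπ⟩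
              ∈ dMaxKer (coneMetric g c) i),
            e (Submodule.Quotient.mk ⟨L2Form.mk φ, hφ⟩) =
              Submodule.Quotient.mk ⟨L2Form.mk ⟨conePullback φ.1, hπ⟩, hπ'⟩) ∧
    ((f : ℝ) / 2 + 1 / (2 * c) ≤ (i : ℝ) → Subsingleton (L2Cohomology (coneMetric g c) i)) := by
  have hexpo : ∀ k : ℕ, expo (EuclideanSpace ℝ (Fin f)) c k = c * (f - 2 * k) := fun k => by
    rw [expo, finrank_euclideanSpace_fin]
  -- After multiplication by 2c the threshold becomes c f + 1, so comparing i with it amounts to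
  -- comparing c(f - 2i) with -1.
  have hmul : 2 * c * ((f : ℝ) / 2 + 1 / (2 * c)) = c * f + 1 := by field_simp
  refine ⟨fun hi => ?_, fun hi => ?_⟩
  · have hw : -1 < expo (EuclideanSpace ℝ (Fin f)) c i := by
      have := mul_lt_mul_of_pos_left hi (show 0 < 2 * c by positivity)
      rw [hexpo]
      linarith
    refine ⟨LinearEquiv.ofBijective (cohomologyPull g hc hw) (cohomologyPull_bijective hc hw),
      fun φ hφ => ⟨conePullback_mem φ.2 hw, l2Pull_mem_ker hw hφ, rfl⟩⟩
  · have hi' := mul_le_mul_of_nonneg_left hi (show 0 ≤ 2 * c by positivity)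
    rw [hmul] at hi'
    cases i with
    | zero =>
      -- The threshold is positive, so degree 0 never lies above it.
      have : 0 ≤ c * f := by positivity
      rw [Nat.cast_zero, mul_zero] at hi'
      linarith
    | succ k =>
      have hv : expo (EuclideanSpace ℝ (Fin f)) c (k + 1) ≤ -1 := by
        rw [hexpo]
        linarith
      refine subsingleton_cohomology fun χ hχ => ?_
      by_cases hw : expo (EuclideanSpace ℝ (Fin f)) c k < 1
      · exact mem_range_of_expo_lt_one hv hw hχ
      -- From c(f - 2k - 2) ≤ -1 and c(f - 2k) ≥ 1 it follows that 2k < f < 2k + 2. Thus f = 2k + 1,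
      -- and the exponent in degree k is c itself.
      · have hlt : f < 2 * k + 2 := by
          by_contra hlt
          have h1 : ((2 * k + 2 : ℕ) : ℝ) ≤ f := Nat.cast_le.2 (not_lt.1 hlt)
          push_cast at h1
          have h2 := mul_le_mul_of_nonneg_left h1 hc.le
          push_cast at hi'
          linarith
        have hgt : 2 * k < f := by
          by_contra hgt
          have h1 : (f : ℝ) ≤ ((2 * k : ℕ) : ℝ) := Nat.cast_le.2 (not_lt.1 hgt)
          push_cast at h1
          have h2 := mul_le_mul_of_nonneg_left h1 hc.le
          rw [hexpo] at hw
          linarith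
        have hf : f = 2 * k + 1 := by omega
        have hfr : (f : ℝ) = 2 * k + 1 := by exact_mod_cast hf
        have hwc : expo (EuclideanSpace ℝ (Fin f)) c k = c := by
          rw [hexpo, hfr]
          ring
        -- The first alternative contradicts c ≥ 1 and the second contradicts the oddness of f; the
        -- third is closed range in degree k = (f - 1)/2.
        rcases h with h | ⟨-, h⟩ | ⟨-, -, h⟩
        · exact absurd (hwc.trans_lt h) hw
        · exact absurd h (by rw [hf, Nat.not_even_iff_odd]; exact odd_two_mul_add_one k)
        · have hk : (f - 1) / 2 = k := by omega
          rw [hk] at h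
          exact mem_range_of_isClosed hv (by rw [hwc]; linarith) h hχ
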